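/- Let $p\in(2,\infty)$, $L>0$. For an immersed curve $\gamma\in W^{2,p}(0,L;\mathbf R^2)$ (always identified with its $C^1$ representative on $[0,L]$) let $k$ be its signed curvature, $s$ its arclength, $\mathcal B_p[\gamma]=\int_\gamma|k|^p\,ds$ and $\mathcal L[\gamma]=\int_\gamma ds$. The curve $\gamma$ is a *$p$-elastica* if there is $\lambda\in\mathbf R$ with $\frac{d}{d\varepsilon}\big(\mathcal B_p[\gamma+\varepsilon\eta]+\lambda\mathcal L[\gamma+\varepsilon\eta]\big)\big|_{\varepsilon=0}=0$ for all $\eta\in C_c^\infty(0,L;\mathbf R^2)$. For $q\in(0,1)$ put $$F_1(x,q)=\int_0^x\frac{|\cos\theta|^{1-2/p}}{\sqrt{1-q^2\sin^2\theta}}\,d\theta,\quad F_2(x,q)=\int_0^x\frac{d\theta}{(1-q^2\sin^2\theta)^{1/p}},\quad F_1(x,1)=\int_0^x\frac{d\theta}{|\cos\theta|^{2/p}},$$ $$E_1(x,q)=\int_0^x\sqrt{1-q^2\sin^2\theta}\,|\cos\theta|^{1-2/p}d\theta,\qquad E_2(x,q)=\int_0^x(1-q^2\sin^2\theta)^{(p-1)/p}d\theta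 ,$$ let $\mathrm{am}_i(\cdot,q)$ be the inverse function of $F_i(\cdot,q)$ on $\mathbf R$ (also for $q=1$ if $i=1$), $\mathrm{cn}(s,q)=|\cos \mathrm{am}_1(s,q)|^{2/p-1}\cos\mathrm{am}_1(s,q)$, $\mathrm{dn}(s,q)=(1-q^2\sin^2\mathrm{am}_2(s,q))^{1/p}$, $K=F_1(\pi/2,1)<\infty$, $\mathrm{sech}_p\,s=\mathrm{cn}(s,1)$ for $|s|<K$ and $\mathrm{sech}_p\,s=0$ for $|s|\ge K$, and $\tanh_p s=\int_0^s(\mathrm{sech}_p\,t)^p\,dt$. A curve on $[0,L]$ is called linear, wavelike, orbitlike, circular or flat-core if, up to a similarity of the plane (translation, rotation, reflection, dilation) and a reparameterization, it is a piece of, respectively, - $s\mapsto(s,0)$; - $s\mapsto\big(2E_1(\mathrm{am}_1(s,q),q)-s,\ -q\tfrac p{p-1}|\mathrm{cn}(s,q)|^{p-2}\mathrm{cn}(s,q)\big)$ for some $q\in(0,1)$; - $s\mapsto\frac1{q^2}\big(2E_2(\mathrm{am}_2(s,q),q)+(q^2-2)s,\ -\tfrac p{p-1}\mathrm{dn}(s,q)^{p-1}\big)$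 for some $q\in(0,1)$; - $s\mapsto(\cos s,\sin s)$; - a concatenation $\bigoplus_{j=1}^N(\gamma_\ell^{L_j}\oplus\gamma_b^{\sigma_j})$ with $N\ge1$, $L_j\ge0$, $\sigma_j\in\{+,-\}$, where $\gamma_\ell^{L_j}(s)=(-s,0)$ on $[0,L_j]$ and $\gamma_b^{\pm}(s)=\big(2\tanh_p s-s,\ \mp\tfrac p{p-1}(\mathrm{sech}_p\, s)^{p-1}\big)$ on $[-K,K]$, and $\oplus$ translates the second curve so that it starts where the first one ends. **Theorem 1.5.** Let $\gamma:[0,L]\to\mathbf R^2$ be an arclength parameterized $p$-elastica, $Z=\{s\in[0,L]: k(s)=0\}$, and let $\partial Z$ be the boundary of $Z$ relative to $[0,L]$. If $\gamma$ is linear, orbitlike or circular, then $\gamma$ is analytic on $[0,L]$. Suppose from now on that $\partial Z\ne\emptyset$. If $\gamma$ is wavelike, then $\gamma\in W^{3,r}(0,L;\mathbf R^2)$ for every $r\in[1,\frac{p-1}{p-2})$, and $\gamma\notin W^{3,\frac{p-1}{p-2}}(0,L;\mathbf R^2)$. Let $M_p=\lceil\frac2{p-2}\rceil$ (so $M_p\ge1$)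 and, if $\frac2{p-2}\notin\mathbf Z$, $R_p=(M_p-\frac2{p-2})^{-1}$ (so $R_p>1$). If $\gamma$ is flat-core, then: (i) if $\frac2{p-2}\notin\mathbf Z$, then $\gamma\in W^{M_p+2,r}(0,L;\mathbf R^2)$ for every $r\in[1,R_p)$, and $\gamma\notin W^{M_p+2,R_p}(0,L;\mathbf R^2)$; (ii) if $\frac2{p-2}\in\mathbf Z$, then $\gamma\in W^{M_p+2,\infty}(0,L;\mathbf R^2)$; moreover $Z$ is not discrete if and only if it contains a nondegenerate interval, and in that case $\gamma\notin W^{M_p+3,1}(0,L;\mathbf R^2)$. -/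

import Mathlib

open Set MeasureTheory
open scoped ContDiff

noncomputable section

namespace PElastica

/-- The Euclidean plane. -/
abbrev Plane : Type := EuclideanSpace ℝ (Fin 2)

/-- `g` is the weak derivative of order `j` of `f` on the open interval `(0, L)`. -/
def IsWeakDeriv {E : Type*} [NormedAddCommGroup E] [NormedSpace ℝ E]
    (L : ℝ) (j : ℕ) (f g : ℝ → E) : Prop :=
  ∀ φ : ℝ → ℝ, ContDiff ℝ ∞ φ → HasCompactSupport φ → tsupport φ ⊆ Ioo 0 L →
    ∫ x in Ioo 0 L, iteratedDeriv j φ x • f x = (-1 : ℝ) ^ j • ∫ x in Ioo 0 L, φ x • g x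

/-- The Sobolev space `W^{m,r}(0, L; E)`, for `1 ≤ r ≤ ∞`: `f` and its weak derivatives up to
order `m` lie in `L^r(0, L; E)`. -/
def MemSobolev {E : Type*} [NormedAddCommGroup E] [NormedSpace ℝ E]
    (L : ℝ) (m : ℕ) (r : ENNReal) (f : ℝ → E) : Prop :=
  MemLp f r (volume.restrict (Ioo 0 L)) ∧
    ∀ j : ℕ, j ≤ m → ∃ g : ℝ → E, MemLp g r (volume.restrict (Ioo 0 L)) ∧ IsWeakDeriv L j f g

/-! ### Curves on `[0, L]`

A curve is a function `ℝ → Plane` of which only the values on `[0, L]` matter. -/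

/-- The velocity of a curve on `[0, L]` (one-sided at the end points). -/
def velocity (L : ℝ) (γ : ℝ → Plane) (t : ℝ) : Plane :=
  derivWithin γ (Icc 0 L) t

/-- The second derivative of a curve on `[0, L]`. For a curve of class `W^{2,p}` the velocity is
absolutely continuous, so this exists for almost every `t` and equals the weak derivative. -/
def acceleration (L : ℝ) (γ : ℝ → Plane) (t : ℝ) : Plane :=
  derivWithin (velocity L γ) (Icc 0 L) t

/-- The (counterclockwise) signed curvature `det (γ', γ'') / |γ'|³` of a curve on `[0, L]`. -/
def curvature (L : ℝ) (γ : ℝ → Plane) (t : ℝ) : ℝ :=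
  (velocity L γ t 0 * acceleration L γ t 1 - velocity L γ t 1 * acceleration L γ t 0) /
    ‖velocity L γ t‖ ^ 3

/-- The `p`-bending energy `∫ |k|^p ds`. -/
def bendingEnergy (p L : ℝ) (γ : ℝ → Plane) : ℝ :=
  ∫ t in (0 : ℝ)..L, |curvature L γ t| ^ p * ‖velocity L γ t‖

/-- The length `∫ ds`. -/
def curveLength (L : ℝ) (γ : ℝ → Plane) : ℝ :=
  ∫ t in (0 : ℝ)..L, ‖velocity L γ t‖

/-- An immersed curve of class `W^{2,p}` on `[0, L]`, represented by its continuous (hence `C¹`)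
representative. -/
structure IsImmersedSobolevCurve (p L : ℝ) (γ : ℝ → Plane) : Prop where
  continuousOn : ContinuousOn γ (Icc 0 L)
  memSobolev : MemSobolev L 2 (ENNReal.ofReal p) γ
  immersed : ∀ t ∈ Icc 0 L, velocity L γ t ≠ 0

/-- A planar `p`-elastica: an immersed `W^{2,p}` curve which for some `lam` is a critical point of
bending energy plus `lam` times length, with respect to smooth compactly supported
perturbations. -/
def IsPElastica (p L : ℝ) (γ : ℝ → Plane) : Prop :=
  IsImmersedSobolevCurve p L γ ∧
    ∃ lam : ℝ, ∀ η : ℝ → Plane, ContDiff ℝ ∞ η → HasCompactSupport η → tsupport η ⊆ Ioo 0 L →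
      HasDerivAt
        (fun ε : ℝ => bendingEnergy p L (fun t => γ t + ε • η t) +
          lam * curveLength L (fun t => γ t + ε • η t)) 0 0

/-- The curve is parameterized by arclength. -/
def IsArclength (L : ℝ) (γ : ℝ → Plane) : Prop :=
  ∀ t ∈ Icc 0 L, ‖velocity L γ t‖ = 1

/-- The zero set `Z` of the curvature, as a subset of the space `[0, L]`; thus `frontier` is the
boundary relative to `[0, L]`. -/
def curvatureZeros (L : ℝ) (γ : ℝ → Plane) : Set (Icc (0 : ℝ) L) :=
  {s | curvature L γ s = 0}

/-! ### `p`-elliptic integrals and functions, for `p > 2` -/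

/-- The incomplete `p`-elliptic integral of the first kind `F_{1,p}(x, q)`, `0 ≤ q ≤ 1`. -/
def ellF1 (p q x : ℝ) : ℝ :=
  if q = 1 then ∫ θ in (0 : ℝ)..x, 1 / |Real.cos θ| ^ (2 / p)
  else ∫ θ in (0 : ℝ)..x, |Real.cos θ| ^ (1 - 2 / p) / √(1 - q ^ 2 * Real.sin θ ^ 2)

/-- The incomplete `p`-elliptic integral of the first kind `F_{2,p}(x, q)`, `0 ≤ q < 1`. -/
def ellF2 (p q x : ℝ) : ℝ :=
  ∫ θ in (0 : ℝ)..x, 1 / (1 - q ^ 2 * Real.sin θ ^ 2) ^ (1 / p)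

/-- The complete integral `K_p(1)`, which is finite for `p > 2`. -/
def ellK (p : ℝ) : ℝ := ellF1 p 1 (Real.pi / 2)

/-- The incomplete `p`-elliptic integral of the second kind `E_{1,p}(x, q)`. -/
def ellE1 (p q x : ℝ) : ℝ :=
  ∫ θ in (0 : ℝ)..x, √(1 - q ^ 2 * Real.sin θ ^ 2) * |Real.cos θ| ^ (1 - 2 / p)

/-- The incomplete `p`-elliptic integral of the second kind `E_{2,p}(x, q)`. -/
def ellE2 (p q x : ℝ) : ℝ :=
  ∫ θ in (0 : ℝ)..x, (1 - q ^ 2 * Real.sin θ ^ 2) ^ (1 / p)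

/-- The amplitude `am_{1,p}(·, q)`: the inverse of the increasing bijection `F_{1,p}(·, q)`. -/
def am1 (p q : ℝ) : ℝ → ℝ := Function.invFun (ellF1 p q)

/-- The amplitude `am_{2,p}(·, q)`: the inverse of the increasing bijection `F_{2,p}(·, q)`. -/
def am2 (p q : ℝ) : ℝ → ℝ := Function.invFun (ellF2 p q)

/-- The `p`-elliptic cosine. -/
def cn (p q x : ℝ) : ℝ :=
  |Real.cos (am1 p q x)| ^ (2 / p - 1) * Real.cos (am1 p q x)

/-- The `p`-delta amplitude. -/
def dn (p q x : ℝ) : ℝ :=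
  (1 - q ^ 2 * Real.sin (am2 p q x) ^ 2) ^ (1 / p)

open Classical in
/-- The `p`-hyperbolic secant. -/
def sech (p x : ℝ) : ℝ :=
  if x ∈ Ioo (-ellK p) (ellK p) then cn p 1 x else 0

/-- The `p`-hyperbolic tangent. -/
def tanh (p x : ℝ) : ℝ := ∫ t in (0 : ℝ)..x, sech p t ^ p

/-! ### The profile curves -/

/-- The linear profile. -/
def linearProfile (s : ℝ) : Plane := !₂[s, 0]

/-- The wavelike profile of modulus `q`. -/
def wavelikeProfile (p q s : ℝ) : Plane :=
  !₂[2 * ellE1 p q (am1 p q s) - s,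
    -q * (p / (p - 1)) * (|cn p q s| ^ (p - 2) * cn p q s)]

/-- The orbitlike profile of modulus `q`. -/
def orbitlikeProfile (p q s : ℝ) : Plane :=
  (1 / q ^ 2) • !₂[2 * ellE2 (p / (p - 1)) q (am2 p q s) + (q ^ 2 - 2) * s,
    -(p / (p - 1)) * dn p q s ^ (p - 1)]

/-- The circular profile. -/
def circularProfile (s : ℝ) : Plane := !₂[Real.cos s, Real.sin s]

/-- A curve on a compact interval `[left, right]`. -/
structure Arc where
  left : ℝ
  right : ℝ
  curve : ℝ → Plane

/-- The concatenation `γ₁ ⊕ γ₂` of two arcs, on `[0, L₁ + L₂]`. -/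
def Arc.concat (A B : Arc) : Arc where
  left := 0
  right := (A.right - A.left) + (B.right - B.left)
  curve := fun s =>
    if s ≤ A.right - A.left then A.curve (s + A.left)
    else B.curve (s + B.left - (A.right - A.left)) + A.curve A.right - B.curve B.left

/-- The iterated concatenation `A 0 ⊕ A 1 ⊕ ⋯ ⊕ A n`. -/
def Arc.concatSeq (A : ℕ → Arc) : ℕ → Arc
  | 0 => A 0
  | n + 1 => (Arc.concatSeq A n).concat (A (n + 1))

/-- The segment of length `ℓ`, run through leftward. -/
def segmentArc (ℓ : ℝ) : Arc where
  left := 0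
  right := ℓ
  curve := fun s => !₂[-s, 0]

/-- The loop with sign `σ = ±1`, on `[-K_p(1), K_p(1)]`. -/
def loopArc (p σ : ℝ) : Arc where
  left := -ellK p
  right := ellK p
  curve := fun s => !₂[2 * tanh p s - s, -σ * (p / (p - 1)) * sech p s ^ (p - 1)]

/-- The flat-core profile: the concatenation, over `j = 0, …, n`, of a segment of length `ℓ j`
followed by a loop of sign `σ j`. -/
def flatCoreProfile (p : ℝ) (σ ℓ : ℕ → ℝ) (n : ℕ) : Arc :=
  Arc.concatSeq (fun j => (segmentArc (ℓ j)).concat (loopArc p (σ j))) n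

/-- Up to similarity (dilation `c`, rotation or reflection `U`, translation `v`) and a `C¹`
reparameterization `φ`, the curve `γ` on `[0, L]` is a piece of the curve `δ` defined on `J`. -/
def IsPieceOf (L : ℝ) (γ : ℝ → Plane) (J : Set ℝ) (δ : ℝ → Plane) : Prop :=
  ∃ (c : ℝ) (U : Plane ≃ₗᵢ[ℝ] Plane) (v : Plane) (φ : ℝ → ℝ),
    0 < c ∧ ContDiffOn ℝ 1 φ (Icc 0 L) ∧ (∀ s ∈ Icc 0 L, derivWithin φ (Icc 0 L) s ≠ 0) ∧
      MapsTo φ (Icc 0 L) J ∧ ∀ s ∈ Icc 0 L, γ s = c • U (δ (φ s)) + v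

/-- Linear curves. -/
def IsLinear (L : ℝ) (γ : ℝ → Plane) : Prop :=
  IsPieceOf L γ univ linearProfile

/-- Wavelike curves. -/
def IsWavelike (p L : ℝ) (γ : ℝ → Plane) : Prop :=
  ∃ q ∈ Ioo (0 : ℝ) 1, IsPieceOf L γ univ (wavelikeProfile p q)

/-- Orbitlike curves. -/
def IsOrbitlike (p L : ℝ) (γ : ℝ → Plane) : Prop :=
  ∃ q ∈ Ioo (0 : ℝ) 1, IsPieceOf L γ univ (orbitlikeProfile p q)

/-- Circular curves. -/
def IsCircular (L : ℝ) (γ : ℝ → Plane) : Prop :=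
  IsPieceOf L γ univ circularProfile

/-- Flat-core curves. -/
def IsFlatCore (p L : ℝ) (γ : ℝ → Plane) : Prop :=
  ∃ (n : ℕ) (σ ℓ : ℕ → ℝ), (∀ j, σ j = 1 ∨ σ j = -1) ∧ (∀ j, 0 ≤ ℓ j) ∧
    IsPieceOf L γ (Icc 0 (flatCoreProfile p σ ℓ n).right) (flatCoreProfile p σ ℓ n).curve

/-- The exponent `M_p = ⌈2 / (p - 2)⌉`. -/
def expM (p : ℝ) : ℕ := ⌈2 / (p - 2)⌉₊

/-- The exponent `R_p = (M_p - 2 / (p - 2))⁻¹`, used when `2 / (p - 2)` is not an integer. -/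
def expR (p : ℝ) : ℝ := ((expM p : ℝ) - 2 / (p - 2))⁻¹

end PElastica

end

/-! The classes of curves are explicit, so regularity can be read off from the profiles. A unit
speed piece of a unit speed profile differs from it by a similarity and an affine change of
parameter (`IsPieceOf.exists_affine`), and neither affects the orders of singularities. For unit
speed, the curvature vanishes exactly where the second derivative does (`curvature_eq_zero_iff`).

The linear and circular profiles are visibly analytic. For the orbitlike one, the integrands are
real powers of a positive function and extend holomorphically. Their primitives, and the inverse of
such a primitive with nonvanishing derivative, are therefore analytic
(`analyticAt_of_hasDerivAt_re`).

For the other profiles the curvature is a non-smooth power of a function `Y` with simple zeros. In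
the wavelike case `Y` is the height: the curvature has size `|Y| ^ (1 / (p - 1))` up to a constant,
and the third derivative is `|Y| ^ (-(p - 2) / (p - 1))` times a continuous factor that is nonzero
at the zeros of `Y`. It thus behaves exactly like the power `-(p - 2) / (p - 1)` of the distance to
a zero, which is in `L^r` near that zero iff `r < (p - 1) / (p - 2)`.

On a flat-core loop with amplitude `φ`, put `Y = (cos φ) ^ (1 - 2 / p)` and `a = 2 / (p - 2)`. The
curvature has modulus `2 * Y ^ a`, and each derivative lowers the exponent by one. The factor that
remains is nonzero at the ends of the loop as long as the exponents differentiated were positive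
(`loopFactor_ne_zero`). The derivative of order `M + 2`, with `M = ⌈a⌉`, therefore has the exact
singularity of exponent `-(M - a)`. If `a` is an integer, it is bounded with nonzero one-sided
limits at the ends of the loop. Next to a segment, where it vanishes, it jumps, so it has no
integrable weak derivative (`not_isWeakDeriv_of_jump`). If the zero set contains an interval and the
curve also meets a loop, such a jump is found at the point nearest to the interval where a loop
begins (`exists_first_mem`, `exists_last_mem`).

Pointwise and weak derivatives are linked by `DerivChain.isWeakDeriv` and by the uniqueness of weak
derivatives `IsWeakDeriv.ae_eq`. Integrability is decided by `memLp_of_isBigO_rpow` and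
`not_memLp_of_rpow_isBigO`. -/

noncomputable section

namespace PElastica

open Filter Topology Asymptotics

/-! ### Weak derivatives of piecewise smooth functions -/

section Sobolev

variable {E : Type*} [NormedAddCommGroup E] [NormedSpace ℝ E]

/-- `d 0, d 1, …, d m` are successive derivatives outside of a countable set, all but the last one
being continuous. -/
structure DerivChain (S : Set ℝ) (m : ℕ) (d : ℕ → ℝ → E) : Prop where
  countable : S.Countable
  continuous : ∀ j < m, Continuous (d j)
  hasDerivAt : ∀ j < m, ∀ x ∉ S, HasDerivAt (d j) (d (j + 1) x) x

/-- The fundamental theorem of calculus tolerates countably many exceptional points, so `f` is a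
primitive of the continuous `g`, and the exceptions disappear. This gives differentiability where
the chain rule fails, at the zeros of the curvature. -/
theorem hasDerivAt_of_off_countable [CompleteSpace E] {f g : ℝ → E} {S : Set ℝ}
    (hS : S.Countable) (hf : Continuous f) (hg : Continuous g)
    (h : ∀ x ∉ S, HasDerivAt f (g x) x) (x : ℝ) : HasDerivAt f (g x) x := by
  have key : (fun y => f 0 + ∫ t in (0 : ℝ)..y, g t) = f := by
    funext y
    rw [integral_eq_of_hasDerivAt_off_countable f g hS hf.continuousOn (fun x hx => h x hx.2)
      (hg.intervalIntegrable _ _)]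
    abel
  have h2 := (hg.integral_hasStrictDerivAt 0 x).hasDerivAt.const_add (f 0)
  rwa [key] at h2

theorem DerivChain.hasDerivAt_all [CompleteSpace E] {S : Set ℝ} {m : ℕ} {d : ℕ → ℝ → E}
    (hd : DerivChain S m d) {j : ℕ} (hj : j + 1 < m) (x : ℝ) :
    HasDerivAt (d j) (d (j + 1) x) x :=
  hasDerivAt_of_off_countable hd.countable (hd.continuous j (by omega)) (hd.continuous _ hj)
    (hd.hasDerivAt j (by omega)) x

theorem integrableOn_smul_of_continuous {φ : ℝ → ℝ} {f : ℝ → E} {a b : ℝ} (hφ : Continuous φ)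
    (hf : IntegrableOn f (Ioo a b)) : IntegrableOn (fun x => φ x • f x) (Ioo a b) := by
  rw [← integrableOn_Icc_iff_integrableOn_Ioo] at hf ⊢
  exact hf.continuousOn_smul hφ.continuousOn isCompact_Icc

theorem setIntegral_deriv_smul [CompleteSpace E] {φ : ℝ → ℝ} {f g : ℝ → E} {S : Set ℝ} {a b : ℝ}
    (hab : a ≤ b) (hS : S.Countable) (hφ : ContDiff ℝ ∞ φ)
    (hf : Continuous f) (hfg : ∀ x ∉ S, HasDerivAt f (g x) x) (hg : IntegrableOn g (Ioo a b)) :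
    ∫ x in Ioo a b, deriv φ x • f x =
      (φ b • f b - φ a • f a) - ∫ x in Ioo a b, φ x • g x := by
  have hφ' : Continuous (deriv φ) := hφ.continuous_deriv (by simp)
  have i1 : IntegrableOn (fun x => deriv φ x • f x) (Ioo a b) :=
    ((hφ'.smul hf).integrableOn_Icc).mono_set Ioo_subset_Icc_self
  have i2 := integrableOn_smul_of_continuous hφ.continuous hg
  have key := integral_eq_of_hasDerivAt_off_countable_of_le (fun x => φ x • f x)
    (fun x => φ x • g x + deriv φ x • f x) hab hS (hφ.continuous.smul hf).continuousOn
    (fun x hx => ((hφ.differentiable (by simp)).differentiableAt.hasDerivAt).smul (hfg x hx.2))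
    (by
      rw [intervalIntegrable_iff_integrableOn_Ioo_of_le hab]
      exact i2.add i1)
  rw [intervalIntegral.integral_of_le hab, integral_Ioc_eq_integral_Ioo, integral_add i2 i1] at key
  rw [← key]
  abel

theorem eq_zero_of_tsupport_subset {φ : ℝ → ℝ} {s : Set ℝ} (h : tsupport φ ⊆ s) {x : ℝ}
    (hx : x ∉ s) : φ x = 0 :=
  image_eq_zero_of_notMem_tsupport fun h' => hx (h h')

/-- Integration by parts, one order at a time: the inductive hypothesis is applied to `deriv φ`, and
the boundary terms vanish because `φ` is supported inside `(0, L)`. Only the last member of the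
chain may be discontinuous, whence the integrability assumption on it alone. -/
theorem DerivChain.isWeakDeriv [CompleteSpace E] {S : Set ℝ} {m : ℕ} {d : ℕ → ℝ → E} {L : ℝ}
    (hL : 0 ≤ L) (hd : DerivChain S m d) (hm : IntegrableOn (d m) (Ioo 0 L)) :
    ∀ j ≤ m, IsWeakDeriv L j (d 0) (d j) := by
  intro j
  induction j with
  | zero =>
    intro _ φ _ _ _
    simp
  | succ j ih =>
    intro hj φ hφ hc hs
    have hφ' : ContDiff ℝ ∞ (deriv φ) := (contDiff_infty_iff_deriv.1 hφ).2
    have h1 := ih (by omega) (deriv φ) hφ' hc.deriv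
      ((tsupport_deriv_subset (𝕜 := ℝ)).trans hs)
    rw [iteratedDeriv_succ', h1]
    have hint : IntegrableOn (d (j + 1)) (Ioo 0 L) := by
      rcases hj.lt_or_eq with h | h
      · exact (hd.continuous _ h).integrableOn_Icc.mono_set Ioo_subset_Icc_self
      · rw [h]; exact hm
    rw [setIntegral_deriv_smul hL hd.countable hφ (hd.continuous j (by omega))
      (hd.hasDerivAt j (by omega)) hint, eq_zero_of_tsupport_subset hs (x := L) (by simp),
      eq_zero_of_tsupport_subset hs (x := 0) (by simp), pow_succ]
    simp

theorem IsWeakDeriv.congr_left {L : ℝ} {j : ℕ} {f f' g : ℝ → E} (h : IsWeakDeriv L j f g)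
    (hf : EqOn f' f (Ioo 0 L)) : IsWeakDeriv L j f' g := by
  intro φ h1 h2 h3
  rw [← h φ h1 h2 h3]
  exact setIntegral_congr_fun measurableSet_Ioo fun x hx => by simp [hf hx]

/-- The difference integrates to zero against every test function, so the fundamental lemma of the
calculus of variations applies. -/
theorem IsWeakDeriv.ae_eq [CompleteSpace E] {L : ℝ} {j : ℕ} {f g h : ℝ → E}
    (hg : IsWeakDeriv L j f g) (hh : IsWeakDeriv L j f h) (ig : IntegrableOn g (Ioo 0 L))
    (ih : IntegrableOn h (Ioo 0 L)) : g =ᵐ[volume.restrict (Ioo 0 L)] h := by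
  have key := isOpen_Ioo.ae_eq_zero_of_integral_contDiff_smul_eq_zero (μ := volume)
    (f := fun x => g x - h x) (U := Ioo 0 L) (ig.sub ih).locallyIntegrableOn (by
      intro φ h1 h2 h3
      rw [← setIntegral_eq_integral_of_forall_compl_eq_zero (s := Ioo 0 L)
        (fun x hx => by rw [eq_zero_of_tsupport_subset h3 hx, zero_smul])]
      simp only [smul_sub]
      rw [integral_sub (integrableOn_smul_of_continuous h1.continuous ig)
        (integrableOn_smul_of_continuous h1.continuous ih)]
      have e := (hg φ h1 h2 h3).symm.trans (hh φ h1 h2 h3)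
      rw [sub_eq_zero]
      exact (smul_right_injective E (pow_ne_zero j (by norm_num : (-1 : ℝ) ≠ 0))) e)
  rw [EventuallyEq, ae_restrict_iff' measurableSet_Ioo]
  filter_upwards [key] with x hx hx'
  exact sub_eq_zero.1 (hx hx')

theorem memLp_Ioo_of_continuous {F : Type*} [NormedAddCommGroup F] {f : ℝ → F}
    (hf : Continuous f) (r : ENNReal) (a b : ℝ) :
    MemLp f r (volume.restrict (Ioo a b)) := by
  obtain ⟨C, hC⟩ := (isCompact_Icc (a := a) (b := b)).exists_bound_of_continuousOn hf.continuousOn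
  exact MemLp.of_bound hf.aestronglyMeasurable C
    ((ae_restrict_iff' measurableSet_Ioo).2 (ae_of_all _ fun x hx => hC x ⟨hx.1.le, hx.2.le⟩))

theorem DerivChain.memSobolev [CompleteSpace E] {S : Set ℝ} {m : ℕ} {d : ℕ → ℝ → E} {L : ℝ}
    {r : ENNReal} {f : ℝ → E} (hL : 0 ≤ L) (hd : DerivChain S m d) (hm0 : 0 < m)
    (hf : EqOn f (d 0) (Ioo 0 L)) (hr : 1 ≤ r) (hm : MemLp (d m) r (volume.restrict (Ioo 0 L))) :
    MemSobolev L m r f := by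
  refine ⟨?_, fun j hj => ⟨d j, ?_, ?_⟩⟩
  · exact (memLp_congr_ae ((ae_restrict_iff' measurableSet_Ioo).2 (ae_of_all _ hf))).2
      (memLp_Ioo_of_continuous (hd.continuous 0 hm0) _ _ _)
  · rcases hj.lt_or_eq with h | h
    · exact memLp_Ioo_of_continuous (hd.continuous j h) _ _ _
    · rw [h]; exact hm
  · exact (hd.isWeakDeriv hL (hm.integrable hr) j hj).congr_left hf

/-- Any weak derivative of order `m` in `L^r` would agree almost everywhere with `d m`.
Integrability of `d m` is what makes it a competitor in the uniqueness statement. -/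
theorem DerivChain.not_memSobolev [CompleteSpace E] {S : Set ℝ} {m : ℕ} {d : ℕ → ℝ → E} {L : ℝ}
    {r : ENNReal} {f : ℝ → E} (hL : 0 ≤ L) (hd : DerivChain S m d)
    (hf : EqOn f (d 0) (Ioo 0 L)) (hr : 1 ≤ r) (hi : IntegrableOn (d m) (Ioo 0 L))
    (hm : ¬ MemLp (d m) r (volume.restrict (Ioo 0 L))) :
    ¬ MemSobolev L m r f := by
  rintro ⟨-, h⟩
  obtain ⟨g, hg, hw⟩ := h m le_rfl
  exact hm ((memLp_congr_ae (hw.ae_eq ((hd.isWeakDeriv hL hi m le_rfl).congr_left hf)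
    (hg.integrable hr) hi)).1 hg)

/-- A function with a jump has no integrable weak derivative. -/
theorem not_isWeakDeriv_of_jump [CompleteSpace E] {L x₀ : ℝ} {h A B A' B' g : ℝ → E}
    (hx₀ : x₀ ∈ Ioo 0 L) (hA : ∀ x, HasDerivAt A (A' x) x) (hB : ∀ x, HasDerivAt B (B' x) x)
    (hA' : Continuous A') (hB' : Continuous B') (hAB : A x₀ ≠ B x₀)
    (hl : ∀ᶠ x in 𝓝[<] x₀, h x = A x) (hr : ∀ᶠ x in 𝓝[>] x₀, h x = B x)
    (hg : IntegrableOn g (Ioo 0 L)) : ¬ IsWeakDeriv L 1 h g := by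
  intro hw
  obtain ⟨a, ha, hla⟩ := mem_nhdsLT_iff_exists_Ioo_subset.1
    (inter_mem hl (Ioo_mem_nhdsLT hx₀.1))
  obtain ⟨b, hb, hrb⟩ := mem_nhdsGT_iff_exists_Ioo_subset.1
    (inter_mem hr (Ioo_mem_nhdsGT hx₀.2))
  simp only [mem_Iio, mem_Ioi] at ha hb
  have hsub : Ioo a b ⊆ Ioo 0 L := by
    intro x hx
    rcases lt_trichotomy x x₀ with h' | h' | h'
    · exact ⟨(hla ⟨hx.1, h'⟩).2.1, h'.trans hx₀.2⟩
    · rwa [h']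
    · exact ⟨hx₀.1.trans h', (hrb ⟨h', hx.2⟩).2.2⟩
  -- The classical derivative of `h` near `x₀`, on either side of the jump.
  set e : ℝ → E := fun x => if x < x₀ then A' x else B' x with he
  have split : ∀ F : ℝ → E, IntegrableOn F (Ioo a b) →
      ∫ x in Ioo a b, F x = (∫ x in Ioo a x₀, F x) + ∫ x in Ioo x₀ b, F x := by
    intro F hF
    rw [← integral_Ioc_eq_integral_Ioo, ← integral_Ioc_eq_integral_Ioo,
      ← integral_Ioc_eq_integral_Ioo, ← intervalIntegral.integral_of_le (ha.trans hb).le,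
      ← intervalIntegral.integral_of_le ha.le, ← intervalIntegral.integral_of_le hb.le]
    refine (intervalIntegral.integral_add_adjacent_intervals ?_ ?_).symm
    · rw [intervalIntegrable_iff_integrableOn_Ioo_of_le ha.le]
      exact hF.mono_set (Ioo_subset_Ioo_right hb.le)
    · rw [intervalIntegrable_iff_integrableOn_Ioo_of_le hb.le]
      exact hF.mono_set (Ioo_subset_Ioo_left ha.le)
  have cA : Continuous A := continuous_iff_continuousAt.2 fun x => (hA x).continuousAt
  have cB : Continuous B := continuous_iff_continuousAt.2 fun x => (hB x).continuousAt
  have glue : ∀ (F G H : ℝ → E), Continuous G → Continuous H → EqOn F G (Ioo a x₀) →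
      EqOn F H (Ioo x₀ b) → IntegrableOn F (Ioo a b) := by
    intro F G H hG hH h1 h2
    have i1 : IntegrableOn F (Ioc a x₀) := by
      rw [integrableOn_Ioc_iff_integrableOn_Ioo]
      exact (hG.integrableOn_Icc.mono_set Ioo_subset_Icc_self).congr_fun h1.symm measurableSet_Ioo
    have i2 : IntegrableOn F (Ioo x₀ b) :=
      (hH.integrableOn_Icc.mono_set Ioo_subset_Icc_self).congr_fun h2.symm measurableSet_Ioo
    exact (i1.union i2).mono_set fun x hx => (le_or_gt x x₀).imp (fun h => ⟨hx.1, h⟩)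
      fun h => ⟨h, hx.2⟩
  have ie : IntegrableOn e (Ioo a b) := glue e A' B' hA' hB'
    (fun x hx => by simp [he, hx.2]) (fun x hx => by simp [he, hx.1.not_gt])
  have ige : IntegrableOn (fun x => g x - e x) (Ioo a b) := (hg.mono_set hsub).sub ie
  -- Integrating by parts on each side of `x₀`, the boundary terms at `x₀` leave the jump: the
  -- supposed weak derivative minus `e` acts as a Dirac mass at `x₀`.
  have key : ∀ φ : ℝ → ℝ, ContDiff ℝ ∞ φ → HasCompactSupport φ → tsupport φ ⊆ Ioo a b →
      ∫ x in Ioo a b, φ x • (g x - e x) = φ x₀ • (B x₀ - A x₀) := by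
    intro φ h1 h2 h3
    have hφ' : Continuous (deriv φ) := h1.continuous_deriv (by simp)
    have w := hw φ h1 h2 (h3.trans hsub)
    rw [iteratedDeriv_one] at w
    have zero_off : ∀ F : ℝ → E, ∀ ψ : ℝ → ℝ, tsupport ψ ⊆ Ioo a b →
        ∫ x in Ioo 0 L, ψ x • F x = ∫ x in Ioo a b, ψ x • F x := by
      intro F ψ hψ
      refine (setIntegral_eq_of_subset_of_forall_sdiff_eq_zero (f := fun x => ψ x • F x)
        measurableSet_Ioo hsub ?_)
      intro x hx
      rw [eq_zero_of_tsupport_subset hψ hx.2, zero_smul]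
    rw [zero_off h (deriv φ) ((tsupport_deriv_subset (𝕜 := ℝ)).trans h3), zero_off g φ h3] at w
    have s1 := split (fun x => deriv φ x • h x) (glue _ (fun x => deriv φ x • A x)
      (fun x => deriv φ x • B x) (hφ'.smul cA) (hφ'.smul cB)
      (fun x hx => by simp only [(hla hx).1.out]) (fun x hx => by simp only [(hrb hx).1.out]))
    have s2 := split (fun x => φ x • e x) (integrableOn_smul_of_continuous h1.continuous ie)
    rw [setIntegral_congr_fun (s := Ioo a x₀) (g := fun x => deriv φ x • A x) measurableSet_Ioo
        (fun x hx => by simp only [(hla hx).1.out]),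
      setIntegral_congr_fun (s := Ioo x₀ b) (g := fun x => deriv φ x • B x) measurableSet_Ioo
        (fun x hx => by simp only [(hrb hx).1.out]),
      setIntegral_deriv_smul ha.le countable_empty h1 cA (fun x _ => hA x)
        (hA'.integrableOn_Icc.mono_set Ioo_subset_Icc_self),
      setIntegral_deriv_smul hb.le countable_empty h1 cB (fun x _ => hB x)
        (hB'.integrableOn_Icc.mono_set Ioo_subset_Icc_self),
      eq_zero_of_tsupport_subset h3 (x := a) (by simp),
      eq_zero_of_tsupport_subset h3 (x := b) (by simp)] at s1
    rw [setIntegral_congr_fun (s := Ioo a x₀) (g := fun x => φ x • A' x) measurableSet_Ioo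
        (fun x hx => by simp only [he, hx.2, if_true]),
      setIntegral_congr_fun (s := Ioo x₀ b) (g := fun x => φ x • B' x) measurableSet_Ioo
        (fun x hx => by simp only [he, hx.1.not_gt, if_false])] at s2
    simp only [smul_sub]
    rw [integral_sub (integrableOn_smul_of_continuous h1.continuous (hg.mono_set hsub))
      (integrableOn_smul_of_continuous h1.continuous ie), s2]
    rw [s1] at w
    have w' : ∫ x in Ioo a b, φ x • g x = -((-1 : ℝ) ^ 1 • ∫ x in Ioo a b, φ x • g x) := by simp
    rw [w', ← w]
    simp only [zero_smul]
    abel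
  -- Test functions supported away from `x₀` do not see the Dirac mass, so `g = e` almost
  -- everywhere. A test function equal to one at `x₀` then forces the jump to be zero.
  have hae := (isOpen_Ioo.sdiff isClosed_singleton).ae_eq_zero_of_integral_contDiff_smul_eq_zero
    (μ := volume) (f := fun x => g x - e x) (U := Ioo a b \ {x₀})
    (ige.mono_set sdiff_subset).locallyIntegrableOn (by
      intro φ h1 h2 h3
      rw [← setIntegral_eq_integral_of_forall_compl_eq_zero (s := Ioo a b)
        (fun x hx => by
          rw [eq_zero_of_tsupport_subset (h3.trans sdiff_subset) hx, zero_smul]),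
        key φ h1 h2 (h3.trans sdiff_subset), eq_zero_of_tsupport_subset h3 (x := x₀) (by simp),
        zero_smul])
  have hae' : ∀ᵐ x ∂(volume.restrict (Ioo a b)), g x - e x = 0 := by
    rw [ae_restrict_iff' measurableSet_Ioo]
    filter_upwards [hae, (measure_eq_zero_iff_ae_notMem.1 (Real.volume_singleton (a := x₀)))]
      with x hx hx' hx''
    exact hx ⟨hx'', hx'⟩
  obtain ⟨φ, h1, h2, h3, -, h4⟩ := exists_contDiff_tsupport_subset (n := ⊤) (s := Ioo a b) (x := x₀)
    (Ioo_mem_nhds ha hb)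
  have := key φ h3 h2 h1
  rw [h4, one_smul, integral_eq_zero_of_ae (by
    filter_upwards [hae'] with x hx; rw [hx, smul_zero]; rfl)] at this
  exact hAB (sub_eq_zero.1 this.symm).symm

/-- If the last member of a chain of derivatives has a jump, then it has no integrable weak
derivative. -/
theorem DerivChain.not_memSobolev_succ [CompleteSpace E] {S : Set ℝ} {m : ℕ} {d : ℕ → ℝ → E}
    {L : ℝ} {f : ℝ → E} (hL : 0 ≤ L) (hd : DerivChain S m d)
    (hf : EqOn f (d 0) (Ioo 0 L)) (hi : IntegrableOn (d m) (Ioo 0 L))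
    {x₀ : ℝ} {A B A' B' : ℝ → E}
    (hx₀ : x₀ ∈ Ioo 0 L) (hA : ∀ x, HasDerivAt A (A' x) x) (hB : ∀ x, HasDerivAt B (B' x) x)
    (hA' : Continuous A') (hB' : Continuous B') (hAB : A x₀ ≠ B x₀)
    (hl : ∀ᶠ x in 𝓝[<] x₀, d m x = A x) (hr : ∀ᶠ x in 𝓝[>] x₀, d m x = B x) :
    ¬ MemSobolev L (m + 1) 1 f := by
  rintro ⟨-, h⟩
  obtain ⟨g, hg, hw⟩ := h (m + 1) le_rfl
  refine not_isWeakDeriv_of_jump hx₀ hA hB hA' hB' hAB hl hr (hg.integrable le_rfl) ?_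
  -- A weak derivative of order `m + 1` of `f` is a first weak derivative of `d m`: the identity of
  -- order `m` is tested against `deriv φ` and the common sign is cancelled.
  intro φ h1 h2 h3
  have e1 := hw φ h1 h2 h3
  have e2 := ((hd.isWeakDeriv hL hi m le_rfl).congr_left hf) (deriv φ)
    (contDiff_infty_iff_deriv.1 h1).2
    h2.deriv ((tsupport_deriv_subset (𝕜 := ℝ)).trans h3)
  rw [iteratedDeriv_succ', e2] at e1
  apply smul_right_injective E (pow_ne_zero m (by norm_num : (-1 : ℝ) ≠ 0))
  simp only [iteratedDeriv_one]
  rw [e1, pow_succ, mul_smul, pow_one]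

end Sobolev

/-! ### Integrability of powers of the distance to a point -/

theorem integrableAtFilter_of_nhdsNE {F : Type*} [NormedAddCommGroup F] {g : ℝ → F} {x : ℝ}
    (h : IntegrableAtFilter g (𝓝[≠] x) volume) : IntegrableAtFilter g (𝓝 x) volume := by
  obtain ⟨s, hs, hi⟩ := h
  refine ⟨insert x s, insert_mem_nhds_iff.2 hs, ?_⟩
  rw [insert_eq]
  refine IntegrableOn.union ?_ hi
  rw [integrableOn_singleton_iff]
  right
  simp

theorem integrableAtFilter_abs_rpow {κ : ℝ} (hκ : -1 < κ) (x : ℝ) :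
    IntegrableAtFilter (fun t => |t - x| ^ κ) (𝓝 x) volume := by
  have h1 : IntegrableOn (fun t : ℝ => |t| ^ κ) (Ioc 0 1) := by
    have := (intervalIntegral.intervalIntegrable_rpow' (a := 0) (b := 1) hκ).1
    exact this.congr_fun (fun t ht => by simp only [abs_of_pos ht.1]) measurableSet_Ioc
  have h2 : IntervalIntegrable (fun t : ℝ => |t| ^ κ) volume 0 1 :=
    (intervalIntegrable_iff_integrableOn_Ioc_of_le zero_le_one).2 h1
  have h3 : IntervalIntegrable (fun t : ℝ => |t| ^ κ) volume 0 (-1) := by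
    have := (IntervalIntegrable.iff_comp_neg (f := fun t : ℝ => |t| ^ κ) (a := 0) (b := 1)).1 h2
    simpa using this
  have h4 := (h3.symm.trans h2).comp_sub_right x
  refine ⟨Ioc (-1 + x) (1 + x), Ioc_mem_nhds (by linarith) (by linarith), h4.1⟩

/-- Local domination by `|t - x| ^ (-τ)` with `τ r < 1` implies local `L^r` integrability. -/
theorem memLp_of_isBigO_rpow {F : Type*} [NormedAddCommGroup F] {g : ℝ → F} {r τ : ℝ}
    (hr : 1 ≤ r) (hτ : τ * r < 1) (hg : AEStronglyMeasurable g volume)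
    (h : ∀ x, g =O[𝓝[≠] x] fun t => |t - x| ^ (-τ)) (a b : ℝ) :
    MemLp g (ENNReal.ofReal r) (volume.restrict (Ioo a b)) := by
  have hr0 : 0 < r := by linarith
  have hloc : LocallyIntegrable (fun t => ‖g t‖ ^ r) volume := by
    intro x
    apply integrableAtFilter_of_nhdsNE
    have h1 : (fun t => ‖g t‖ ^ r) =O[𝓝[≠] x] fun t => |t - x| ^ (-(τ * r)) := by
      refine ((h x).norm_left.rpow hr0.le (Eventually.of_forall fun t => by
      simp only [Pi.zero_apply]; positivity)).congr_right ?_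
      intro t
      rw [← Real.rpow_mul (abs_nonneg _), neg_mul]
    have hgen := (measurableSet_singleton x).compl.nhdsWithin_isMeasurablyGenerated x
    refine h1.integrableAtFilter
      ((hg.norm.aemeasurable.pow_const r).aestronglyMeasurable.stronglyMeasurableAtFilter) ?_
    exact (integrableAtFilter_abs_rpow (by linarith) x).filter_mono nhdsWithin_le_nhds
  have h2 : IntegrableOn (fun t => ‖g t‖ ^ r) (Ioo a b) :=
    (hloc.integrableOn_isCompact isCompact_Icc).mono_set Ioo_subset_Icc_self
  rw [← integrable_norm_rpow_iff hg.restrict (by simpa using hr0) ENNReal.ofReal_ne_top,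
    ENNReal.toReal_ofReal hr0.le]
  exact h2

/-- At the critical exponent the `r`-th power of `g` dominates `|t - x|⁻¹`, which is not integrable
on either side of `x`. One side is enough, and only one may be available: `x` can be an end point of
the curve, or the end of a loop followed by a segment. -/
theorem not_memLp_of_rpow_isBigO {F : Type*} [NormedAddCommGroup F] {g : ℝ → F} {r τ x a b : ℝ}
    {l : Filter ℝ} (hl : l = 𝓝[<] x ∨ l = 𝓝[>] x) (hr : 0 < r) (hτ : τ * r = 1)
    (hab : ∀ᶠ t in l, t ∈ Ioo a b) (h : (fun t => |t - x| ^ (-τ)) =O[l] g) :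
    ¬ MemLp g (ENNReal.ofReal r) (volume.restrict (Ioo a b)) := by
  intro hm
  have h1 : IntegrableOn (fun t => ‖g t‖ ^ r) (Ioo a b) := by
    have := hm.integrable_norm_rpow (by simpa using hr) ENNReal.ofReal_ne_top
    rwa [ENNReal.toReal_ofReal hr.le] at this
  have h2 : (fun t => (t - x)⁻¹) =O[l] fun t => ‖g t‖ ^ r := by
    have := h.norm_right.rpow hr.le (Eventually.of_forall fun t => by simp)
    refine IsBigO.trans (IsBigO.of_norm_eventuallyLE (Eventually.of_forall fun t => ?_)) this
    dsimp only
    rw [← Real.rpow_mul (abs_nonneg _), neg_mul, hτ, Real.rpow_neg_one, norm_inv, Real.norm_eq_abs]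
  have hgen : l.IsMeasurablyGenerated := by
    rcases hl with rfl | rfl <;> infer_instance
  have h3 : IntegrableAtFilter (fun t => (t - x)⁻¹) l volume :=
    h2.integrableAtFilter
      ((measurable_id.sub_const x).inv.aestronglyMeasurable.stronglyMeasurableAtFilter)
      ⟨Ioo a b, hab, h1⟩
  obtain ⟨s, hs, hi⟩ := h3
  rcases hl with rfl | rfl
  · obtain ⟨c, hc, hcs⟩ := mem_nhdsLT_iff_exists_Ioo_subset.1 hs
    have hc' : c < x := hc
    have : IntervalIntegrable (fun t => (t - x)⁻¹) volume c x := by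
      rw [intervalIntegrable_iff_integrableOn_Ioo_of_le hc'.le]
      exact hi.mono_set hcs
    rw [intervalIntegrable_sub_inv_iff] at this
    rcases this with h | h
    · exact hc'.ne h
    · exact h right_mem_uIcc
  · obtain ⟨c, hc, hcs⟩ := mem_nhdsGT_iff_exists_Ioo_subset.1 hs
    have hc' : x < c := hc
    have : IntervalIntegrable (fun t => (t - x)⁻¹) volume x c := by
      rw [intervalIntegrable_iff_integrableOn_Ioo_of_le hc'.le]
      exact hi.mono_set hcs
    rw [intervalIntegrable_sub_inv_iff] at this
    rcases this with h | h
    · exact hc'.ne h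
    · exact h left_mem_uIcc

theorem isTheta_abs_of_hasDerivAt {Y : ℝ → ℝ} {Y' x : ℝ} (h : HasDerivAt Y Y' x) (hY : Y x = 0)
    (h' : Y' ≠ 0) : Y =Θ[𝓝 x] fun t => t - x := by
  have := h.isTheta_sub h'
  have h2 : Tendsto (fun t : ℝ => (t, x)) (𝓝 x) (𝓝 x ×ˢ pure x) :=
    tendsto_id.prodMk tendsto_const_pure
  have h3 := this.1.comp_tendsto h2
  have h4 := this.2.comp_tendsto h2
  simp only [Function.comp_def, hY, sub_zero] at h3 h4
  exact ⟨h3, h4⟩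

theorem abs_rpow_isTheta_of_hasDerivAt {Y : ℝ → ℝ} {Y' x : ℝ} (h : HasDerivAt Y Y' x)
    (hY : Y x = 0) (h' : Y' ≠ 0) (τ : ℝ) (hτ : 0 ≤ τ) :
    (fun t => |Y t| ^ (-τ)) =Θ[𝓝[≠] x] fun t => |t - x| ^ (-τ) := by
  have h1 : (fun t => |Y t|) =Θ[𝓝[≠] x] fun t => |t - x| :=
    ((isTheta_abs_of_hasDerivAt h hY h').mono nhdsWithin_le_nhds).norm_left.norm_right
  have h2 : (fun t => |Y t| ^ τ) =Θ[𝓝[≠] x] fun t => |t - x| ^ τ :=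
    ⟨h1.1.rpow hτ (Eventually.of_forall fun t => abs_nonneg _),
      h1.2.rpow hτ (Eventually.of_forall fun t => abs_nonneg _)⟩
  simpa only [Real.rpow_neg (abs_nonneg _)] using h2.inv

/-- If `Y` has simple zeros then `|Y| ^ (-τ)` is locally dominated by a power of the distance. -/
theorem abs_rpow_isBigO_of_hasDerivAt {Y Y' : ℝ → ℝ} (h : ∀ x, HasDerivAt Y (Y' x) x)
    (h' : ∀ x, Y x = 0 → Y' x ≠ 0) {τ : ℝ} (hτ : 0 ≤ τ) (x : ℝ) :
    (fun t => |Y t| ^ (-τ)) =O[𝓝[≠] x] fun t => |t - x| ^ (-τ) := by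
  by_cases hx : Y x = 0
  · exact (abs_rpow_isTheta_of_hasDerivAt (h x) hx (h' x hx) τ hτ).1
  · have c1 : ContinuousAt (fun t => |Y t| ^ (-τ)) x :=
      (h x).continuousAt.abs.rpow_const (Or.inl (abs_ne_zero.2 hx))
    refine (c1.norm.isBoundedUnder_le.isBigO_one ℝ).mono nhdsWithin_le_nhds |>.trans ?_
    have c2 : Tendsto (fun t => |t - x| ^ τ) (𝓝 x) (𝓝 (|x - x| ^ τ)) :=
      ((continuous_id.sub continuous_const).abs.rpow_const fun _ => Or.inr hτ).tendsto x
    have c3 : (fun t => |t - x| ^ τ) =O[𝓝[≠] x] fun _ => (1 : ℝ) :=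
      (c2.norm.isBoundedUnder_le.isBigO_one ℝ).mono nhdsWithin_le_nhds
    have c4 : (fun _ : ℝ => (1 : ℝ)⁻¹) =O[𝓝[≠] x] fun t => (|t - x| ^ τ)⁻¹ := by
      refine c3.inv_rev ?_
      filter_upwards [self_mem_nhdsWithin] with t ht h0
      exact absurd h0 (Real.rpow_pos_of_pos (abs_pos.2 (sub_ne_zero.2 ht)) _).ne'
    simpa only [Real.rpow_neg (abs_nonneg _), inv_one] using c4

/-! ### Elliptic integrals and their inverses -/

/-- An integrand whose primitive is an increasing homeomorphism of the line. -/
structure AmpDensity (f : ℝ → ℝ) : Prop where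
  measurable : Measurable f
  intervalIntegrable : ∀ a b, IntervalIntegrable f volume a b
  cos_sq_le : ∀ θ, Real.cos θ ^ 2 ≤ f θ

/-- The primitive vanishing at the origin. -/
def prim (f : ℝ → ℝ) (x : ℝ) : ℝ := ∫ θ in (0 : ℝ)..x, f θ

theorem hasDerivAt_prim {f : ℝ → ℝ} (hf : Continuous f) (x : ℝ) : HasDerivAt (prim f) (f x) x :=
  (hf.integral_hasStrictDerivAt 0 x).hasDerivAt

theorem prim_neg {f : ℝ → ℝ} (hf : ∀ x, f (-x) = f x) (x : ℝ) : prim f (-x) = -prim f x := by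
  unfold prim
  have := intervalIntegral.integral_comp_neg (f := f) (a := 0) (b := x)
  simp only [hf, neg_zero] at this
  rw [this, intervalIntegral.integral_symm]

namespace AmpDensity

variable {f : ℝ → ℝ} (hf : AmpDensity f)
include hf

theorem continuous_prim : Continuous (prim f) :=
  intervalIntegral.continuous_primitive hf.intervalIntegrable 0

theorem prim_sub (x y : ℝ) : prim f y - prim f x = ∫ θ in x..y, f θ :=
  intervalIntegral.integral_interval_sub_left (hf.intervalIntegrable _ _)
    (hf.intervalIntegrable _ _)

/-- The minorant `cos ^ 2` serves all three integrands. It has only isolated zeros, which gives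
strict monotonicity even where the integrand vanishes, and infinite mass on both half-lines, which
gives surjectivity. -/
theorem integral_cos_sq_le {x y : ℝ} (h : x ≤ y) :
    ∫ θ in x..y, Real.cos θ ^ 2 ≤ prim f y - prim f x := by
  rw [hf.prim_sub]
  exact intervalIntegral.integral_mono_on h
    ((Real.continuous_cos.pow 2).intervalIntegrable _ _) (hf.intervalIntegrable _ _)
    fun θ _ => hf.cos_sq_le θ

theorem strictMono_prim : StrictMono (prim f) := by
  intro x y hxy
  have h1 := hf.integral_cos_sq_le hxy.le
  have h2 : 0 < ∫ θ in x..y, Real.cos θ ^ 2 := by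
    refine intervalIntegral.integral_pos hxy (Real.continuous_cos.pow 2).continuousOn
      (fun _ _ => sq_nonneg _) ?_
    by_cases hx : Real.cos x = 0
    -- At a zero of `cos` one moves right by `δ ≤ 1 < π`, where the cosine is `-sin x * sin δ ≠ 0`.
    · set δ := min (y - x) 1
      have hδ : 0 < δ := lt_min (by linarith) one_pos
      have hδ1 : δ ≤ 1 := min_le_right _ _
      have hδ2 : δ ≤ y - x := min_le_left _ _
      refine ⟨x + δ, ⟨by linarith, by linarith⟩, ?_⟩
      rw [Real.cos_add, hx, zero_mul, zero_sub, neg_sq]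
      have h3 : 0 < Real.sin δ := Real.sin_pos_of_pos_of_lt_pi hδ (by linarith [Real.pi_gt_three])
      have h4 : Real.sin x ≠ 0 := by
        intro h0
        have := Real.sin_sq_add_cos_sq x
        rw [h0, hx] at this
        norm_num at this
      positivity
    · exact ⟨x, ⟨le_rfl, hxy.le⟩, by positivity⟩
  linarith

theorem surjective_prim : Function.Surjective (prim f) := by
  have h0 : prim f 0 = 0 := by simp [prim]
  have hb : ∀ x : ℝ, |Real.cos x * Real.sin x| ≤ 1 := fun x => by
    rw [abs_mul]
    exact mul_le_one₀ (Real.abs_cos_le_one x) (abs_nonneg _) (Real.abs_sin_le_one x)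
  refine hf.continuous_prim.surjective ?_ ?_
  -- The integral of `cos ^ 2` from `0` to `x` is `(x + cos x * sin x) / 2`, and the product is at
  -- least `-1`.
  · refine tendsto_atTop_mono' atTop (f₁ := fun x : ℝ => (x + -1) * 2⁻¹) ?_ ?_
    · filter_upwards [eventually_ge_atTop 0] with x hx
      have := hf.integral_cos_sq_le hx
      rw [integral_cos_sq, h0] at this
      have := (abs_le.1 (hb x)).1
      simp at *
      linarith
    · exact (tendsto_id.atTop_add tendsto_const_nhds).atTop_mul_const (by norm_num)
  · refine tendsto_atBot_mono' atBot (f₁ := fun x : ℝ => (x + 1) * 2⁻¹) ?_ ?_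
    · filter_upwards [eventually_le_atBot 0] with x hx
      have := hf.integral_cos_sq_le hx
      rw [integral_cos_sq, h0] at this
      have := (abs_le.1 (hb x)).2
      simp at *
      linarith
    · exact (tendsto_id.atBot_add tendsto_const_nhds).atBot_mul_const (by norm_num)

theorem amp_prim (x : ℝ) : Function.invFun (prim f) (prim f x) = x :=
  Function.leftInverse_invFun hf.strictMono_prim.injective x

theorem prim_amp (s : ℝ) : prim f (Function.invFun (prim f) s) = s :=
  Function.rightInverse_invFun hf.surjective_prim s

theorem strictMono_amp : StrictMono (Function.invFun (prim f)) := by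
  intro s t hst
  rw [← hf.strictMono_prim.lt_iff_lt, hf.prim_amp, hf.prim_amp]
  exact hst

theorem continuous_amp : Continuous (Function.invFun (prim f)) :=
  hf.strictMono_amp.monotone.continuous_of_surjective fun x => ⟨prim f x, hf.amp_prim x⟩

theorem hasDerivAt_amp {s : ℝ} (hc : ContinuousAt f (Function.invFun (prim f) s))
    (h0 : f (Function.invFun (prim f) s) ≠ 0) :
    HasDerivAt (Function.invFun (prim f)) (f (Function.invFun (prim f) s))⁻¹ s := by
  refine HasDerivAt.of_local_left_inverse hf.continuous_amp.continuousAt ?_ h0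
    (Eventually.of_forall hf.prim_amp)
  exact intervalIntegral.integral_hasDerivAt_right (hf.intervalIntegrable _ _)
    hf.measurable.stronglyMeasurable.stronglyMeasurableAtFilter hc

end AmpDensity

theorem cos_sq_le_abs_cos_rpow {a : ℝ} (ha : 0 < a) (ha2 : a ≤ 2) (θ : ℝ) :
    Real.cos θ ^ 2 ≤ |Real.cos θ| ^ a := by
  rcases eq_or_ne (Real.cos θ) 0 with h | h
  · rw [h, abs_zero, Real.zero_rpow ha.ne']; norm_num
  · rw [← sq_abs, ← Real.rpow_natCast]
    exact Real.rpow_le_rpow_of_exponent_ge (abs_pos.2 h) (Real.abs_cos_le_one θ)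
      (by simpa using ha2)

theorem one_sub_sq_mul_sin_sq_pos {q : ℝ} (hq : q ∈ Ioo (0 : ℝ) 1) (θ : ℝ) :
    0 < 1 - q ^ 2 * Real.sin θ ^ 2 := by
  have h1 : Real.sin θ ^ 2 ≤ 1 := Real.sin_sq_le_one θ
  have h2 : q ^ 2 < 1 := by nlinarith [hq.1, hq.2]
  nlinarith [sq_nonneg q, sq_nonneg (Real.sin θ)]

theorem one_sub_sq_mul_sin_sq_le_one (q θ : ℝ) : 1 - q ^ 2 * Real.sin θ ^ 2 ≤ 1 := by
  nlinarith [mul_nonneg (sq_nonneg q) (sq_nonneg (Real.sin θ))]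

/-- The integrand of `ellF1` for modulus less than one. -/
def density1 (p q θ : ℝ) : ℝ :=
  |Real.cos θ| ^ (1 - 2 / p) / √(1 - q ^ 2 * Real.sin θ ^ 2)

/-- The integrand of `ellF1` for modulus one. -/
def densityOne (p θ : ℝ) : ℝ := 1 / |Real.cos θ| ^ (2 / p)

/-- The integrand of `ellF2`. -/
def density2 (p q θ : ℝ) : ℝ := 1 / (1 - q ^ 2 * Real.sin θ ^ 2) ^ (1 / p)

theorem ellF1_eq_prim {p q : ℝ} (hq : q ∈ Ioo (0 : ℝ) 1) : ellF1 p q = prim (density1 p q) := by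
  funext x
  simp [ellF1, prim, density1, hq.2.ne]

theorem ellF1_one_eq_prim (p : ℝ) : ellF1 p 1 = prim (densityOne p) := by
  funext x
  simp [ellF1, prim, densityOne]

theorem ellF2_eq_prim (p q : ℝ) : ellF2 p q = prim (density2 p q) := rfl

theorem two_div_mem_Ioo {p : ℝ} (hp : 2 < p) : 2 / p ∈ Ioo (0 : ℝ) 1 :=
  ⟨by positivity, by rw [div_lt_one (by linarith)]; exact hp⟩

theorem continuous_density1 {p q : ℝ} (hp : 2 < p) (hq : q ∈ Ioo (0 : ℝ) 1) :
    Continuous (density1 p q) := by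
  have := two_div_mem_Ioo hp
  refine Continuous.div ?_ ?_ fun θ => (Real.sqrt_pos.2 (one_sub_sq_mul_sin_sq_pos hq θ)).ne'
  · exact Real.continuous_cos.abs.rpow_const fun θ => Or.inr (by linarith [this.2])
  · fun_prop

theorem continuous_density2 {p q : ℝ} (hq : q ∈ Ioo (0 : ℝ) 1) :
    Continuous (density2 p q) := by
  refine Continuous.div continuous_const ?_
    fun θ => (Real.rpow_pos_of_pos (one_sub_sq_mul_sin_sq_pos hq θ) _).ne'
  refine Continuous.rpow_const (by fun_prop) fun θ => Or.inl (one_sub_sq_mul_sin_sq_pos hq θ).ne'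

theorem ampDensity_density1 {p q : ℝ} (hp : 2 < p) (hq : q ∈ Ioo (0 : ℝ) 1) :
    AmpDensity (density1 p q) where
  measurable := (continuous_density1 hp hq).measurable
  intervalIntegrable := (continuous_density1 hp hq).intervalIntegrable
  cos_sq_le θ := by
    have := two_div_mem_Ioo hp
    refine (cos_sq_le_abs_cos_rpow (a := 1 - 2 / p) (by linarith [this.2])
      (by linarith [this.1]) θ).trans ?_
    refine le_div_self (by positivity) (Real.sqrt_pos.2 (one_sub_sq_mul_sin_sq_pos hq θ)) ?_
    rw [Real.sqrt_le_iff]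
    refine ⟨zero_le_one, ?_⟩
    rw [one_pow]
    exact one_sub_sq_mul_sin_sq_le_one q θ

theorem ampDensity_density2 {p q : ℝ} (hp : 2 < p) (hq : q ∈ Ioo (0 : ℝ) 1) :
    AmpDensity (density2 p q) where
  measurable := (continuous_density2 hq).measurable
  intervalIntegrable := (continuous_density2 hq).intervalIntegrable
  cos_sq_le θ := by
    refine (Real.cos_sq_le_one θ).trans ?_
    refine (one_le_div (Real.rpow_pos_of_pos (one_sub_sq_mul_sin_sq_pos hq θ) _)).2 ?_
    exact Real.rpow_le_one (one_sub_sq_mul_sin_sq_pos hq θ).le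
      (one_sub_sq_mul_sin_sq_le_one q θ) (by positivity)

theorem densityOne_eq (p θ : ℝ) : densityOne p θ = |Real.cos θ| ^ (-(2 / p)) := by
  rw [densityOne, Real.rpow_neg (abs_nonneg _), one_div]

theorem sin_ne_zero_of_cos_eq_zero {θ : ℝ} (h : Real.cos θ = 0) : Real.sin θ ≠ 0 := by
  intro h0
  have := Real.sin_sq_add_cos_sq θ
  rw [h0, h] at this
  norm_num at this

/-- The integrand blows up at the zeros of `cos`, but these are simple and `2 / p < 1`, so the
singularities are integrable. This is where finiteness of `ellK p` comes from. -/
theorem ampDensity_densityOne {p : ℝ} (hp : 2 < p) : AmpDensity (densityOne p) where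
  measurable := by unfold densityOne; fun_prop
  intervalIntegrable a b := by
    have h2 := two_div_mem_Ioo hp
    have h1 : ∀ a b, a ≤ b → IntervalIntegrable (densityOne p) volume a b := by
      intro a b hab
      rw [intervalIntegrable_iff_integrableOn_Ioo_of_le hab]
      have := memLp_of_isBigO_rpow (g := densityOne p) (r := 1) (τ := 2 / p) le_rfl
        (by linarith [h2.2]) (Measurable.aestronglyMeasurable (by unfold densityOne; fun_prop)) (by
          intro x
          have := abs_rpow_isBigO_of_hasDerivAt (fun x => Real.hasDerivAt_cos x)
            (fun x hx => neg_ne_zero.2 (sin_ne_zero_of_cos_eq_zero hx)) h2.1.le x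
          simpa only [← densityOne_eq] using this) a b
      rw [ENNReal.ofReal_one, memLp_one_iff_integrable] at this
      exact this
    rcases le_total a b with h | h
    · exact h1 a b h
    · exact (h1 b a h).symm
  cos_sq_le θ := by
    rcases eq_or_ne (Real.cos θ) 0 with h | h
    · rw [densityOne_eq, h]; norm_num; positivity
    · refine (Real.cos_sq_le_one θ).trans ?_
      refine (one_le_div (Real.rpow_pos_of_pos (abs_pos.2 h) _)).2 ?_
      exact Real.rpow_le_one (abs_nonneg _) (Real.abs_cos_le_one θ) (two_div_mem_Ioo hp).1.le

theorem continuousAt_densityOne {p θ : ℝ} (h : Real.cos θ ≠ 0) :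
    ContinuousAt (densityOne p) θ := by
  refine ContinuousAt.div continuousAt_const ?_ (Real.rpow_pos_of_pos (abs_pos.2 h) _).ne'
  exact Real.continuous_cos.abs.continuousAt.rpow_const (Or.inl (abs_ne_zero.2 h))

/-! ### Signed powers -/

theorem hasDerivAt_abs_rpow_mul_self (a : ℝ) {x : ℝ} (hx : x ≠ 0) :
    HasDerivAt (fun x => |x| ^ a * x) ((a + 1) * |x| ^ a) x := by
  have h := ((hasDerivAt_abs hx).rpow_const (p := a) (Or.inl (abs_ne_zero.2 hx))).mul
    (hasDerivAt_id x)
  refine h.congr_deriv ?_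
  have e : |x| ^ a = |x| ^ (a - 1) * |x| := by
    rw [← Real.rpow_add_one (abs_ne_zero.2 hx)]; ring_nf
  have e2 : (SignType.sign x : ℝ) * x = |x| := by
    rw [mul_comm]; exact self_mul_sign x
  simp only [id, mul_one]
  rw [e, ← e2]
  ring

theorem abs_abs_rpow_mul_self {a : ℝ} (ha : a + 1 ≠ 0) (x : ℝ) :
    |(|x| ^ a * x)| = |x| ^ (a + 1) := by
  rcases eq_or_ne x 0 with rfl | hx
  · simp [Real.zero_rpow ha]
  · rw [abs_mul, abs_of_nonneg (Real.rpow_nonneg (abs_nonneg x) a),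
      Real.rpow_add_one (abs_ne_zero.2 hx)]

/-- Negative `a` matters: `cn` uses the exponent `2 / p - 1`. At the origin the modulus is `|x| ^ (a
+ 1)`, which tends to zero. -/
theorem continuous_abs_rpow_mul_self {a : ℝ} (ha : -1 < a) :
    Continuous (fun x : ℝ => |x| ^ a * x) := by
  rw [continuous_iff_continuousAt]
  intro x
  rcases eq_or_ne x 0 with rfl | hx
  · rw [ContinuousAt, mul_zero, tendsto_zero_iff_abs_tendsto_zero]
    have h : Tendsto (fun x : ℝ => |x| ^ (a + 1)) (𝓝 0) (𝓝 (|0| ^ (a + 1))) :=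
      (continuous_abs.rpow_const fun _ => Or.inr (by linarith)).tendsto 0
    rw [abs_zero, Real.zero_rpow (by linarith)] at h
    refine h.congr fun x => ?_
    rw [Function.comp_apply, abs_abs_rpow_mul_self (by linarith)]
  · exact (hasDerivAt_abs_rpow_mul_self a hx).continuousAt

/-! ### Plane-valued functions -/

theorem hasDerivAt_pair {f g : ℝ → ℝ} {f' g' x : ℝ} (hf : HasDerivAt f f' x)
    (hg : HasDerivAt g g' x) :
    HasDerivAt (fun t => (!₂[f t, g t] : Plane)) !₂[f', g'] x := by
  have h : HasDerivAt (fun t => ![f t, g t]) ![f', g'] x := by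
    rw [hasDerivAt_pi]
    intro i
    fin_cases i
    · exact hf
    · exact hg
  exact ((EuclideanSpace.equiv (Fin 2) ℝ).symm.toContinuousLinearMap.hasFDerivAt).comp_hasDerivAt
    x h

theorem continuous_pair {f g : ℝ → ℝ} (hf : Continuous f) (hg : Continuous g) :
    Continuous (fun t => (!₂[f t, g t] : Plane)) := by
  have h : Continuous (fun t => ![f t, g t]) := by
    refine continuous_pi fun i => ?_
    fin_cases i
    · exact hf
    · exact hg
  exact (EuclideanSpace.equiv (Fin 2) ℝ).symm.continuous.comp h

theorem norm_pair_sq (a b : ℝ) : ‖(!₂[a, b] : Plane)‖ ^ 2 = a ^ 2 + b ^ 2 := by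
  simp [EuclideanSpace.norm_sq_eq, Fin.sum_univ_two]

theorem norm_pair_eq_one {a b : ℝ} (h : a ^ 2 + b ^ 2 = 1) : ‖(!₂[a, b] : Plane)‖ = 1 := by
  have := norm_pair_sq a b
  rw [h] at this
  exact (pow_eq_one_iff_of_nonneg (norm_nonneg _) two_ne_zero).1 this

theorem pair_congr {a b c d : ℝ} (h₁ : a = c) (h₂ : b = d) : (!₂[a, b] : Plane) = !₂[c, d] := by
  rw [h₁, h₂]

theorem smul_pair (c a b : ℝ) : c • (!₂[a, b] : Plane) = !₂[c * a, c * b] := by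
  ext i; fin_cases i <;> simp

theorem add_pair (a b c d : ℝ) : (!₂[a, b] : Plane) + !₂[c, d] = !₂[a + c, b + d] := by
  ext i; fin_cases i <;> simp

theorem sub_pair (a b c d : ℝ) : (!₂[a, b] : Plane) - !₂[c, d] = !₂[a - c, b - d] := by
  ext i; fin_cases i <;> simp

theorem zero_pair : (!₂[0, 0] : Plane) = 0 := by
  ext i; fin_cases i <;> simp

theorem ne_zero_of_norm_eq_one {v : Plane} (h : ‖v‖ = 1) : v ≠ 0 := by
  rintro rfl; simp at h

/-! ### Functions with a power singularity -/

section Singular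

variable {F : Type*} [NormedAddCommGroup F] [NormedSpace ℝ F]

theorem rpow_smul_isBigO {Y Y' : ℝ → ℝ} (h : ∀ x, HasDerivAt Y (Y' x) x)
    (h' : ∀ x, Y x = 0 → Y' x ≠ 0) {τ : ℝ} (hτ : 0 ≤ τ) {H : ℝ → F} (x : ℝ)
    (hH : H =O[𝓝[≠] x] fun _ => (1 : ℝ)) :
    (fun t => |Y t| ^ (-τ) • H t) =O[𝓝[≠] x] fun t => |t - x| ^ (-τ) := by
  simpa using (abs_rpow_isBigO_of_hasDerivAt h h' hτ x).smul hH

/-- A nonzero limit keeps `H` away from zero along `l`, so it cannot soften the singularity of the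
power of `Y`. -/
theorem isBigO_rpow_smul {Y : ℝ → ℝ} {Y' x : ℝ} (h : HasDerivAt Y Y' x) (hY : Y x = 0)
    (h' : Y' ≠ 0) {τ : ℝ} (hτ : 0 ≤ τ) {H : ℝ → F} {v : F} {l : Filter ℝ} (hl : l ≤ 𝓝[≠] x)
    (hH : Tendsto H l (𝓝 v)) (hv : v ≠ 0) :
    (fun t => |t - x| ^ (-τ)) =O[l] fun t => |Y t| ^ (-τ) • H t := by
  have h1 := (abs_rpow_isTheta_of_hasDerivAt h hY h' τ hτ).2.mono hl
  have h2 : (fun _ : ℝ => (1 : ℝ)) =O[l] H := by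
    refine IsBigO.of_bound (2 / ‖v‖) ?_
    have h0 : 0 < ‖v‖ := norm_pos_iff.2 hv
    filter_upwards [hH.norm.eventually (lt_mem_nhds (half_lt_self h0))] with t ht
    rw [norm_one, div_mul_eq_mul_div, one_le_div h0]
    linarith
  simpa using h1.smul h2

end Singular

/-! ### Wavelike curves -/

section Wave

variable {p q : ℝ}

theorem am1_eq (hq : q ∈ Ioo (0 : ℝ) 1) : am1 p q = Function.invFun (prim (density1 p q)) := by
  rw [am1, ellF1_eq_prim hq]

/-- If `sin β = q * sin θ` with `|β| < π / 2`, this is `cos β`. Then `waveTangent` is `(cos 2β, sin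
2β)` and `waveNormal` is its rotation by a right angle. -/
def waveW (q θ : ℝ) : ℝ := √(1 - q ^ 2 * Real.sin θ ^ 2)

def waveTangent (q θ : ℝ) : Plane :=
  !₂[1 - 2 * q ^ 2 * Real.sin θ ^ 2, 2 * q * Real.sin θ * waveW q θ]

def waveNormal (q θ : ℝ) : Plane :=
  !₂[-(2 * q * Real.sin θ * waveW q θ), 1 - 2 * q ^ 2 * Real.sin θ ^ 2]

/-- A multiple of the height of the wavelike profile. -/
def waveHeight (p q s : ℝ) : ℝ :=
  |Real.cos (am1 p q s)| ^ (1 - 2 / p) * Real.cos (am1 p q s)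

/-- What is left of the third derivative after extracting the singular power of the height. The
normal part comes from the derivative of the curvature. The tangential part, minus the squared
curvature, is regular and is premultiplied by the opposite power to compensate. -/
def waveFactor (p q s : ℝ) : Plane :=
  (-(4 * q / p * Real.sin (am1 p q s) * waveW q (am1 p q s))) • waveNormal q (am1 p q s) -
    (|waveHeight p q s| ^ ((p - 2) / (p - 1)) * (2 * q * cn p q s) ^ 2) •
      waveTangent q (am1 p q s)

/-- The first three derivatives of the wavelike profile. -/
def waveChain (p q : ℝ) : ℕ → ℝ → Plane
  | 0 => wavelikeProfile p q
  | 1 => fun s => waveTangent q (am1 p q s)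
  | 2 => fun s => (2 * q * cn p q s) • waveNormal q (am1 p q s)
  | _ => fun s => |waveHeight p q s| ^ (-((p - 2) / (p - 1))) • waveFactor p q s

theorem waveW_pos (hq : q ∈ Ioo (0 : ℝ) 1) (θ : ℝ) : 0 < waveW q θ :=
  Real.sqrt_pos.2 (one_sub_sq_mul_sin_sq_pos hq θ)

theorem waveW_sq (hq : q ∈ Ioo (0 : ℝ) 1) (θ : ℝ) :
    waveW q θ ^ 2 = 1 - q ^ 2 * Real.sin θ ^ 2 :=
  Real.sq_sqrt (one_sub_sq_mul_sin_sq_pos hq θ).le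

theorem continuous_waveW : Continuous (waveW q) := by unfold waveW; fun_prop

theorem continuous_waveTangent : Continuous (waveTangent q) := by
  have := continuous_waveW (q := q)
  unfold waveTangent
  exact continuous_pair (by fun_prop) (by fun_prop)

theorem continuous_waveNormal : Continuous (waveNormal q) := by
  have := continuous_waveW (q := q)
  unfold waveNormal
  exact continuous_pair (by fun_prop) (by fun_prop)

theorem hasDerivAt_waveW (hq : q ∈ Ioo (0 : ℝ) 1) (θ : ℝ) :
    HasDerivAt (waveW q) (-(q ^ 2 * Real.sin θ * Real.cos θ) / waveW q θ) θ := by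
  have h := ((((Real.hasDerivAt_sin θ).pow 2).const_mul (q ^ 2)).const_sub 1).sqrt
    (one_sub_sq_mul_sin_sq_pos hq θ).ne'
  refine h.congr_deriv ?_
  have := (waveW_pos hq θ).ne'
  change -(q ^ 2 * (((2 : ℕ) : ℝ) * Real.sin θ ^ (2 - 1) * Real.cos θ)) / (2 * waveW q θ) = _
  field_simp
  push_cast
  ring

theorem norm_waveTangent (hq : q ∈ Ioo (0 : ℝ) 1) (θ : ℝ) : ‖waveTangent q θ‖ = 1 := by
  apply norm_pair_eq_one
  rw [mul_pow _ (waveW q θ), waveW_sq hq]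
  ring

theorem norm_waveNormal (hq : q ∈ Ioo (0 : ℝ) 1) (θ : ℝ) : ‖waveNormal q θ‖ = 1 := by
  apply norm_pair_eq_one
  rw [neg_sq, mul_pow _ (waveW q θ), waveW_sq hq]
  ring

theorem hasDerivAt_waveTangent (hq : q ∈ Ioo (0 : ℝ) 1) (θ : ℝ) :
    HasDerivAt (waveTangent q) ((2 * q * Real.cos θ / waveW q θ) • waveNormal q θ) θ := by
  have hs := Real.hasDerivAt_sin θ
  have h := hasDerivAt_pair (((hs.pow 2).const_mul (2 * q ^ 2)).const_sub 1)
    ((hs.const_mul (2 * q)).mul (hasDerivAt_waveW hq θ))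
  refine h.congr_deriv ?_
  have h0 := (waveW_pos hq θ).ne'
  have h2 := waveW_sq hq θ
  rw [waveNormal, smul_pair]
  refine pair_congr ?_ ?_
  · push_cast
    field_simp
  · field_simp
    rw [h2]
    ring

theorem hasDerivAt_waveNormal (hq : q ∈ Ioo (0 : ℝ) 1) (θ : ℝ) :
    HasDerivAt (waveNormal q) (-(2 * q * Real.cos θ / waveW q θ) • waveTangent q θ) θ := by
  have hs := Real.hasDerivAt_sin θ
  have h := hasDerivAt_pair ((hs.const_mul (2 * q)).mul (hasDerivAt_waveW hq θ)).neg
    (((hs.pow 2).const_mul (2 * q ^ 2)).const_sub 1)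
  refine h.congr_deriv ?_
  have h0 := (waveW_pos hq θ).ne'
  have h2 := waveW_sq hq θ
  rw [waveTangent, smul_pair]
  refine pair_congr ?_ ?_
  · field_simp
    rw [h2]
    ring
  · push_cast
    field_simp

theorem continuous_am1 (hp : 2 < p) (hq : q ∈ Ioo (0 : ℝ) 1) : Continuous (am1 p q) := by
  rw [am1_eq hq]; exact (ampDensity_density1 hp hq).continuous_amp

theorem hasDerivAt_am1 (hp : 2 < p) (hq : q ∈ Ioo (0 : ℝ) 1) {s : ℝ}
    (hs : Real.cos (am1 p q s) ≠ 0) :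
    HasDerivAt (am1 p q) (waveW q (am1 p q s) / |Real.cos (am1 p q s)| ^ (1 - 2 / p)) s := by
  have h0 : density1 p q (am1 p q s) ≠ 0 :=
    (div_pos (Real.rpow_pos_of_pos (abs_pos.2 hs) _) (waveW_pos hq _)).ne'
  rw [am1_eq hq] at *
  refine ((ampDensity_density1 hp hq).hasDerivAt_amp (continuous_density1 hp hq).continuousAt
    h0).congr_deriv ?_
  rw [density1, inv_div]
  rfl

theorem cn_eq (p q : ℝ) :
    cn p q = (fun x => |x| ^ (2 / p - 1) * x) ∘ fun s => Real.cos (am1 p q s) :=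
  rfl

theorem abs_cn_rpow_mul_cn (hp : 2 < p) (s : ℝ) :
    |cn p q s| ^ (p - 2) * cn p q s = waveHeight p q s := by
  unfold waveHeight
  have h2 := two_div_mem_Ioo hp
  have e : |cn p q s| = |Real.cos (am1 p q s)| ^ (2 / p - 1 + 1) :=
    abs_abs_rpow_mul_self (by linarith [h2.1]) _
  rcases eq_or_ne (Real.cos (am1 p q s)) 0 with h | h
  · simp [cn, h]
  · rw [e, ← Real.rpow_mul (abs_nonneg _), cn, ← mul_assoc, ← Real.rpow_add (abs_pos.2 h)]
    congr 2
    field_simp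
    ring

/-- The derivative of the curvature contains `|cos| ^ (2 / p - 1)` from the signed power, divided by
`|cos| ^ (1 - 2 / p)` from the amplitude. This converts the resulting power to one of the height,
which, unlike `cos (am1 p q s)`, has simple zeros. -/
theorem abs_cos_rpow_eq (hp : 2 < p) (s : ℝ) :
    |Real.cos (am1 p q s)| ^ (4 / p - 2) = |waveHeight p q s| ^ (-((p - 2) / (p - 1))) := by
  have h2 := two_div_mem_Ioo hp
  have e : |waveHeight p q s| = |Real.cos (am1 p q s)| ^ (1 - 2 / p + 1) :=
    abs_abs_rpow_mul_self (by linarith [h2.2]) _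
  rw [e, ← Real.rpow_mul (abs_nonneg _)]
  congr 1
  have : p - 1 ≠ 0 := by linarith
  field_simp
  ring

theorem waveHeight_eq_zero_iff {s : ℝ} :
    waveHeight p q s = 0 ↔ Real.cos (am1 p q s) = 0 := by
  unfold waveHeight
  constructor
  · intro h
    by_contra h'
    exact (mul_ne_zero (Real.rpow_pos_of_pos (abs_pos.2 h') _).ne' h') h
  · intro h; simp [h]

theorem cn_eq_zero_iff {s : ℝ} : cn p q s = 0 ↔ Real.cos (am1 p q s) = 0 := by
  rw [cn]
  constructor
  · intro h
    by_contra h'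
    exact (mul_ne_zero (Real.rpow_pos_of_pos (abs_pos.2 h') _).ne' h') h
  · intro h; simp [h]

theorem continuous_cn (hp : 2 < p) (hq : q ∈ Ioo (0 : ℝ) 1) : Continuous (cn p q) := by
  have h2 := two_div_mem_Ioo hp
  rw [cn_eq]
  exact (continuous_abs_rpow_mul_self (by linarith [h2.1])).comp
    (Real.continuous_cos.comp (continuous_am1 hp hq))

theorem continuous_waveHeight (hp : 2 < p) (hq : q ∈ Ioo (0 : ℝ) 1) :
    Continuous (waveHeight p q) := by
  have h2 := two_div_mem_Ioo hp
  exact (continuous_abs_rpow_mul_self (a := 1 - 2 / p) (by linarith [h2.2])).comp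
    (Real.continuous_cos.comp (continuous_am1 hp hq))

theorem countable_cos_am1_eq_zero (hp : 2 < p) (hq : q ∈ Ioo (0 : ℝ) 1) :
    {s | Real.cos (am1 p q s) = 0}.Countable := by
  have h : {x | Real.cos x = 0}.Countable := by
    have : {x | Real.cos x = 0} = range fun k : ℤ => (2 * k + 1) * Real.pi / 2 := by
      ext x
      refine Real.cos_eq_zero_iff.trans ?_
      simp only [mem_range, eq_comm]
    rw [this]
    exact countable_range _
  refine h.preimage_of_injOn (f := am1 p q) ?_
  rw [am1_eq hq]
  exact (ampDensity_density1 hp hq).strictMono_amp.injective.injOn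

theorem hasDerivAt_waveHeight_of_ne (hp : 2 < p) (hq : q ∈ Ioo (0 : ℝ) 1) {s : ℝ}
    (hs : Real.cos (am1 p q s) ≠ 0) :
    HasDerivAt (waveHeight p q)
      (-((2 - 2 / p) * Real.sin (am1 p q s) * waveW q (am1 p q s))) s := by
  have h := (hasDerivAt_abs_rpow_mul_self (1 - 2 / p) hs).comp s
    ((Real.hasDerivAt_cos _).comp s (hasDerivAt_am1 hp hq hs))
  refine h.congr_deriv ?_
  have : |Real.cos (am1 p q s)| ^ (1 - 2 / p) ≠ 0 := (Real.rpow_pos_of_pos (abs_pos.2 hs) _).ne'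
  simp only [Function.comp_def] at *
  field_simp
  ring

/-- The amplitude has infinite slope at the zeros of `cos`, but its denominator `|cos| ^ (1 - 2 /
p)` cancels in the derivative of the height. The resulting formula is continuous, so the countably
many exceptional points can be removed. -/
theorem hasDerivAt_waveHeight (hp : 2 < p) (hq : q ∈ Ioo (0 : ℝ) 1) (s : ℝ) :
    HasDerivAt (waveHeight p q)
      (-((2 - 2 / p) * Real.sin (am1 p q s) * waveW q (am1 p q s))) s := by
  have h1 := continuous_am1 hp hq
  have h2 := (continuous_waveW (q := q)).comp h1
  exact hasDerivAt_of_off_countable (countable_cos_am1_eq_zero hp hq)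
    (continuous_waveHeight hp hq)
    (g := fun s => -((2 - 2 / p) * Real.sin (am1 p q s) * waveW q (am1 p q s)))
    (by simp only [Function.comp_def] at h2; fun_prop)
    (fun x hx => hasDerivAt_waveHeight_of_ne hp hq hx) s

theorem continuous_ellE1_density (hp : 2 < p) : Continuous fun θ =>
    √(1 - q ^ 2 * Real.sin θ ^ 2) * |Real.cos θ| ^ (1 - 2 / p) := by
  have h2 := two_div_mem_Ioo hp
  refine Continuous.mul (by fun_prop) ?_
  exact Real.continuous_cos.abs.rpow_const fun θ => Or.inr (by linarith [h2.2])

theorem wavelikeProfile_eq (hp : 2 < p) (s : ℝ) : wavelikeProfile p q s =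
    !₂[2 * ellE1 p q (am1 p q s) - s, -q * (p / (p - 1)) * waveHeight p q s] := by
  rw [wavelikeProfile, abs_cn_rpow_mul_cn hp]

theorem derivChain_waveChain (hp : 2 < p) (hq : q ∈ Ioo (0 : ℝ) 1) :
    DerivChain {s | Real.cos (am1 p q s) = 0} 3 (waveChain p q) where
  countable := countable_cos_am1_eq_zero hp hq
  continuous j hj := by
    have cA := continuous_am1 hp hq
    have cE : Continuous (ellE1 p q) := continuous_iff_continuousAt.2 fun x =>
      (hasDerivAt_prim (continuous_ellE1_density (q := q) hp) x).continuousAt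
    have cY := continuous_waveHeight hp hq
    interval_cases j
    · simp only [waveChain]
      simp only [funext (wavelikeProfile_eq (q := q) hp)]
      exact continuous_pair (((cE.comp cA).const_smul (2 : ℝ)).sub continuous_id)
        (cY.const_smul (-q * (p / (p - 1))))
    · exact continuous_waveTangent.comp cA
    · exact ((continuous_cn hp hq).const_smul (2 * q)).smul (continuous_waveNormal.comp cA)
  hasDerivAt j hj s hs := by
    have hs' : Real.cos (am1 p q s) ≠ 0 := hs
    have hD : |Real.cos (am1 p q s)| ^ (1 - 2 / p) ≠ 0 :=
      (Real.rpow_pos_of_pos (abs_pos.2 hs') _).ne'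
    have hA := hasDerivAt_am1 hp hq hs'
    have hW := (waveW_pos hq (am1 p q s)).ne'
    have hcn : cn p q s = Real.cos (am1 p q s) / |Real.cos (am1 p q s)| ^ (1 - 2 / p) := by
      rw [cn, ← neg_sub 1 (2 / p), Real.rpow_neg (abs_nonneg _)]
      field_simp
    interval_cases j
    · simp only [waveChain]
      rw [funext (wavelikeProfile_eq (q := q) hp)]
      have h := hasDerivAt_pair
        ((((hasDerivAt_prim (continuous_ellE1_density (q := q) hp) _).comp s hA).const_mul 2).sub
          (hasDerivAt_id s)) ((hasDerivAt_waveHeight hp hq s).const_mul (-q * (p / (p - 1))))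
      refine h.congr_deriv ?_
      rw [waveTangent]
      refine pair_congr ?_ ?_
      · have h2 := waveW_sq hq (am1 p q s)
        rw [show √(1 - q ^ 2 * Real.sin (am1 p q s) ^ 2) = waveW q (am1 p q s) from rfl]
        have h3 : waveW q (am1 p q s) * |Real.cos (am1 p q s)| ^ (1 - 2 / p) *
            (waveW q (am1 p q s) / |Real.cos (am1 p q s)| ^ (1 - 2 / p)) =
            waveW q (am1 p q s) ^ 2 := by field_simp
        rw [h3, h2]
        ring
      · have : p - 1 ≠ 0 := by linarith
        field_simp
    · simp only [waveChain]
      refine ((hasDerivAt_waveTangent hq _).scomp s hA).congr_deriv ?_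
      rw [smul_smul, hcn]
      congr 1
      field_simp
    · simp only [waveChain]
      have h1 := (hasDerivAt_abs_rpow_mul_self (2 / p - 1) hs').comp s
        ((Real.hasDerivAt_cos _).comp s hA)
      have h2 := (h1.const_mul (2 * q)).smul ((hasDerivAt_waveNormal hq _).scomp s hA)
      refine h2.congr_deriv ?_
      -- Off the exceptional set the height is nonzero, so the compensating power in `waveFactor`
      -- cancels the singular one.
      have e1 : |waveHeight p q s| ^ (-((p - 2) / (p - 1))) *
          |waveHeight p q s| ^ ((p - 2) / (p - 1)) = 1 := by
        rw [Real.rpow_neg (abs_nonneg _)]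
        refine inv_mul_cancel₀ (Real.rpow_pos_of_pos (abs_pos.2 ?_) _).ne'
        rw [Ne, waveHeight_eq_zero_iff]
        exact hs'
      have e1' : ∀ x, |waveHeight p q s| ^ (-((p - 2) / (p - 1))) *
          (|waveHeight p q s| ^ ((p - 2) / (p - 1)) * x) = x := fun x => by
        rw [← mul_assoc, e1, one_mul]
      have e2 : |Real.cos (am1 p q s)| ^ (2 / p - 1) / |Real.cos (am1 p q s)| ^ (1 - 2 / p) =
          |waveHeight p q s| ^ (-((p - 2) / (p - 1))) := by
        rw [← abs_cos_rpow_eq hp, ← Real.rpow_sub (abs_pos.2 hs')]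
        congr 1; ring
      rw [waveFactor, smul_sub, smul_smul (|waveHeight p q s| ^ (-((p - 2) / (p - 1)))),
        smul_smul (|waveHeight p q s| ^ (-((p - 2) / (p - 1)))), e1', ← e2,
        add_comm, sub_eq_add_neg (_ • waveNormal q (am1 p q s)), ← neg_smul, smul_smul, smul_smul]
      have e3 : |Real.cos (am1 p q s)| ^ (2 / p - 1) * Real.cos (am1 p q s) = cn p q s := rfl
      simp only [Function.comp_def]
      rw [e3]
      congr 2
      · field_simp
        ring
      · rw [hcn]
        field_simp

theorem norm_waveChain_one (hq : q ∈ Ioo (0 : ℝ) 1) (s : ℝ) : ‖waveChain p q 1 s‖ = 1 :=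
  norm_waveTangent hq _

theorem waveChain_two_eq_zero_iff (hq : q ∈ Ioo (0 : ℝ) 1) {s : ℝ} :
    waveChain p q 2 s = 0 ↔ Real.cos (am1 p q s) = 0 := by
  simp only [waveChain, smul_eq_zero, mul_eq_zero, cn_eq_zero_iff,
    ne_zero_of_norm_eq_one (norm_waveNormal hq _), hq.1.ne', or_false]
  norm_num

/-- At a zero of the curvature the tangential part drops out, and the normal coefficient survives
because `sin = ±1` there. -/
theorem waveFactor_ne_zero (hp : 2 < p) (hq : q ∈ Ioo (0 : ℝ) 1) {s : ℝ}
    (hs : Real.cos (am1 p q s) = 0) : waveFactor p q s ≠ 0 := by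
  have h1 := (cn_eq_zero_iff (p := p) (q := q)).2 hs
  rw [waveFactor, h1]
  simp only [mul_zero, ne_eq, OfNat.ofNat_ne_zero, not_false_eq_true, zero_pow, zero_smul, sub_zero,
    smul_eq_zero, neg_eq_zero, mul_eq_zero, div_eq_zero_iff, or_false, hq.1.ne',
    sin_ne_zero_of_cos_eq_zero hs, (waveW_pos hq _).ne',
    ne_zero_of_norm_eq_one (norm_waveNormal hq _), or_self, false_or]
  intro h
  linarith

theorem continuous_waveFactor (hp : 2 < p) (hq : q ∈ Ioo (0 : ℝ) 1) :
    Continuous (waveFactor p q) := by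
  have cA := continuous_am1 hp hq
  have h1 := (continuous_waveNormal (q := q)).comp cA
  have h2 := (continuous_waveTangent (q := q)).comp cA
  have h3 := (continuous_waveW (q := q)).comp cA
  have h4 : Continuous fun s => |waveHeight p q s| ^ ((p - 2) / (p - 1)) :=
    (continuous_waveHeight hp hq).abs.rpow_const
      fun _ => Or.inr (div_nonneg (by linarith) (by linarith))
  have h5 := continuous_cn hp hq
  simp only [Function.comp_def] at h1 h2 h3
  unfold waveFactor
  fun_prop

theorem waveChain_isBigO (hp : 2 < p) (hq : q ∈ Ioo (0 : ℝ) 1) (x : ℝ) :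
    waveChain p q 3 =O[𝓝[≠] x] fun t => |t - x| ^ (-((p - 2) / (p - 1))) := by
  refine rpow_smul_isBigO (fun x => hasDerivAt_waveHeight hp hq x) (fun x hx => ?_)
    (div_nonneg (by linarith) (by linarith)) x
    (((continuous_waveFactor hp hq).tendsto x).norm.isBoundedUnder_le.isBigO_one ℝ |>.mono
      nhdsWithin_le_nhds)
  have hx' := (waveHeight_eq_zero_iff).1 hx
  have h2 := two_div_mem_Ioo hp
  have h3 : (2 - 2 / p) ≠ 0 := by linarith [h2.2]
  exact neg_ne_zero.2 (mul_ne_zero (mul_ne_zero h3 (sin_ne_zero_of_cos_eq_zero hx'))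
    (waveW_pos hq _).ne')

/-- Together with `waveChain_isBigO` this fixes the exact order of the third derivative at a zero of
the curvature, and so the critical exponent. -/
theorem isBigO_waveChain (hp : 2 < p) (hq : q ∈ Ioo (0 : ℝ) 1) {x : ℝ}
    (hx : Real.cos (am1 p q x) = 0) :
    (fun t => |t - x| ^ (-((p - 2) / (p - 1)))) =O[𝓝[≠] x] waveChain p q 3 := by
  have h2 := two_div_mem_Ioo hp
  have h3 : (2 - 2 / p) ≠ 0 := by linarith [h2.2]
  exact isBigO_rpow_smul (hasDerivAt_waveHeight hp hq x) ((waveHeight_eq_zero_iff).2 hx)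
    (neg_ne_zero.2 (mul_ne_zero (mul_ne_zero h3 (sin_ne_zero_of_cos_eq_zero hx))
      (waveW_pos hq _).ne')) (div_nonneg (by linarith) (by linarith)) le_rfl
    (((continuous_waveFactor hp hq).tendsto x).mono_left nhdsWithin_le_nhds)
    (waveFactor_ne_zero hp hq hx)

end Wave

/-! ### Orbitlike curves -/

/-- A holomorphic `g` has a primitive on a disc around `x`. Normalized to equal `F x` at `x`, its
real part on the real axis has the same derivative as `F` and hence coincides with `F` nearby. -/
theorem analyticAt_of_hasDerivAt_re {F : ℝ → ℝ} {g : ℂ → ℂ} {x : ℝ} (hg : AnalyticAt ℂ g x)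
    (hF : ∀ t : ℝ, HasDerivAt F (g t).re t) : AnalyticAt ℝ F x := by
  obtain ⟨r, hr, hball⟩ := Metric.eventually_nhds_iff_ball.1 hg.eventually_analyticAt
  have hd : DifferentiableOn ℂ g (Metric.ball (x : ℂ) r) := fun z hz =>
    (hball z hz).differentiableAt.differentiableWithinAt
  obtain ⟨G, hGx, hG⟩ := hd.isExactOn_ball.with_val_at (x : ℂ) (F x : ℂ)
  have hGa : AnalyticAt ℂ G x :=
    DifferentiableOn.analyticAt (fun z hz => (hG z hz).differentiableAt.differentiableWithinAt)
      (Metric.ball_mem_nhds _ hr)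
  have hmem : ∀ t ∈ Metric.ball x r, (t : ℂ) ∈ Metric.ball (x : ℂ) r := fun t ht => by
    rw [Metric.mem_ball, Complex.dist_of_im_eq (by simp)]
    simpa using ht
  have hGd : ∀ t ∈ Metric.ball x r, HasDerivAt (fun t : ℝ => (G t).re) (g t).re t :=
    fun t ht => (hG t (hmem t ht)).real_of_complex
  have heq : EqOn (fun t : ℝ => (G t).re) F (Metric.ball x r) :=
    Metric.isOpen_ball.eqOn_of_deriv_eq (convex_ball x r).isPreconnected
      (fun t ht => (hGd t ht).differentiableAt.differentiableWithinAt)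
      (fun t _ => (hF t).differentiableAt.differentiableWithinAt)
      (fun t ht => by rw [(hGd t ht).deriv, (hF t).deriv]) (Metric.mem_ball_self hr)
      (by simp [hGx])
  exact hGa.re_ofReal.congr (heq.eventuallyEq_of_mem (Metric.ball_mem_nhds _ hr))

theorem AmpDensity.analyticAt_amp {f : ℝ → ℝ} (hf : AmpDensity f) {s : ℝ}
    (hd : HasDerivAt (prim f) (f (Function.invFun (prim f) s)) (Function.invFun (prim f) s))
    (h0 : f (Function.invFun (prim f) s) ≠ 0)
    (ha : AnalyticAt ℝ (prim f) (Function.invFun (prim f) s)) :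
    AnalyticAt ℝ (Function.invFun (prim f)) s := by
  let e : ℝ ≃ₜ ℝ :=
    { toFun := prim f
      invFun := Function.invFun (prim f)
      left_inv := hf.amp_prim
      right_inv := hf.prim_amp
      continuous_toFun := hf.continuous_prim
      continuous_invFun := hf.continuous_amp }
  exact (e.toOpenPartialHomeomorph.contDiffAt_symm_deriv (n := ω) (a := s) h0 (mem_univ _) hd
    ha.contDiffAt).analyticAt

section Orbit

variable {p q : ℝ}

/-- The base `1 - q ^ 2 * sin ^ 2` is a positive real at `x`, so it stays in the slit plane nearby
and the principal complex power is holomorphic. -/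
theorem analyticAt_prim_rpow (hq : q ∈ Ioo (0 : ℝ) 1) (a x : ℝ) :
    AnalyticAt ℝ (prim fun θ => (1 - q ^ 2 * Real.sin θ ^ 2) ^ a) x := by
  refine analyticAt_of_hasDerivAt_re
    (g := fun z => (1 - (q : ℂ) ^ 2 * Complex.sin z ^ 2) ^ (a : ℂ)) ?_ fun t => ?_
  · have hs : AnalyticAt ℂ Complex.sin x := Complex.differentiable_sin.analyticAt _
    refine AnalyticAt.cpow (analyticAt_const.sub (analyticAt_const.mul (hs.pow 2)))
      analyticAt_const (Or.inl ?_)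
    have := one_sub_sq_mul_sin_sq_pos hq x
    norm_cast
  · have hc : Continuous fun θ => (1 - q ^ 2 * Real.sin θ ^ 2) ^ a :=
      Continuous.rpow_const (by fun_prop) fun θ => Or.inl (one_sub_sq_mul_sin_sq_pos hq θ).ne'
    refine (hasDerivAt_prim hc t).congr_deriv ?_
    have := Complex.ofReal_cpow (one_sub_sq_mul_sin_sq_pos hq t).le a
    push_cast at this
    rw [← this, ← Complex.ofReal_re ((1 - q ^ 2 * Real.sin t ^ 2) ^ a)]
    rfl

theorem density2_eq (hq : q ∈ Ioo (0 : ℝ) 1) :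
    density2 p q = fun θ => (1 - q ^ 2 * Real.sin θ ^ 2) ^ (-(1 / p)) := by
  funext θ
  rw [density2, Real.rpow_neg (one_sub_sq_mul_sin_sq_pos hq θ).le, one_div]

theorem density2_ne_zero (hq : q ∈ Ioo (0 : ℝ) 1) (θ : ℝ) : density2 p q θ ≠ 0 :=
  (div_pos one_pos (Real.rpow_pos_of_pos (one_sub_sq_mul_sin_sq_pos hq θ) _)).ne'

theorem analyticAt_am2 (hp : 2 < p) (hq : q ∈ Ioo (0 : ℝ) 1) (s : ℝ) :
    AnalyticAt ℝ (am2 p q) s := by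
  rw [am2, ellF2_eq_prim]
  refine (ampDensity_density2 hp hq).analyticAt_amp (hasDerivAt_prim (continuous_density2 hq) _)
    (density2_ne_zero hq _) ?_
  rw [density2_eq hq]
  exact analyticAt_prim_rpow hq _ _

theorem hasDerivAt_am2 (hp : 2 < p) (hq : q ∈ Ioo (0 : ℝ) 1) (s : ℝ) :
    HasDerivAt (am2 p q) ((1 - q ^ 2 * Real.sin (am2 p q s) ^ 2) ^ (1 / p)) s := by
  refine ((ampDensity_density2 hp hq).hasDerivAt_amp (continuous_density2 hq).continuousAt
    (density2_ne_zero hq _)).congr_deriv ?_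
  rw [density2, one_div, inv_inv]
  rfl

/-- Passing to the conjugate exponent turns `1 / p` into `1 - 1 / p`, and `dn ^ (p - 1)` has that
same exponent. Both coordinates then involve the same power. -/
theorem orbitlikeProfile_eq (hp : 2 < p) (hq : q ∈ Ioo (0 : ℝ) 1) : orbitlikeProfile p q =
    fun s => !₂[(1 / q ^ 2) *
        (2 * prim (fun θ => (1 - q ^ 2 * Real.sin θ ^ 2) ^ (1 - 1 / p)) (am2 p q s) +
          (q ^ 2 - 2) * s),
      (1 / q ^ 2) * (-(p / (p - 1)) * (1 - q ^ 2 * Real.sin (am2 p q s) ^ 2) ^ (1 - 1 / p))] := by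
  funext s
  have h1 : p - 1 ≠ 0 := by linarith
  have h2 : 1 / (p / (p - 1)) = 1 - 1 / p := by field_simp
  rw [orbitlikeProfile, smul_pair]
  refine pair_congr ?_ ?_
  · unfold ellE2 prim
    rw [h2]
  · rw [dn, ← Real.rpow_mul (one_sub_sq_mul_sin_sq_pos hq _).le]
    congr 3
    field_simp

theorem analyticAt_pair {f g : ℝ → ℝ} {x : ℝ} (hf : AnalyticAt ℝ f x) (hg : AnalyticAt ℝ g x) :
    AnalyticAt ℝ (fun t => (!₂[f t, g t] : Plane)) x := by
  have h : AnalyticAt ℝ (fun t => ![f t, g t]) x := by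
    refine AnalyticAt.pi fun i => ?_
    fin_cases i
    · exact hf
    · exact hg
  exact ((EuclideanSpace.equiv (Fin 2) ℝ).symm.toContinuousLinearMap.analyticAt _).comp h

theorem analyticAt_orbitlikeProfile (hp : 2 < p) (hq : q ∈ Ioo (0 : ℝ) 1) (s : ℝ) :
    AnalyticAt ℝ (orbitlikeProfile p q) s := by
  rw [orbitlikeProfile_eq hp hq]
  have hA := analyticAt_am2 hp hq s
  have hsin : AnalyticAt ℝ (fun s => 1 - q ^ 2 * Real.sin (am2 p q s) ^ 2) s :=
    analyticAt_const.sub (analyticAt_const.mul ((Real.analyticAt_sin.comp hA).pow 2))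
  refine analyticAt_pair (analyticAt_const.mul ((analyticAt_const.mul
    ((analyticAt_prim_rpow hq _ _).comp hA)).add (analyticAt_const.mul analyticAt_id)))
    (analyticAt_const.mul (analyticAt_const.mul ?_))
  exact ((Real.contDiffAt_rpow_const_of_ne (n := ω) (one_sub_sq_mul_sin_sq_pos hq _).ne').comp s
    hsin.contDiffAt).analyticAt

theorem exists_hasDerivAt_orbitlikeProfile (hp : 2 < p) (hq : q ∈ Ioo (0 : ℝ) 1) (s : ℝ) :
    ∃ v : Plane, HasDerivAt (orbitlikeProfile p q) v s ∧ ‖v‖ = 1 := by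
  -- The tangent is `(cos 2θ, sin 2θ)`, where `θ` is the amplitude.
  refine ⟨!₂[1 - 2 * Real.sin (am2 p q s) ^ 2,
    2 * Real.sin (am2 p q s) * Real.cos (am2 p q s)], ?_, ?_⟩
  · rw [orbitlikeProfile_eq hp hq]
    have hA := hasDerivAt_am2 hp hq s
    have hpos := one_sub_sq_mul_sin_sq_pos hq (am2 p q s)
    have hc : Continuous fun θ => (1 - q ^ 2 * Real.sin θ ^ 2) ^ (1 - 1 / p) :=
      Continuous.rpow_const (by fun_prop) fun θ => Or.inl (one_sub_sq_mul_sin_sq_pos hq θ).ne'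
    have h := hasDerivAt_pair
      (((((hasDerivAt_prim hc _).comp s hA).const_mul 2).add
        ((hasDerivAt_id s).const_mul (q ^ 2 - 2))).const_mul (1 / q ^ 2))
      ((((((((Real.hasDerivAt_sin _).comp s hA).pow 2).const_mul (q ^ 2)).const_sub 1).rpow_const
        (p := 1 - 1 / p) (Or.inl hpos.ne')).const_mul (-(p / (p - 1)))).const_mul (1 / q ^ 2))
    refine h.congr_deriv ?_
    have hq0 := hq.1.ne'
    have hp1 : p - 1 ≠ 0 := by linarith
    have e1 : (1 - q ^ 2 * Real.sin (am2 p q s) ^ 2) ^ (1 - 1 / p) *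
        (1 - q ^ 2 * Real.sin (am2 p q s) ^ 2) ^ (1 / p) =
          1 - q ^ 2 * Real.sin (am2 p q s) ^ 2 := by
      rw [← Real.rpow_add hpos]; simp
    have e2 : (1 - q ^ 2 * Real.sin (am2 p q s) ^ 2) ^ (1 - 1 / p - 1) *
        (1 - q ^ 2 * Real.sin (am2 p q s) ^ 2) ^ (1 / p) = 1 := by
      rw [← Real.rpow_add hpos]; simp
    refine pair_congr ?_ ?_
    · rw [e1]
      field_simp
      ring
    · simp only [Function.comp_def, Pi.pow_apply]
      generalize (1 - q ^ 2 * Real.sin (am2 p q s) ^ 2) ^ (1 - 1 / p - 1) = A at *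
      generalize (1 - q ^ 2 * Real.sin (am2 p q s) ^ 2) ^ (1 / p) = B at *
      push_cast
      field_simp
      linear_combination (Real.sin (am2 p q s) * Real.cos (am2 p q s)) * e2
  · apply norm_pair_eq_one
    rw [mul_pow, mul_pow, Real.cos_sq']
    ring

/-! ### Linear and circular curves. -/

theorem exists_hasDerivAt_linearProfile (s : ℝ) :
    ∃ v : Plane, HasDerivAt linearProfile v s ∧ ‖v‖ = 1 :=
  ⟨_, hasDerivAt_pair (hasDerivAt_id s) (hasDerivAt_const s 0), norm_pair_eq_one (by norm_num)⟩

theorem exists_hasDerivAt_circularProfile (s : ℝ) :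
    ∃ v : Plane, HasDerivAt circularProfile v s ∧ ‖v‖ = 1 :=
  ⟨_, hasDerivAt_pair (Real.hasDerivAt_cos s) (Real.hasDerivAt_sin s),
    norm_pair_eq_one (by rw [neg_sq, Real.sin_sq_add_cos_sq])⟩

theorem analyticAt_linearProfile (s : ℝ) : AnalyticAt ℝ linearProfile s :=
  analyticAt_pair analyticAt_id analyticAt_const

theorem analyticAt_circularProfile (s : ℝ) : AnalyticAt ℝ circularProfile s :=
  analyticAt_pair Real.analyticAt_cos Real.analyticAt_sin

end Orbit

/-! ### The loop -/

section Loop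

variable {p σ : ℝ}

theorem am1_one_eq (p : ℝ) : am1 p 1 = Function.invFun (prim (densityOne p)) := by
  rw [am1, ellF1_one_eq_prim]

theorem am1_ellK (hp : 2 < p) : am1 p 1 (ellK p) = Real.pi / 2 := by
  rw [am1_one_eq, ellK, ellF1_one_eq_prim]
  exact (ampDensity_densityOne hp).amp_prim _

theorem am1_neg_ellK (hp : 2 < p) : am1 p 1 (-ellK p) = -(Real.pi / 2) := by
  rw [am1_one_eq, ellK, ellF1_one_eq_prim, ← prim_neg (fun x => by simp [densityOne])]
  exact (ampDensity_densityOne hp).amp_prim _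

theorem am1_one_zero (hp : 2 < p) : am1 p 1 0 = 0 := by
  have : prim (densityOne p) 0 = 0 := by simp [prim]
  rw [am1_one_eq, ← this, (ampDensity_densityOne hp).amp_prim, this]

theorem strictMono_am1_one (hp : 2 < p) : StrictMono (am1 p 1) := by
  rw [am1_one_eq]; exact (ampDensity_densityOne hp).strictMono_amp

theorem ellK_pos (hp : 2 < p) : 0 < ellK p := by
  rw [← (strictMono_am1_one hp).lt_iff_lt, am1_ellK hp, am1_one_zero hp]
  positivity

/-- The angle `am1 p 1`, extended by constants outside of `[-ellK p, ellK p]`. -/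
def loopAngle (p s : ℝ) : ℝ := am1 p 1 (max (-ellK p) (min (ellK p) s))

theorem loopAngle_of_mem {s : ℝ} (hs : s ∈ Ioo (-ellK p) (ellK p)) :
    loopAngle p s = am1 p 1 s := by
  rw [loopAngle, min_eq_right hs.2.le, max_eq_right hs.1.le]

theorem loopAngle_of_ge (hp : 2 < p) {s : ℝ} (hs : ellK p ≤ s) :
    loopAngle p s = Real.pi / 2 := by
  have := ellK_pos hp
  rw [loopAngle, min_eq_left hs, max_eq_right (by linarith), am1_ellK hp]

theorem loopAngle_of_le (hp : 2 < p) {s : ℝ} (hs : s ≤ -ellK p) :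
    loopAngle p s = -(Real.pi / 2) := by
  have := ellK_pos hp
  rw [loopAngle, min_eq_right (by linarith), max_eq_left hs, am1_neg_ellK hp]

theorem continuous_loopAngle (hp : 2 < p) : Continuous (loopAngle p) := by
  have : Continuous (am1 p 1) := by
    rw [am1_one_eq]; exact (ampDensity_densityOne hp).continuous_amp
  unfold loopAngle
  fun_prop

theorem loopAngle_mem_Icc (hp : 2 < p) (s : ℝ) :
    loopAngle p s ∈ Icc (-(Real.pi / 2)) (Real.pi / 2) := by
  have h0 := ellK_pos hp
  have hm := (strictMono_am1_one hp).monotone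
  rw [← am1_neg_ellK hp, ← am1_ellK hp]
  exact ⟨hm (le_max_left _ _), hm (max_le (by linarith) (min_le_left _ _))⟩

theorem cos_loopAngle_nonneg (hp : 2 < p) (s : ℝ) : 0 ≤ Real.cos (loopAngle p s) :=
  Real.cos_nonneg_of_mem_Icc (loopAngle_mem_Icc hp s)

theorem cos_loopAngle_pos (hp : 2 < p) {s : ℝ} (hs : s ∈ Ioo (-ellK p) (ellK p)) :
    0 < Real.cos (loopAngle p s) := by
  have hm := strictMono_am1_one hp
  rw [loopAngle_of_mem hs]
  apply Real.cos_pos_of_mem_Ioo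
  rw [← am1_neg_ellK hp, ← am1_ellK hp]
  exact ⟨hm hs.1, hm hs.2⟩

theorem loopAngle_of_notMem (hp : 2 < p) {s : ℝ} (hs : s ∉ Ioo (-ellK p) (ellK p)) :
    loopAngle p s = Real.pi / 2 ∨ loopAngle p s = -(Real.pi / 2) := by
  rcases le_or_gt (ellK p) s with h | h
  · exact Or.inl (loopAngle_of_ge hp h)
  · exact Or.inr (loopAngle_of_le hp (not_lt.1 fun h' => hs ⟨h', h⟩))

theorem cos_loopAngle_of_notMem (hp : 2 < p) {s : ℝ} (hs : s ∉ Ioo (-ellK p) (ellK p)) :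
    Real.cos (loopAngle p s) = 0 := by
  rcases loopAngle_of_notMem hp hs with h | h <;> simp [h]

/-- One formula covers the loop and the constant extensions, since outside the loop the cosine is
zero and so is its positive power `2 / p`. -/
theorem hasDerivAt_loopAngle (hp : 2 < p) {s : ℝ} (hs : s ∉ ({-ellK p, ellK p} : Set ℝ)) :
    HasDerivAt (loopAngle p) (Real.cos (loopAngle p s) ^ (2 / p)) s := by
  have h2 := two_div_mem_Ioo hp
  simp only [mem_insert_iff, mem_singleton_iff, not_or] at hs
  by_cases hm : s ∈ Ioo (-ellK p) (ellK p)
  · have hc := cos_loopAngle_pos hp hm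
    have hev : loopAngle p =ᶠ[𝓝 s] am1 p 1 := by
      filter_upwards [isOpen_Ioo.mem_nhds hm] with t ht using loopAngle_of_mem ht
    refine HasDerivAt.congr_of_eventuallyEq ?_ hev
    rw [loopAngle_of_mem hm] at *
    rw [am1_one_eq] at *
    refine ((ampDensity_densityOne hp).hasDerivAt_amp (continuousAt_densityOne hc.ne')
      ?_).congr_deriv ?_
    · exact (div_pos one_pos (Real.rpow_pos_of_pos (abs_pos.2 hc.ne') _)).ne'
    · rw [densityOne, one_div, inv_inv, abs_of_pos hc]
  · rw [cos_loopAngle_of_notMem hp hm, Real.zero_rpow h2.1.ne']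
    rcases lt_or_gt_of_ne hs.2 with h | h
    · have h' : s < -ellK p := lt_of_le_of_ne (not_lt.1 fun h' => hm ⟨h', h⟩) hs.1
      refine (hasDerivAt_const s (-(Real.pi / 2))).congr_of_eventuallyEq ?_
      filter_upwards [gt_mem_nhds h'] with t ht using loopAngle_of_le hp ht.le
    · refine (hasDerivAt_const s (Real.pi / 2)).congr_of_eventuallyEq ?_
      filter_upwards [lt_mem_nhds h] with t ht using loopAngle_of_ge hp ht.le

theorem sech_eq (hp : 2 < p) (s : ℝ) : sech p s = Real.cos (loopAngle p s) ^ (2 / p) := by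
  have h2 := two_div_mem_Ioo hp
  rw [sech]
  split_ifs with h
  · have hc := cos_loopAngle_pos hp h
    rw [loopAngle_of_mem h] at *
    rw [cn, abs_of_pos hc, ← Real.rpow_add_one hc.ne']
    ring_nf
  · rw [cos_loopAngle_of_notMem hp h, Real.zero_rpow h2.1.ne']

theorem sech_rpow (hp : 2 < p) (s : ℝ) : sech p s ^ p = Real.cos (loopAngle p s) ^ 2 := by
  rw [sech_eq hp, ← Real.rpow_mul (cos_loopAngle_nonneg hp s), ← Real.rpow_two]
  congr 1
  field_simp

theorem sech_rpow_sub_one (hp : 2 < p) (s : ℝ) :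
    sech p s ^ (p - 1) = Real.cos (loopAngle p s) ^ (2 - 2 / p) := by
  rw [sech_eq hp, ← Real.rpow_mul (cos_loopAngle_nonneg hp s)]
  congr 1
  field_simp

theorem continuous_cos_loopAngle (hp : 2 < p) :
    Continuous fun s => Real.cos (loopAngle p s) :=
  Real.continuous_cos.comp (continuous_loopAngle hp)

theorem hasDerivAt_tanh (hp : 2 < p) (s : ℝ) :
    HasDerivAt (tanh p) (Real.cos (loopAngle p s) ^ 2) s := by
  have h : tanh p = prim fun s => Real.cos (loopAngle p s) ^ 2 := by
    funext s
    simp only [tanh, prim, sech_rpow hp]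
  rw [h]
  exact hasDerivAt_prim ((continuous_cos_loopAngle hp).pow 2) s

/-- The exponent of the curvature near the ends of a loop. -/
def loopExp (p : ℝ) : ℝ := 2 / (p - 2)

/-- The profile whose power `loopExp p` is the curvature of the loop, extended linearly. -/
def loopHeight (p s : ℝ) : ℝ := 1 - (1 - 2 / p) * prim (fun t => Real.sin (loopAngle p t)) s

/-- The factors multiplying the powers of `loopHeight` in the derivatives of the loop. -/
def loopFactor (p σ : ℝ) : ℕ → ℝ → Plane
  | 0 => fun θ => !₂[-(4 * Real.sin θ * Real.cos θ), 2 * σ * (Real.cos θ ^ 2 - Real.sin θ ^ 2)]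
  | j + 1 => fun θ => ((loopExp p - j) * -((1 - 2 / p) * Real.sin θ)) • loopFactor p σ j θ +
      Real.cos θ • deriv (loopFactor p σ j) θ

open Classical in
/-- The difference between the loop and its leftward tangent at the ends, and its derivatives. -/
def loopChain (p σ : ℝ) : ℕ → ℝ → Plane
  | 0 => fun s => !₂[2 * tanh p s, -σ * (p / (p - 1)) * sech p s ^ (p - 1)]
  | 1 => fun s => !₂[2 * Real.cos (loopAngle p s) ^ 2,
      2 * σ * Real.sin (loopAngle p s) * Real.cos (loopAngle p s)]
  | j + 2 => fun s => if s ∈ Ioo (-ellK p) (ellK p) then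
      |loopHeight p s| ^ (loopExp p - j) • loopFactor p σ j (loopAngle p s) else 0

theorem contDiff_pair {f g : ℝ → ℝ} {n : WithTop ℕ∞} (hf : ContDiff ℝ n f) (hg : ContDiff ℝ n g) :
    ContDiff ℝ n (fun t => (!₂[f t, g t] : Plane)) := by
  have h : ContDiff ℝ n (fun t => ![f t, g t]) := by
    refine contDiff_pi.2 fun i => ?_
    fin_cases i
    · exact hf
    · exact hg
  exact (EuclideanSpace.equiv (Fin 2) ℝ).symm.toContinuousLinearMap.contDiff.comp h

theorem contDiff_loopFactor (p σ : ℝ) (j : ℕ) : ContDiff ℝ ∞ (loopFactor p σ j) := by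
  have hs := Real.contDiff_sin (n := ∞)
  have hc := Real.contDiff_cos (n := ∞)
  induction j with
  | zero => exact contDiff_pair (by fun_prop) (by fun_prop)
  | succ j ih =>
    exact ((contDiff_const.mul (contDiff_const.mul hs).neg).smul ih).add
      (hc.smul (contDiff_infty_iff_deriv.1 ih).2)

theorem hasDerivAt_loopFactor (p σ : ℝ) (j : ℕ) (θ : ℝ) :
    HasDerivAt (loopFactor p σ j) (deriv (loopFactor p σ j) θ) θ :=
  ((contDiff_loopFactor p σ j).differentiable (by simp)).differentiableAt.hasDerivAt

theorem hasDerivAt_loopHeight (hp : 2 < p) (s : ℝ) :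
    HasDerivAt (loopHeight p) (-((1 - 2 / p) * Real.sin (loopAngle p s))) s :=
  ((hasDerivAt_prim (Real.continuous_sin.comp (continuous_loopAngle hp)) s).const_mul _).const_sub 1

theorem continuous_loopHeight (hp : 2 < p) : Continuous (loopHeight p) :=
  continuous_iff_continuousAt.2 fun x => (hasDerivAt_loopHeight hp x).continuousAt

/-- Both sides have the same derivative on the open interval and the value one at the origin;
continuity adds the ends. Defining the height as a primitive makes it differentiable across the ends
of the loop, with nonzero slope there. -/
theorem loopHeight_eq_Icc (hp : 2 < p) {s : ℝ} (hs : s ∈ Icc (-ellK p) (ellK p)) :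
    loopHeight p s = Real.cos (loopAngle p s) ^ (1 - 2 / p) := by
  have h2 := two_div_mem_Ioo hp
  have hK := ellK_pos hp
  have hd : ∀ t ∈ Ioo (-ellK p) (ellK p), HasDerivAt
      (fun s => Real.cos (loopAngle p s) ^ (1 - 2 / p))
      (-((1 - 2 / p) * Real.sin (loopAngle p t))) t := by
    intro t ht
    have hc := cos_loopAngle_pos hp ht
    have hA := hasDerivAt_loopAngle hp (s := t) (by
      rintro (rfl | rfl)
      · exact lt_irrefl _ ht.1
      · exact lt_irrefl _ ht.2)
    refine (((Real.hasDerivAt_cos _).comp t hA).rpow_const (p := 1 - 2 / p)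
      (Or.inl hc.ne')).congr_deriv ?_
    have e : Real.cos (loopAngle p t) ^ (2 / p) * Real.cos (loopAngle p t) ^ (1 - 2 / p - 1) =
        1 := by
      rw [← Real.rpow_add hc]; simp
    simp only [Function.comp_apply]
    linear_combination (-(1 - 2 / p) * Real.sin (loopAngle p t)) * e
  have h0 : (0 : ℝ) ∈ Ioo (-ellK p) (ellK p) := ⟨by linarith, hK⟩
  have heq : EqOn (loopHeight p) (fun s => Real.cos (loopAngle p s) ^ (1 - 2 / p))
      (Ioo (-ellK p) (ellK p)) :=
    isOpen_Ioo.eqOn_of_deriv_eq isPreconnected_Ioo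
      (fun t _ => (hasDerivAt_loopHeight hp t).differentiableAt.differentiableWithinAt)
      (fun t ht => (hd t ht).differentiableAt.differentiableWithinAt)
      (fun t ht => by rw [(hd t ht).deriv, (hasDerivAt_loopHeight hp t).deriv]) h0
      (by simp [loopHeight, prim, loopAngle_of_mem h0, am1_one_zero hp])
  have := heq.closure (continuous_loopHeight hp)
    ((continuous_cos_loopAngle hp).rpow_const fun _ => Or.inr (by linarith [h2.2]))
  rw [closure_Ioo (by linarith)] at this
  exact this hs

theorem loopHeight_pos (hp : 2 < p) {s : ℝ} (hs : s ∈ Ioo (-ellK p) (ellK p)) :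
    0 < loopHeight p s := by
  rw [loopHeight_eq_Icc hp (Ioo_subset_Icc_self hs)]
  exact Real.rpow_pos_of_pos (cos_loopAngle_pos hp hs) _

theorem abs_loopHeight_rpow (hp : 2 < p) {s : ℝ} (hs : s ∈ Ioo (-ellK p) (ellK p)) (a : ℝ) :
    |loopHeight p s| ^ a = Real.cos (loopAngle p s) ^ ((1 - 2 / p) * a) := by
  rw [abs_of_pos (loopHeight_pos hp hs), loopHeight_eq_Icc hp (Ioo_subset_Icc_self hs),
    ← Real.rpow_mul (cos_loopAngle_nonneg hp s)]

/-- As long as the exponent is positive, the power vanishes at the ends of the loop and beyond, so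
the case distinction is redundant and continuity is plain. -/
theorem loopChain_add_two_eq (hp : 2 < p) {j : ℕ} (hj : (j : ℝ) < loopExp p) :
    loopChain p σ (j + 2) = fun s => Real.cos (loopAngle p s) ^ ((1 - 2 / p) * (loopExp p - j)) •
      loopFactor p σ j (loopAngle p s) := by
  have h2 := two_div_mem_Ioo hp
  have hpos : 0 < (1 - 2 / p) * (loopExp p - j) := mul_pos (by linarith [h2.2]) (by linarith)
  funext s
  simp only [loopChain]
  split_ifs with h
  · rw [abs_loopHeight_rpow hp h]
  · rw [cos_loopAngle_of_notMem hp h, Real.zero_rpow hpos.ne', zero_smul]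

theorem mul_loopExp (hp : 2 < p) : (1 - 2 / p) * loopExp p = 2 / p := by
  have : p - 2 ≠ 0 := by linarith
  rw [loopExp]
  field_simp

theorem loopExp_pos (hp : 2 < p) : 0 < loopExp p := div_pos two_pos (by linarith)

theorem loopChain_two (hp : 2 < p) (s : ℝ) : loopChain p σ 2 s =
    Real.cos (loopAngle p s) ^ (2 / p) • loopFactor p σ 0 (loopAngle p s) := by
  rw [loopChain_add_two_eq hp (by simpa using loopExp_pos hp)]
  simp [mul_loopExp hp]

theorem hasDerivAt_loopChain_zero (hp : 2 < p) {s : ℝ} (hs : s ∉ ({-ellK p, ellK p} : Set ℝ)) :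
    HasDerivAt (loopChain p σ 0) (loopChain p σ 1 s) s := by
  have h2 := two_div_mem_Ioo hp
  simp only [loopChain, sech_rpow_sub_one hp]
  have hA := hasDerivAt_loopAngle hp hs
  have h := hasDerivAt_pair ((hasDerivAt_tanh hp s).const_mul 2)
    ((((Real.hasDerivAt_cos _).comp s hA).rpow_const (p := 2 - 2 / p)
      (Or.inr (by linarith [h2.2]))).const_mul (-σ * (p / (p - 1))))
  refine h.congr_deriv (pair_congr rfl ?_)
  have e : Real.cos (loopAngle p s) ^ (2 / p) * Real.cos (loopAngle p s) ^ (2 - 2 / p - 1) =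
      Real.cos (loopAngle p s) := by
    rw [← Real.rpow_add_of_nonneg (cos_loopAngle_nonneg hp s) h2.1.le (by linarith [h2.2])]
    ring_nf
    exact Real.rpow_one _
  have h1 : p - 1 ≠ 0 := by linarith
  have e2 : p / (p - 1) * (2 - 2 / p) = 2 := by field_simp
  simp only [Function.comp_apply]
  linear_combination (2 * σ * Real.sin (loopAngle p s)) * e + (σ * Real.sin (loopAngle p s) *
    (Real.cos (loopAngle p s) ^ (2 / p) * Real.cos (loopAngle p s) ^ (2 - 2 / p - 1))) * e2

theorem hasDerivAt_loopChain_one (hp : 2 < p) {s : ℝ} (hs : s ∉ ({-ellK p, ellK p} : Set ℝ)) :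
    HasDerivAt (loopChain p σ 1) (loopChain p σ 2 s) s := by
  rw [loopChain_two hp]
  have hA := hasDerivAt_loopAngle hp hs
  have hc := (Real.hasDerivAt_cos _).comp s hA
  have hsn := (Real.hasDerivAt_sin _).comp s hA
  have h := hasDerivAt_pair ((hc.pow 2).const_mul 2) ((hsn.const_mul (2 * σ)).mul hc)
  refine h.congr_deriv ?_
  rw [loopFactor, smul_pair]
  refine pair_congr ?_ ?_ <;> simp only [Function.comp_apply] <;> push_cast <;> ring

/-- Inside the loop, differentiating `Y ^ (a - j) • G (φ)`, with `a = loopExp p` and `φ' = (cos φ) ^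
(2 / p)`, uses `Y * (cos φ) ^ (2 / p) = cos φ`. Hence `Y ^ (a - j - 1)` factors out of both terms of
the product rule, and what remains is the recursion defining `loopFactor`. -/
theorem hasDerivAt_loopChain_add_two (hp : 2 < p) {s : ℝ}
    (hs : s ∉ ({-ellK p, ellK p} : Set ℝ)) (j : ℕ) :
    HasDerivAt (loopChain p σ (j + 2)) (loopChain p σ (j + 3) s) s := by
  have h2 := two_div_mem_Ioo hp
  by_cases hm : s ∈ Ioo (-ellK p) (ellK p)
  · have hev : loopChain p σ (j + 2) =ᶠ[𝓝 s] fun s =>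
        loopHeight p s ^ (loopExp p - j) • loopFactor p σ j (loopAngle p s) := by
      filter_upwards [isOpen_Ioo.mem_nhds hm] with t ht
      simp only [loopChain, ht, if_true, abs_of_pos (loopHeight_pos hp ht)]
    refine HasDerivAt.congr_of_eventuallyEq ?_ hev
    have hY := loopHeight_pos hp hm
    have h := ((hasDerivAt_loopHeight hp s).rpow_const (p := loopExp p - j)
      (Or.inl hY.ne')).smul
        ((hasDerivAt_loopFactor p σ j _).scomp s (hasDerivAt_loopAngle hp hs))
    refine h.congr_deriv ?_
    have e1 : loopHeight p s ^ (loopExp p - j) =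
        loopHeight p s ^ (loopExp p - j - 1) * loopHeight p s := by
      rw [← Real.rpow_add_one hY.ne']; ring_nf
    have e2 : loopHeight p s * Real.cos (loopAngle p s) ^ (2 / p) = Real.cos (loopAngle p s) := by
      rw [loopHeight_eq_Icc hp (Ioo_subset_Icc_self hm), ← Real.rpow_add (cos_loopAngle_pos hp hm)]
      simp
    have e3 : loopChain p σ (j + 3) s = loopHeight p s ^ (loopExp p - j - 1) •
        loopFactor p σ (j + 1) (loopAngle p s) := by
      change (if s ∈ Ioo (-ellK p) (ellK p) then _ else _) = _
      rw [if_pos hm, abs_of_pos hY]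
      congr 2
      push_cast
      ring
    rw [e3, loopFactor, smul_smul, e1, mul_assoc, e2, smul_add, smul_smul, smul_smul, add_comm]
    congr 2
    ring
  · have h3 : loopChain p σ (j + 3) s = 0 := by
      change (if s ∈ Ioo (-ellK p) (ellK p) then _ else _) = _
      rw [if_neg hm]
    rw [h3]
    refine (hasDerivAt_const s (0 : Plane)).congr_of_eventuallyEq ?_
    have hm' : s ∈ (Icc (-ellK p) (ellK p))ᶜ := by
      simp only [mem_insert_iff, mem_singleton_iff, not_or] at hs
      exact fun h => hm ⟨lt_of_le_of_ne h.1 (Ne.symm hs.1), lt_of_le_of_ne h.2 hs.2⟩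
    filter_upwards [isClosed_Icc.isOpen_compl.mem_nhds hm'] with t ht
    have : t ∉ Ioo (-ellK p) (ellK p) := fun h => ht (Ioo_subset_Icc_self h)
    simp only [loopChain, this, if_false]

theorem derivChain_loopChain (hp : 2 < p) {m : ℕ} (hm : ∀ j < m, (j : ℝ) < loopExp p) :
    DerivChain {-ellK p, ellK p} (m + 2) (loopChain p σ) where
  countable := (finite_singleton _).insert _ |>.countable
  continuous j hj := by
    have h2 := two_div_mem_Ioo hp
    have cA := continuous_loopAngle hp
    have cc := continuous_cos_loopAngle hp
    match j with
    | 0 =>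
      simp only [loopChain, sech_rpow_sub_one hp]
      have ct : Continuous (tanh p) :=
        continuous_iff_continuousAt.2 fun x => (hasDerivAt_tanh hp x).continuousAt
      exact continuous_pair (ct.const_smul (2 : ℝ)) ((cc.rpow_const
        fun _ => Or.inr (by linarith [h2.2])).const_smul (-σ * (p / (p - 1))))
    | 1 =>
      exact continuous_pair (by fun_prop) (by fun_prop)
    | j + 2 =>
      have hj' := hm j (by omega)
      rw [loopChain_add_two_eq hp hj']
      exact (cc.rpow_const fun _ => Or.inr (mul_nonneg (by linarith [h2.2])
        (by linarith))).smul ((contDiff_loopFactor p σ j).continuous.comp cA)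
  hasDerivAt j _ x hx := by
    match j with
    | 0 => exact hasDerivAt_loopChain_zero hp hx
    | 1 => exact hasDerivAt_loopChain_one hp hx
    | j + 2 => exact hasDerivAt_loopChain_add_two hp hx j

theorem loopChain_one_of_notMem (hp : 2 < p) {s : ℝ} (hs : s ∉ Ioo (-ellK p) (ellK p)) :
    loopChain p σ 1 s = 0 := by
  simp [loopChain, cos_loopAngle_of_notMem hp hs, zero_pair]

theorem loopChain_add_two_of_notMem {s : ℝ} (hs : s ∉ Ioo (-ellK p) (ellK p)) (j : ℕ) :
    loopChain p σ (j + 2) s = 0 := by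
  simp only [loopChain, hs, if_false]

/-- With the leftward tangent restored, the velocity is `(cos 2φ, σ * sin 2φ)`. -/
theorem norm_loopChain_one (hσ : σ = 1 ∨ σ = -1) (s : ℝ) :
    ‖(!₂[-1, 0] : Plane) + loopChain p σ 1 s‖ = 1 := by
  have h1 : σ ^ 2 = 1 := by rcases hσ with h | h <;> rw [h] <;> norm_num
  have h := Real.sin_sq_add_cos_sq (loopAngle p s)
  rw [loopChain, add_pair]
  apply norm_pair_eq_one
  linear_combination (4 * Real.sin (loopAngle p s) ^ 2 * Real.cos (loopAngle p s) ^ 2) * h1 +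
    (4 * Real.cos (loopAngle p s) ^ 2) * h

/-- The vector is `2 • (-sin 2θ, σ * cos 2θ)`, of norm two. -/
theorem loopFactor_zero_ne_zero (hσ : σ = 1 ∨ σ = -1) (θ : ℝ) : loopFactor p σ 0 θ ≠ 0 := by
  have h1 : σ ^ 2 = 1 := by rcases hσ with h | h <;> rw [h] <;> norm_num
  have h := Real.sin_sq_add_cos_sq θ
  have h2 := norm_pair_sq (-(4 * Real.sin θ * Real.cos θ))
    (2 * σ * (Real.cos θ ^ 2 - Real.sin θ ^ 2))
  intro h0
  rw [show (!₂[_, _] : Plane) = 0 from h0] at h2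
  have h3 : (-(4 * Real.sin θ * Real.cos θ)) ^ 2 + (2 * σ * (Real.cos θ ^ 2 - Real.sin θ ^ 2)) ^ 2
      = 4 := by
    linear_combination (4 * (Real.cos θ ^ 2 - Real.sin θ ^ 2) ^ 2) * h1 +
      4 * (Real.sin θ ^ 2 + Real.cos θ ^ 2 + 1) * h
  rw [h3] at h2
  norm_num at h2

theorem loopChain_two_ne_zero (hp : 2 < p) (hσ : σ = 1 ∨ σ = -1) {s : ℝ}
    (hs : s ∈ Ioo (-ellK p) (ellK p)) : loopChain p σ 2 s ≠ 0 := by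
  rw [loopChain_two hp]
  exact smul_ne_zero (Real.rpow_pos_of_pos (cos_loopAngle_pos hp hs) _).ne'
    (loopFactor_zero_ne_zero hσ _)

/-- Where `cos θ = 0` the recursion loses its derivative term and merely multiplies by `-(loopExp p
- j) * (1 - 2 / p) * sin θ`. This is nonzero while `j < loopExp p`. -/
theorem loopFactor_ne_zero (hp : 2 < p) (hσ : σ = 1 ∨ σ = -1) {θ : ℝ} (hθ : Real.cos θ = 0)
    {m : ℕ} (hm : ∀ j < m, (j : ℝ) < loopExp p) : loopFactor p σ m θ ≠ 0 := by
  have h2 := two_div_mem_Ioo hp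
  induction m with
  | zero => exact loopFactor_zero_ne_zero hσ θ
  | succ j ih =>
    have h1 := hm j (by omega)
    simp only [loopFactor, hθ, zero_smul, add_zero]
    refine smul_ne_zero (mul_ne_zero (by linarith) (neg_ne_zero.2 (mul_ne_zero
      (by linarith [h2.2]) (sin_ne_zero_of_cos_eq_zero hθ)))) (ih fun i hi => hm i (by omega))

/-- The angle extended by constants is differentiable at `±ellK p` too, as its derivative tends to
zero there. This yields the globally `C¹` functions that the jump criterion asks for. -/
theorem hasDerivAt_loopFactor_loopAngle (hp : 2 < p) (j : ℕ) (s : ℝ) :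
    HasDerivAt (fun s => loopFactor p σ j (loopAngle p s))
      (Real.cos (loopAngle p s) ^ (2 / p) • deriv (loopFactor p σ j) (loopAngle p s)) s := by
  have cA := continuous_loopAngle hp
  exact hasDerivAt_of_off_countable (S := {-ellK p, ellK p})
    (((finite_singleton _).insert _).countable)
    ((contDiff_loopFactor p σ j).continuous.comp cA)
    (g := fun s => Real.cos (loopAngle p s) ^ (2 / p) • deriv (loopFactor p σ j) (loopAngle p s))
    (((continuous_cos_loopAngle hp).rpow_const fun _ => Or.inr (two_div_mem_Ioo hp).1.le).smul
      ((contDiff_infty_iff_deriv.1 (contDiff_loopFactor p σ j)).2.continuous.comp cA))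
    (fun x hx => (hasDerivAt_loopFactor p σ j _).scomp x (hasDerivAt_loopAngle hp hx)) s

theorem continuous_deriv_loopFactor_loopAngle (hp : 2 < p) (j : ℕ) : Continuous fun s =>
    Real.cos (loopAngle p s) ^ (2 / p) • deriv (loopFactor p σ j) (loopAngle p s) :=
  ((continuous_cos_loopAngle hp).rpow_const fun _ => Or.inr (two_div_mem_Ioo hp).1.le).smul
    ((contDiff_infty_iff_deriv.1 (contDiff_loopFactor p σ j)).2.continuous.comp
      (continuous_loopAngle hp))

theorem loopChain_of_mem_of_eq {m : ℕ} (hm : loopExp p = m) {s : ℝ}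
    (hs : s ∈ Ioo (-ellK p) (ellK p)) :
    loopChain p σ (m + 2) s = loopFactor p σ m (loopAngle p s) := by
  simp only [loopChain, hs, if_true, hm, sub_self, Real.rpow_zero, one_smul]

theorem exists_loopFactor_bound (hp : 2 < p) (j : ℕ) :
    ∃ C, ∀ s, ‖loopFactor p σ j (loopAngle p s)‖ ≤ C := by
  obtain ⟨C, hC⟩ := (isCompact_Icc (a := -(Real.pi / 2)) (b :=
    Real.pi / 2)).exists_bound_of_continuousOn (contDiff_loopFactor p σ j).continuous.continuousOn
  exact ⟨C, fun s => hC _ (loopAngle_mem_Icc hp s)⟩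

theorem exists_loopChain_bound (hp : 2 < p) {m : ℕ} (hm : loopExp p = m) :
    ∃ C, ∀ s, ‖loopChain p σ (m + 2) s‖ ≤ C := by
  obtain ⟨C, hC⟩ := exists_loopFactor_bound (σ := σ) hp m
  refine ⟨C, fun s => ?_⟩
  by_cases hs : s ∈ Ioo (-ellK p) (ellK p)
  · rw [loopChain_of_mem_of_eq hm hs]; exact hC s
  · rw [loopChain_add_two_of_notMem hs, norm_zero]; exact (norm_nonneg _).trans (hC s)

theorem measurable_loopChain (hp : 2 < p) (j : ℕ) : StronglyMeasurable (loopChain p σ (j + 2)) := by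
  have h1 : Measurable fun s => |loopHeight p s| ^ (loopExp p - j) :=
    ((continuous_loopHeight hp).measurable.abs).pow_const _
  have h2 : Continuous fun s => loopFactor p σ j (loopAngle p s) :=
    (contDiff_loopFactor p σ j).continuous.comp (continuous_loopAngle hp)
  exact StronglyMeasurable.ite measurableSet_Ioo (h1.stronglyMeasurable.smul h2.stronglyMeasurable)
    stronglyMeasurable_const

theorem loopHeight_deriv_ne_zero (hp : 2 < p) {x : ℝ} (hx : x ∉ Ioo (-ellK p) (ellK p)) :
    -((1 - 2 / p) * Real.sin (loopAngle p x)) ≠ 0 := by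
  have h2 := two_div_mem_Ioo hp
  exact neg_ne_zero.2 (mul_ne_zero (by linarith [h2.2])
    (sin_ne_zero_of_cos_eq_zero (cos_loopAngle_of_notMem hp hx)))

theorem loopChain_isBigO (hp : 2 < p) {m : ℕ} (hm : loopExp p ≤ m) (x : ℝ) :
    loopChain p σ (m + 2) =O[𝓝[≠] x] fun t => |t - x| ^ (-(m - loopExp p)) := by
  obtain ⟨C, hC⟩ := exists_loopFactor_bound (σ := σ) hp m
  have h := rpow_smul_isBigO (fun x => hasDerivAt_loopHeight hp x)
    (fun x hx => loopHeight_deriv_ne_zero hp fun h => (loopHeight_pos hp h).ne' hx)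
    (τ := m - loopExp p) (by linarith)
    (H := fun s => loopFactor p σ m (loopAngle p s)) x
    (IsBigO.of_bound C (Eventually.of_forall fun s => by simpa using hC s))
  refine IsBigO.trans (IsBigO.of_bound 1 (Eventually.of_forall fun s => ?_)) h
  rw [one_mul, neg_sub]
  by_cases hs : s ∈ Ioo (-ellK p) (ellK p)
  · simp only [loopChain, hs, if_true, le_refl]
  · rw [loopChain_add_two_of_notMem hs, norm_zero]; exact norm_nonneg _

theorem isBigO_loopChain (hp : 2 < p) (hσ : σ = 1 ∨ σ = -1) {m : ℕ} (hm : loopExp p ≤ m)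
    (hm' : ∀ j < m, (j : ℝ) < loopExp p) {x : ℝ} (hx : x = -ellK p ∨ x = ellK p)
    {l : Filter ℝ} (hl : l ≤ 𝓝[≠] x) (hlm : ∀ᶠ t in l, t ∈ Ioo (-ellK p) (ellK p)) :
    (fun t => |t - x| ^ (-(m - loopExp p))) =O[l] loopChain p σ (m + 2) := by
  have h2 := two_div_mem_Ioo hp
  have hK := ellK_pos hp
  have hx1 : x ∉ Ioo (-ellK p) (ellK p) := by
    rintro ⟨h, h'⟩; rcases hx with rfl | rfl <;> linarith
  have hx2 : x ∈ Icc (-ellK p) (ellK p) := by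
    rcases hx with rfl | rfl <;> constructor <;> linarith
  have hY : loopHeight p x = 0 := by
    rw [loopHeight_eq_Icc hp hx2, cos_loopAngle_of_notMem hp hx1,
      Real.zero_rpow (by linarith [h2.2])]
  have h := isBigO_rpow_smul (hasDerivAt_loopHeight hp x) hY (loopHeight_deriv_ne_zero hp hx1)
    (τ := m - loopExp p) (by linarith) (H := fun s => loopFactor p σ m (loopAngle p s)) hl
    ((((contDiff_loopFactor p σ m).continuous.comp (continuous_loopAngle hp)).tendsto x).mono_left
      (hl.trans nhdsWithin_le_nhds))
    (loopFactor_ne_zero hp hσ (cos_loopAngle_of_notMem hp hx1) hm')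
  refine h.congr' EventuallyEq.rfl ?_
  filter_upwards [hlm] with t ht
  simp only [loopChain, ht, if_true, neg_sub]

end Loop

/-! ### The flat-core profile -/

section FlatCore

variable {p : ℝ} {σ ℓ : ℕ → ℝ}

theorem tanh_sub (hp : 2 < p) (s t : ℝ) :
    tanh p t - tanh p s = ∫ x in s..t, Real.cos (loopAngle p x) ^ 2 := by
  have hc := (continuous_cos_loopAngle hp).pow 2
  simp only [tanh, sech_rpow hp]
  exact intervalIntegral.integral_interval_sub_left (hc.intervalIntegrable _ _)
    (hc.intervalIntegrable _ _)

/-- Off the loop both `sech` and the integrand of `tanh` vanish. So the contribution of a loop is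
frozen before and after it, which lets a concatenation be written as a sum. -/
theorem loopChain_zero_eq_of_disjoint (hp : 2 < p) {τ s t : ℝ} (hst : s ≤ t)
    (h : ∀ x ∈ Icc s t, x ∉ Ioo (-ellK p) (ellK p)) : loopChain p τ 0 s = loopChain p τ 0 t := by
  have h1 : tanh p t - tanh p s = 0 := by
    rw [tanh_sub hp, intervalIntegral.integral_congr (g := fun _ => (0 : ℝ)) ?_]
    · simp
    · intro x hx
      rw [uIcc_of_le hst] at hx
      simp [cos_loopAngle_of_notMem hp (h x hx)]
  have h2 : ∀ x, x ∉ Ioo (-ellK p) (ellK p) → sech p x = 0 := fun x hx => by simp [sech, hx]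
  simp only [loopChain, h2 s (h s ⟨le_rfl, hst⟩), h2 t (h t ⟨hst, le_rfl⟩), sub_eq_zero.1 h1]

theorem loopChain_zero_of_le (hp : 2 < p) {τ s : ℝ} (hs : s ≤ -ellK p) :
    loopChain p τ 0 s = loopChain p τ 0 (-ellK p) :=
  loopChain_zero_eq_of_disjoint hp hs fun _ hx h => absurd h.1 (not_lt.2 hx.2)

theorem loopChain_zero_eq_of_ge (hp : 2 < p) {τ s t : ℝ} (hs : ellK p ≤ s) (hst : s ≤ t) :
    loopChain p τ 0 s = loopChain p τ 0 t :=
  loopChain_zero_eq_of_disjoint hp hst fun _ hx h => absurd h.2 (not_lt.2 (hs.trans hx.1))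

theorem loopArc_curve (p τ s : ℝ) : (loopArc p τ).curve s = !₂[-s, 0] + loopChain p τ 0 s := by
  simp only [loopArc, loopChain, add_pair]
  refine pair_congr ?_ ?_ <;> ring

theorem segment_concat_loop_right (a τ : ℝ) :
    ((segmentArc a).concat (loopArc p τ)).right = a + 2 * ellK p := by
  simp only [Arc.concat, segmentArc, loopArc]
  ring

/-- The segment is the leftward motion `(-s, 0)` alone, and the loop is the same motion plus its own
contribution, which is still constant along the segment. -/
theorem segment_concat_loop_curve (hp : 2 < p) (a τ s : ℝ) :
    ((segmentArc a).concat (loopArc p τ)).curve s =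
      !₂[-s, 0] + (loopChain p τ 0 (s - (a + ellK p)) - loopChain p τ 0 (-ellK p)) := by
  have e : ∀ s, ((segmentArc a).concat (loopArc p τ)).curve s =
      if s ≤ a - 0 then (!₂[-(s + 0), 0] : Plane) else
        (loopArc p τ).curve (s + -ellK p - (a - 0)) + !₂[-a, 0] - (loopArc p τ).curve (-ellK p) :=
    fun _ => rfl
  rw [e]
  split_ifs with h
  · rw [loopChain_zero_of_le hp (by linarith : s - (a + ellK p) ≤ -ellK p), sub_self, add_zero,
      add_zero]
  · rw [loopArc_curve, loopArc_curve, show s + -ellK p - (a - 0) = s - (a + ellK p) by ring]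
    have : (!₂[-s, 0] : Plane) = !₂[-(s - (a + ellK p)), 0] + !₂[-a, 0] - !₂[- -ellK p, 0] := by
      rw [add_pair, sub_pair]
      refine pair_congr ?_ ?_ <;> ring
    rw [this]
    abel

/-- The arclength at which the `n`-th segment starts. -/
def flatStart (p : ℝ) (ℓ : ℕ → ℝ) (n : ℕ) : ℝ := ∑ i ∈ Finset.range n, (ℓ i + 2 * ellK p)

/-- The arclength of the center of the `n`-th loop. -/
def flatCenter (p : ℝ) (ℓ : ℕ → ℝ) (n : ℕ) : ℝ := flatStart p ℓ n + (ℓ n + ellK p)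

theorem flatCenter_add (n : ℕ) : flatCenter p ℓ n + ellK p = flatStart p ℓ (n + 1) := by
  rw [flatCenter, flatStart, flatStart, Finset.sum_range_succ]
  ring

theorem monotone_flatStart (hp : 2 < p) (hℓ : ∀ j, 0 ≤ ℓ j) : Monotone (flatStart p ℓ) :=
  monotone_nat_of_le_succ fun n => by
    rw [flatStart, flatStart, Finset.sum_range_succ]
    linarith [hℓ n, ellK_pos hp]

theorem flatCenter_lt (hp : 2 < p) (hℓ : ∀ j, 0 ≤ ℓ j) {i j : ℕ} (hij : i < j) :
    flatCenter p ℓ i + ellK p ≤ flatCenter p ℓ j - ellK p := by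
  rw [flatCenter_add]
  have := monotone_flatStart hp hℓ (Nat.succ_le_of_lt hij)
  rw [flatCenter]
  linarith [hℓ j]

/-- The open parameter interval of the `i`-th loop. -/
def loopInterval (p : ℝ) (ℓ : ℕ → ℝ) (i : ℕ) : Set ℝ :=
  Ioo (flatCenter p ℓ i - ellK p) (flatCenter p ℓ i + ellK p)

theorem mem_loopInterval {i : ℕ} {t : ℝ} :
    t ∈ loopInterval p ℓ i ↔ t - flatCenter p ℓ i ∈ Ioo (-ellK p) (ellK p) := by
  rw [loopInterval, mem_Ioo, mem_Ioo]
  constructor <;> rintro ⟨h1, h2⟩ <;> constructor <;> linarith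

theorem loopInterval_disjoint (hp : 2 < p) (hℓ : ∀ j, 0 ≤ ℓ j) {i j : ℕ} {t : ℝ}
    (hi : t ∈ loopInterval p ℓ i) (hij : i ≠ j) : t ∉ loopInterval p ℓ j := by
  intro hj
  rcases lt_or_gt_of_ne hij with h | h
  · have := flatCenter_lt hp hℓ h
    linarith [hi.2, hj.1]
  · have := flatCenter_lt hp hℓ h
    linarith [hi.1, hj.2]

/-- The derivatives of the flat-core profile, extended by straight lines. -/
def flatChain (p : ℝ) (σ ℓ : ℕ → ℝ) (n : ℕ) : ℕ → ℝ → Plane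
  | 0 => fun s => !₂[-s, 0] + ∑ i ∈ Finset.range (n + 1),
      (loopChain p (σ i) 0 (s - flatCenter p ℓ i) - loopChain p (σ i) 0 (-ellK p))
  | 1 => fun s => !₂[-1, 0] + ∑ i ∈ Finset.range (n + 1),
      loopChain p (σ i) 1 (s - flatCenter p ℓ i)
  | j + 2 => fun s => ∑ i ∈ Finset.range (n + 1), loopChain p (σ i) (j + 2) (s - flatCenter p ℓ i)

theorem flatCoreProfile_left (n : ℕ) : (flatCoreProfile p σ ℓ n).left = 0 := by
  cases n <;> rfl

theorem flatCoreProfile_right (n : ℕ) :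
    (flatCoreProfile p σ ℓ n).right = flatStart p ℓ (n + 1) := by
  induction n with
  | zero =>
    rw [flatStart, Finset.sum_range_one]
    exact segment_concat_loop_right _ _
  | succ n ih =>
    have e : (flatCoreProfile p σ ℓ (n + 1)).right =
        ((flatCoreProfile p σ ℓ n).right - (flatCoreProfile p σ ℓ n).left) +
          (((segmentArc (ℓ (n + 1))).concat (loopArc p (σ (n + 1)))).right - 0) := rfl
    rw [e, ih, flatCoreProfile_left, segment_concat_loop_right, flatStart, flatStart,
      Finset.sum_range_succ _ (n + 1)]
    ring

/-- On the part already built, the new loop has not started and its summand is zero. On the new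
part, all earlier loops are over and their summands are constant, which supplies the translation
made by the concatenation. -/
theorem flatCoreProfile_curve (hp : 2 < p) (hℓ : ∀ j, 0 ≤ ℓ j) (n : ℕ) :
    (flatCoreProfile p σ ℓ n).curve = flatChain p σ ℓ n 0 := by
  induction n with
  | zero =>
    funext s
    simp only [flatChain, zero_add, Finset.sum_range_one, flatCenter, flatStart,
      Finset.range_zero, Finset.sum_empty]
    exact segment_concat_loop_curve hp _ _ _
  | succ n ih =>
    funext s
    have e : (flatCoreProfile p σ ℓ (n + 1)).curve s =
        if s ≤ (flatCoreProfile p σ ℓ n).right - (flatCoreProfile p σ ℓ n).left then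
          (flatCoreProfile p σ ℓ n).curve (s + (flatCoreProfile p σ ℓ n).left) else
        ((segmentArc (ℓ (n + 1))).concat (loopArc p (σ (n + 1)))).curve
          (s + 0 - ((flatCoreProfile p σ ℓ n).right - (flatCoreProfile p σ ℓ n).left)) +
          (flatCoreProfile p σ ℓ n).curve (flatCoreProfile p σ ℓ n).right -
        ((segmentArc (ℓ (n + 1))).concat (loopArc p (σ (n + 1)))).curve 0 := rfl
    have hK := ellK_pos hp
    have hl := hℓ (n + 1)
    have hc : flatCenter p ℓ (n + 1) = flatStart p ℓ (n + 1) + (ℓ (n + 1) + ellK p) := rfl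
    rw [e, flatCoreProfile_left, flatCoreProfile_right, sub_zero, add_zero, ih]
    simp only [flatChain]
    rw [Finset.sum_range_succ _ (n + 1)]
    split_ifs with h
    · rw [loopChain_zero_of_le hp (by linarith : s - flatCenter p ℓ (n + 1) ≤ -ellK p), sub_self,
        add_zero]
    · rw [segment_concat_loop_curve hp, segment_concat_loop_curve hp,
        loopChain_zero_of_le hp (by linarith : 0 - (ℓ (n + 1) + ellK p) ≤ -ellK p),
        show s - flatStart p ℓ (n + 1) - (ℓ (n + 1) + ellK p) = s - flatCenter p ℓ (n + 1) by
          rw [hc]; ring]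
      -- Past the junction the earlier summands keep the values they have at the junction.
      have hsum : ∑ i ∈ Finset.range (n + 1), (loopChain p (σ i) 0
            (flatStart p ℓ (n + 1) - flatCenter p ℓ i) - loopChain p (σ i) 0 (-ellK p)) =
          ∑ i ∈ Finset.range (n + 1),
            (loopChain p (σ i) 0 (s - flatCenter p ℓ i) - loopChain p (σ i) 0 (-ellK p)) := by
        refine Finset.sum_congr rfl fun i hi => ?_
        have h1 : flatCenter p ℓ i + ellK p ≤ flatStart p ℓ (n + 1) := by
          rw [flatCenter_add]
          exact monotone_flatStart hp hℓ (Finset.mem_range.1 hi)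
        rw [loopChain_zero_eq_of_ge hp (by linarith : ellK p ≤ flatStart p ℓ (n + 1) -
          flatCenter p ℓ i) (by linarith : _ ≤ s - flatCenter p ℓ i)]
      rw [hsum]
      have : (!₂[-s, 0] : Plane) = !₂[-(s - flatStart p ℓ (n + 1)), 0] +
          !₂[-flatStart p ℓ (n + 1), 0] - !₂[-0, 0] := by
        rw [add_pair, sub_pair]
        refine pair_congr ?_ ?_ <;> ring
      rw [this]
      abel

theorem derivChain_flatChain (hp : 2 < p) (n : ℕ) {m : ℕ} (hm : ∀ j < m, (j : ℝ) < loopExp p) :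
    DerivChain (⋃ i ∈ Finset.range (n + 1), (fun s => s - flatCenter p ℓ i) ⁻¹' {-ellK p, ellK p})
      (m + 2) (flatChain p σ ℓ n) where
  countable := by
    refine (Finset.range (n + 1)).countable_toSet.biUnion fun i _ => ?_
    exact (((finite_singleton _).insert _).countable).preimage_of_injOn
      (sub_left_injective).injOn
  continuous j hj := by
    have hL := fun i => (derivChain_loopChain (σ := σ i) hp hm).continuous j hj
    match j with
    | 0 =>
      refine (continuous_pair continuous_neg continuous_const).add
        (continuous_finsetSum _ fun i _ => ?_)
      exact ((hL i).comp (continuous_id.sub continuous_const)).sub continuous_const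
    | 1 =>
      refine continuous_const.add (continuous_finsetSum _ fun i _ => ?_)
      exact (hL i).comp (continuous_id.sub continuous_const)
    | j + 2 =>
      refine continuous_finsetSum _ fun i _ => ?_
      exact (hL i).comp (continuous_id.sub continuous_const)
  hasDerivAt j hj x hx := by
    have hL : ∀ i ∈ Finset.range (n + 1), HasDerivAt
        (fun s => loopChain p (σ i) j (s - flatCenter p ℓ i))
        (loopChain p (σ i) (j + 1) (x - flatCenter p ℓ i)) x := fun i hi => by
      have hxi : x - flatCenter p ℓ i ∉ ({-ellK p, ellK p} : Set ℝ) := fun h =>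
        hx (mem_biUnion hi h)
      exact ((derivChain_loopChain (σ := σ i) hp hm).hasDerivAt j hj _ hxi).comp_sub_const x _
    match j with
    | 0 =>
      exact (hasDerivAt_pair (hasDerivAt_neg x) (hasDerivAt_const x 0)).add
        (HasDerivAt.fun_sum fun i hi => (hL i hi).sub_const _)
    | 1 =>
      exact (HasDerivAt.fun_sum fun i hi => hL i hi).const_add _
    | j + 2 =>
      exact HasDerivAt.fun_sum fun i hi => hL i hi

theorem flatChain_of_mem (hp : 2 < p) (hℓ : ∀ j, 0 ≤ ℓ j) {n i : ℕ} (hi : i ≤ n) {t : ℝ}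
    (ht : t ∈ loopInterval p ℓ i) (j : ℕ) :
    flatChain p σ ℓ n (j + 2) t = loopChain p (σ i) (j + 2) (t - flatCenter p ℓ i) := by
  simp only [flatChain]
  refine Finset.sum_eq_single i (fun k _ hk => ?_)
    fun h => absurd (Finset.mem_range.2 (Nat.lt_succ_of_le hi)) h
  exact loopChain_add_two_of_notMem
    (fun h => loopInterval_disjoint hp hℓ ht hk.symm (mem_loopInterval.2 h)) j

theorem flatChain_of_notMem {n : ℕ} {t : ℝ} (ht : ∀ i ≤ n, t ∉ loopInterval p ℓ i) (j : ℕ) :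
    flatChain p σ ℓ n (j + 2) t = 0 := by
  simp only [flatChain]
  refine Finset.sum_eq_zero fun i hi => loopChain_add_two_of_notMem (fun h => ?_) j
  exact ht i (Nat.le_of_lt_succ (Finset.mem_range.1 hi)) (mem_loopInterval.2 h)

theorem norm_flatChain_one (hp : 2 < p) (hσ : ∀ j, σ j = 1 ∨ σ j = -1) (hℓ : ∀ j, 0 ≤ ℓ j)
    (n : ℕ) (t : ℝ) : ‖flatChain p σ ℓ n 1 t‖ = 1 := by
  simp only [flatChain]
  by_cases h : ∃ i ≤ n, t ∈ loopInterval p ℓ i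
  · obtain ⟨i, hi, ht⟩ := h
    rw [Finset.sum_eq_single i (fun k _ hk => loopChain_one_of_notMem hp
      (fun h => loopInterval_disjoint hp hℓ ht hk.symm (mem_loopInterval.2 h)))
      fun h => absurd (Finset.mem_range.2 (Nat.lt_succ_of_le hi)) h]
    exact norm_loopChain_one (hσ i) _
  · push Not at h
    rw [Finset.sum_eq_zero fun i hi => loopChain_one_of_notMem hp (fun h' =>
      h i (Nat.le_of_lt_succ (Finset.mem_range.1 hi)) (mem_loopInterval.2 h')), add_zero]
    exact norm_pair_eq_one (by norm_num)

theorem flatChain_two_eq_zero_iff (hp : 2 < p) (hσ : ∀ j, σ j = 1 ∨ σ j = -1)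
    (hℓ : ∀ j, 0 ≤ ℓ j) {n : ℕ} {t : ℝ} :
    flatChain p σ ℓ n 2 t = 0 ↔ ∀ i ≤ n, t ∉ loopInterval p ℓ i := by
  refine ⟨fun h i hi ht => ?_, fun h => flatChain_of_notMem h 0⟩
  rw [flatChain_of_mem hp hℓ hi ht 0] at h
  exact loopChain_two_ne_zero hp (hσ i) (mem_loopInterval.1 ht) h

theorem measurable_flatChain (hp : 2 < p) (n j : ℕ) :
    StronglyMeasurable (flatChain p σ ℓ n (j + 2)) := by
  have : flatChain p σ ℓ n (j + 2) = ∑ i ∈ Finset.range (n + 1), fun s =>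
      loopChain p (σ i) (j + 2) (s - flatCenter p ℓ i) := by
    funext s
    simp only [flatChain, Finset.sum_apply]
  rw [this]
  exact Finset.stronglyMeasurable_sum _ fun i _ =>
    (measurable_loopChain hp j).comp_measurable (measurable_id.sub_const _)

theorem flatChain_isBigO (hp : 2 < p) (n : ℕ) {m : ℕ} (hm : loopExp p ≤ m) (x : ℝ) :
    flatChain p σ ℓ n (m + 2) =O[𝓝[≠] x] fun t => |t - x| ^ (-(m - loopExp p)) := by
  simp only [flatChain]
  refine IsBigO.fun_sum fun i _ => ?_
  have h := loopChain_isBigO (σ := σ i) hp hm (x - flatCenter p ℓ i)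
  have ht : Tendsto (fun s => s - flatCenter p ℓ i) (𝓝[≠] x) (𝓝[≠] (x - flatCenter p ℓ i)) :=
    tendsto_nhdsWithin_iff.2 ⟨((continuous_id.sub continuous_const).tendsto x).mono_left
      nhdsWithin_le_nhds, by
        filter_upwards [self_mem_nhdsWithin] with t ht h
        exact ht (sub_left_injective h)⟩
  refine (h.comp_tendsto ht).congr_right fun t => ?_
  simp only [Function.comp_apply, sub_sub_sub_cancel_right]

theorem exists_flatChain_bound (hp : 2 < p) (n : ℕ) {m : ℕ} (hm : loopExp p = m) :
    ∃ C, ∀ s, ‖flatChain p σ ℓ n (m + 2) s‖ ≤ C := by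
  choose C hC using fun i => exists_loopChain_bound (σ := σ i) hp hm
  exact ⟨∑ i ∈ Finset.range (n + 1), C i, fun s =>
    (norm_sum_le _ _).trans (Finset.sum_le_sum fun i _ => hC i _)⟩

end FlatCore

/-! ### Similarities and reparameterizations -/

section Similarity

variable {c κ s₀ L : ℝ} {U : Plane ≃ₗᵢ[ℝ] Plane} {v : Plane} {d : ℕ → ℝ → Plane}

/-- The derivatives of `s ↦ c • U (δ (κ * s + s₀)) + v`, where `d` are the derivatives of `δ`. -/
def simChain (c : ℝ) (U : Plane ≃ₗᵢ[ℝ] Plane) (v : Plane) (κ s₀ : ℝ) (d : ℕ → ℝ → Plane) (j : ℕ)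
    (s : ℝ) : Plane :=
  (c * κ ^ j) • U (d j (κ * s + s₀)) + if j = 0 then v else 0

theorem hasDerivAt_affine (κ s₀ x : ℝ) : HasDerivAt (fun s => κ * s + s₀) κ x := by
  simpa using ((hasDerivAt_id x).const_mul κ).add_const s₀

theorem continuous_affine (κ s₀ : ℝ) : Continuous fun s : ℝ => κ * s + s₀ := by fun_prop

theorem injective_affine (hκ : κ ≠ 0) (s₀ : ℝ) : Function.Injective fun s : ℝ => κ * s + s₀ :=
  fun _ _ h => mul_left_cancel₀ hκ (add_right_cancel h)

theorem hasDerivAt_simChain {j : ℕ} {x : ℝ}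
    (h : HasDerivAt (d j) (d (j + 1) (κ * x + s₀)) (κ * x + s₀)) :
    HasDerivAt (simChain c U v κ s₀ d j) (simChain c U v κ s₀ d (j + 1) x) x := by
  have h1 := (U.toContinuousLinearEquiv.toContinuousLinearMap.hasFDerivAt.comp_hasDerivAt x
    (h.scomp x (hasDerivAt_affine κ s₀ x))).const_smul (c * κ ^ j)
  refine (h1.add_const (if j = 0 then v else 0)).congr_deriv ?_
  have e : (U.toContinuousLinearEquiv.toContinuousLinearMap) (κ • d (j + 1) (κ * x + s₀)) =
      κ • U (d (j + 1) (κ * x + s₀)) := map_smul U _ _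
  rw [e, smul_smul, simChain, if_neg (Nat.succ_ne_zero j), add_zero, pow_succ, mul_assoc]

theorem derivChain_simChain (hκ : κ ≠ 0) {S : Set ℝ} {m : ℕ} (hd : DerivChain S m d) :
    DerivChain ((fun s => κ * s + s₀) ⁻¹' S) m (simChain c U v κ s₀ d) where
  countable := hd.countable.preimage_of_injOn (injective_affine hκ s₀).injOn
  continuous j hj := (((U.continuous.comp ((hd.continuous j hj).comp
    (continuous_affine κ s₀))).const_smul (c * κ ^ j))).add continuous_const
  hasDerivAt j hj _ hx := hasDerivAt_simChain (hd.hasDerivAt j hj _ hx)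

theorem simChain_succ (j : ℕ) : simChain c U v κ s₀ d (j + 1) = fun s =>
    (c * κ ^ (j + 1)) • U (d (j + 1) (κ * s + s₀)) := by
  funext s
  rw [simChain, if_neg (Nat.succ_ne_zero j), add_zero]

theorem simChain_succ_eq_zero_iff (hc : c ≠ 0) (hκ : κ ≠ 0) (j : ℕ) {s : ℝ} :
    simChain c U v κ s₀ d (j + 1) s = 0 ↔ d (j + 1) (κ * s + s₀) = 0 := by
  simp [simChain_succ, hc, hκ]

theorem norm_simChain_one (hc : |κ| * c = 1) (hc0 : 0 < c) (hd : ∀ s, ‖d 1 s‖ = 1) (s : ℝ) :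
    ‖simChain c U v κ s₀ d 1 s‖ = 1 := by
  rw [simChain_succ, norm_smul, LinearIsometryEquiv.norm_map, hd, zero_add, pow_one,
    Real.norm_eq_abs, abs_mul, abs_of_pos hc0, mul_one, mul_comm, hc]

theorem simChain_succ_measurable {j : ℕ} (h : StronglyMeasurable (d (j + 1))) :
    StronglyMeasurable (simChain c U v κ s₀ d (j + 1)) := by
  rw [simChain_succ]
  have h1 : StronglyMeasurable fun s => U (d (j + 1) (κ * s + s₀)) :=
    U.continuous.comp_stronglyMeasurable (h.comp_measurable (continuous_affine κ s₀).measurable)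
  exact h1.const_smul (c * κ ^ (j + 1))

theorem tendsto_affine_nhdsNE (hκ : κ ≠ 0) (s₀ x : ℝ) :
    Tendsto (fun s => κ * s + s₀) (𝓝[≠] x) (𝓝[≠] (κ * x + s₀)) :=
  tendsto_nhdsWithin_iff.2 ⟨((continuous_affine κ s₀).tendsto x).mono_left nhdsWithin_le_nhds, by
    filter_upwards [self_mem_nhdsWithin] with t ht h
    exact ht (injective_affine hκ s₀ h)⟩

theorem abs_affine_rpow (κ s₀ t x τ : ℝ) :
    |κ * t + s₀ - (κ * x + s₀)| ^ τ = |κ| ^ τ * |t - x| ^ τ := by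
  rw [← Real.mul_rpow (abs_nonneg _) (abs_nonneg _), ← abs_mul]
  ring_nf

theorem simChain_succ_isBigO (hκ : κ ≠ 0) {j : ℕ} {τ : ℝ}
    (h : ∀ x, d (j + 1) =O[𝓝[≠] x] fun t => |t - x| ^ τ) (x : ℝ) :
    simChain c U v κ s₀ d (j + 1) =O[𝓝[≠] x] fun t => |t - x| ^ τ := by
  have h1 := (h (κ * x + s₀)).comp_tendsto (tendsto_affine_nhdsNE hκ s₀ x)
  simp only [Function.comp_def, abs_affine_rpow] at h1
  have h2 := h1.trans (isBigO_const_mul_self _ _ _)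
  rw [simChain_succ]
  have h3 : (fun s => U (d (j + 1) (κ * s + s₀))) =O[𝓝[≠] x] fun t => |t - x| ^ τ :=
    IsBigO.trans (IsBigO.of_bound 1 (Eventually.of_forall fun s => by
      rw [LinearIsometryEquiv.norm_map, one_mul])) h2
  exact h3.const_smul_left (c * κ ^ (j + 1))

theorem isBigO_simChain_succ (hc : c ≠ 0) (hκ : κ ≠ 0) {j : ℕ} {τ x : ℝ} {l : Filter ℝ}
    (h : (fun t => |t - (κ * x + s₀)| ^ τ) =O[map (fun s => κ * s + s₀) l] d (j + 1)) :
    (fun t => |t - x| ^ τ) =O[l] simChain c U v κ s₀ d (j + 1) := by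
  have h1 := h.comp_tendsto tendsto_map
  simp only [Function.comp_def, abs_affine_rpow] at h1
  have h0 : |κ| ^ τ ≠ 0 := (Real.rpow_pos_of_pos (abs_pos.2 hκ) _).ne'
  have h2 := (isBigO_self_const_mul h0 (fun t => |t - x| ^ τ) l).trans h1
  rw [simChain_succ]
  have h3 : (c * κ ^ (j + 1)) ≠ 0 := mul_ne_zero hc (pow_ne_zero _ hκ)
  refine (isBigO_const_smul_right h3).2 ?_
  refine h2.trans (IsBigO.of_bound 1 (Eventually.of_forall fun s => ?_))
  rw [LinearIsometryEquiv.norm_map, one_mul]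

/-- A unit speed piece of a unit speed curve differs from it by an affine reparameterization. -/
theorem IsPieceOf.exists_affine {γ : ℝ → Plane} {J : Set ℝ} {δ₀ δ : ℝ → Plane}
    (h : IsPieceOf L γ J δ₀) (hL : 0 < L) (harc : IsArclength L γ) (hJ : EqOn δ₀ δ J)
    (hδ : ∀ s, ∃ w : Plane, HasDerivAt δ w s ∧ ‖w‖ = 1) :
    ∃ (c : ℝ) (U : Plane ≃ₗᵢ[ℝ] Plane) (v : Plane) (κ s₀ : ℝ), 0 < c ∧ |κ| * c = 1 ∧
      ∀ s ∈ Icc 0 L, γ s = c • U (δ (κ * s + s₀)) + v := by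
  obtain ⟨c, U, v, φ, hc, hφ, hφ0, hφJ, hγ⟩ := h
  have hu := uniqueDiffOn_Icc hL
  have hγ' : ∀ s ∈ Icc 0 L, γ s = c • U (δ (φ s)) + v := fun s hs => by
    rw [hγ s hs, hJ (hφJ hs)]
  have hd : ∀ s ∈ Icc 0 L, HasDerivWithinAt φ (derivWithin φ (Icc 0 L) s) (Icc 0 L) s :=
    fun s hs => (hφ.differentiableOn one_ne_zero s hs).hasDerivWithinAt
  -- Both curves have unit speed, so comparing velocities determines `|φ'|`.
  have hsq : ∀ s ∈ Icc 0 L, c * |derivWithin φ (Icc 0 L) s| = 1 := by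
    intro s hs
    obtain ⟨w, hw, hw1⟩ := hδ (φ s)
    have h1 := ((U.toContinuousLinearEquiv.toContinuousLinearMap.hasFDerivAt.comp_hasDerivWithinAt s
      (hw.scomp_hasDerivWithinAt s (hd s hs))).const_smul c).add_const v
    have h2 : HasDerivWithinAt γ (c • U (derivWithin φ (Icc 0 L) s • w)) (Icc 0 L) s :=
      h1.congr hγ' (hγ' s hs)
    have h3 := harc s hs
    rw [velocity, h2.derivWithin (hu s hs), norm_smul, LinearIsometryEquiv.norm_map, norm_smul, hw1,
      Real.norm_eq_abs, Real.norm_eq_abs, abs_of_pos hc, mul_one] at h3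
    exact h3
  have hcont : ContinuousOn (derivWithin φ (Icc 0 L)) (Icc 0 L) :=
    hφ.continuousOn_derivWithin hu le_rfl
  have hconst : ∃ κ : ℝ, ∀ s ∈ Icc 0 L, derivWithin φ (Icc 0 L) s = κ := by
    have hpre : IsPreconnected (Icc 0 L) := isPreconnected_Icc
    -- A continuous function with constant nonzero square on an interval cannot change sign.
    rcases hpre.eq_or_eq_neg_of_sq_eq hcont (g := fun _ => c⁻¹) continuousOn_const (by
      intro s hs
      have := hsq s hs
      simp only [Pi.pow_apply]
      rw [← sq_abs, eq_inv_of_mul_eq_one_right this]) (fun _ => by positivity) with h | h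
    · exact ⟨c⁻¹, h⟩
    · exact ⟨-c⁻¹, h⟩
  obtain ⟨κ, hκ⟩ := hconst
  have hκc : |κ| * c = 1 := by
    have h0 : (0 : ℝ) ∈ Icc 0 L := ⟨le_rfl, hL.le⟩
    rw [mul_comm, ← hκ 0 h0, hsq 0 h0]
  refine ⟨c, U, v, κ, φ 0, hc, hκc, fun s hs => ?_⟩
  have hlin : ∀ t ∈ Icc 0 L, HasDerivWithinAt (fun s => φ s - κ * s) 0 (Icc 0 L) t := fun t ht => by
    have h1 := (hd t ht).sub ((hasDerivAt_id t).const_mul κ).hasDerivWithinAt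
    rw [hκ t ht, mul_one, sub_self] at h1
    exact h1
  have := constant_of_derivWithin_zero (fun t ht => (hlin t ht).differentiableWithinAt)
    (fun t ht => (hlin t (Ico_subset_Icc_self ht)).derivWithin (hu t (Ico_subset_Icc_self ht))) s hs
  rw [hγ' s hs]
  have e : φ s = κ * s + φ 0 := by
    simp only [mul_zero, sub_zero] at this
    linarith
  rw [e]

/-- The two conditions say that `b` is both orthogonal and parallel to the unit vector `a`. -/
theorem eq_zero_of_det_eq_zero {a b : Plane} (ha : ‖a‖ = 1) (hab : inner ℝ a b = 0)
    (h : a 0 * b 1 - a 1 * b 0 = 0) : b = 0 := by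
  have h1 : a 0 ^ 2 + a 1 ^ 2 = 1 := by
    have := EuclideanSpace.norm_sq_eq a
    rw [ha, Fin.sum_univ_two] at this
    simpa using this.symm
  have h2 : a 0 * b 0 + a 1 * b 1 = 0 := by
    rw [PiLp.inner_apply, Fin.sum_univ_two] at hab
    simp at hab
    linarith
  ext i
  fin_cases i
  · simp
    linear_combination (-b 0) * h1 + a 0 * h2 - a 1 * h
  · simp
    linear_combination (-b 1) * h1 + a 1 * h2 + a 0 * h

/-- For a unit speed curve of class `C²`, the curvature vanishes exactly where the second derivative
does. -/
theorem curvature_eq_zero_iff {γ : ℝ → Plane} {D : ℕ → ℝ → Plane} (hL : 0 < L)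
    (hγ : EqOn γ (D 0) (Icc 0 L)) (h0 : ∀ x, HasDerivAt (D 0) (D 1 x) x)
    (h1 : ∀ x, HasDerivAt (D 1) (D 2 x) x) (hn : ∀ x, ‖D 1 x‖ = 1) {s : ℝ} (hs : s ∈ Icc 0 L) :
    curvature L γ s = 0 ↔ D 2 s = 0 := by
  have hu := uniqueDiffOn_Icc hL
  have hv : EqOn (velocity L γ) (D 1) (Icc 0 L) := fun t ht =>
    ((h0 t).hasDerivWithinAt.congr hγ (hγ ht)).derivWithin (hu t ht)
  have ha : acceleration L γ s = D 2 s :=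
    ((h1 s).hasDerivWithinAt.congr hv (hv hs)).derivWithin (hu s hs)
  rw [curvature, hv hs, ha, hn, one_pow, div_one]
  -- Differentiate the constant `‖D 1‖ ^ 2`.
  have hinner : inner ℝ (D 1 s) (D 2 s) = 0 := by
    have h2 := (h1 s).norm_sq
    have h3 : (fun x => ‖D 1 x‖ ^ 2) = fun _ => (1 : ℝ) := by
      funext x; rw [hn, one_pow]
    have h4 : HasDerivAt (fun x => ‖D 1 x‖ ^ 2) 0 s := by rw [h3]; exact hasDerivAt_const s 1
    have := h2.unique h4
    linarith
  refine ⟨fun h => eq_zero_of_det_eq_zero (hn s) hinner h, fun h => by rw [h]; simp⟩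

end Similarity

/-! ### Regularity of analytic and wavelike curves -/

section Regularity

variable {p L : ℝ} {γ : ℝ → Plane}

theorem IsPieceOf.analyticOn {δ : ℝ → Plane} (h : IsPieceOf L γ univ δ) (hL : 0 < L)
    (harc : IsArclength L γ) (hδ : ∀ s, ∃ w : Plane, HasDerivAt δ w s ∧ ‖w‖ = 1)
    (ha : ∀ s, AnalyticAt ℝ δ s) : AnalyticOn ℝ γ (Icc 0 L) := by
  obtain ⟨c, U, v, κ, s₀, -, -, hγ⟩ := h.exists_affine hL harc (fun _ _ => rfl) hδ
  have h1 : ∀ s, AnalyticAt ℝ (fun s => c • U (δ (κ * s + s₀)) + v) s := fun s => by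
    have e1 : AnalyticAt ℝ (fun s : ℝ => κ * s + s₀) s :=
      (analyticAt_const.mul analyticAt_id).add analyticAt_const
    have e2 : AnalyticAt ℝ (fun s => δ (κ * s + s₀)) s := AnalyticAt.comp (ha _) e1
    have e3 : AnalyticAt ℝ (fun s => U (δ (κ * s + s₀))) s :=
      (U.toContinuousLinearEquiv.toContinuousLinearMap.analyticAt _).comp e2
    have e4 : AnalyticAt ℝ (fun _ : ℝ => c) s := analyticAt_const
    exact (e4.smul e3).add analyticAt_const
  exact AnalyticOn.congr (fun s _ => (h1 s).analyticWithinAt) hγ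

theorem nonempty_of_frontier_nonempty {X : Type*} [TopologicalSpace X] {Z : Set X}
    (h : (frontier Z).Nonempty) : Z.Nonempty := by
  rw [nonempty_iff_ne_empty]
  rintro rfl
  simp at h

theorem exists_onesided_filter (hL : 0 < L) {x : ℝ} (hx : x ∈ Icc 0 L) :
    ∃ l : Filter ℝ, (l = 𝓝[<] x ∨ l = 𝓝[>] x) ∧ ∀ᶠ t in l, t ∈ Ioo 0 L := by
  rcases hx.2.lt_or_eq with h | h
  · exact ⟨𝓝[>] x, Or.inr rfl, by
      filter_upwards [Ioo_mem_nhdsGT h] with t ht using ⟨hx.1.trans_lt ht.1, ht.2⟩⟩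
  · subst h
    exact ⟨𝓝[<] x, Or.inl rfl, Ioo_mem_nhdsLT hL⟩

theorem onesided_le_nhdsNE {x : ℝ} {l : Filter ℝ} (hl : l = 𝓝[<] x ∨ l = 𝓝[>] x) :
    l ≤ 𝓝[≠] x := by
  rcases hl with rfl | rfl
  · exact nhdsWithin_mono _ fun _ h => ne_of_lt h
  · exact nhdsWithin_mono _ fun _ h => ne_of_gt h

theorem ne_zero_of_abs_mul_eq_one {κ c : ℝ} (h : |κ| * c = 1) : κ ≠ 0 := by
  rintro rfl
  simp at h

theorem IsWavelike.memSobolev (h : IsWavelike p L γ) (hp : 2 < p) (hL : 0 < L)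
    (harc : IsArclength L γ) (hZ : (curvatureZeros L γ).Nonempty) :
    (∀ r : ℝ, 1 ≤ r → r < (p - 1) / (p - 2) → MemSobolev L 3 (ENNReal.ofReal r) γ) ∧
      ¬ MemSobolev L 3 (ENNReal.ofReal ((p - 1) / (p - 2))) γ := by
  obtain ⟨q, hq, hpiece⟩ := h
  have hW := derivChain_waveChain hp hq
  obtain ⟨c, U, v, κ, s₀, hc, hκc, hγ⟩ := hpiece.exists_affine hL harc (fun _ _ => rfl)
    fun s => ⟨_, hW.hasDerivAt_all (j := 0) (by norm_num) s, norm_waveChain_one hq s⟩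
  have hκ := ne_zero_of_abs_mul_eq_one hκc
  have hD := derivChain_simChain (c := c) (U := U) (v := v) (s₀ := s₀) hκ hW
  have hγ' : EqOn γ (simChain c U v κ s₀ (waveChain p q) 0) (Icc 0 L) := fun s hs => by
    rw [hγ s hs]; simp [simChain, waveChain]
  have hγo := hγ'.mono Ioo_subset_Icc_self
  have hp1 : 0 < p - 1 := by linarith
  have hp2 : 0 < p - 2 := by linarith
  have hO := simChain_succ_isBigO (c := c) (U := U) (v := v) (s₀ := s₀) hκ (waveChain_isBigO hp hq)
  have hmeas : StronglyMeasurable (simChain c U v κ s₀ (waveChain p q) 3) := by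
    apply simChain_succ_measurable
    exact ((continuous_waveHeight hp hq).measurable.abs.pow_const _).stronglyMeasurable.smul
      (continuous_waveFactor hp hq).stronglyMeasurable
  have hmem : ∀ r : ℝ, 1 ≤ r → r < (p - 1) / (p - 2) →
      MemLp (simChain c U v κ s₀ (waveChain p q) 3) (ENNReal.ofReal r)
        (volume.restrict (Ioo 0 L)) := by
    intro r h1 h2
    refine memLp_of_isBigO_rpow h1 ?_ hmeas.aestronglyMeasurable hO 0 L
    rw [lt_div_iff₀ hp2] at h2
    rw [div_mul_eq_mul_div, div_lt_one hp1]
    linarith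
  refine ⟨fun r h1 h2 => hD.memSobolev hL.le (by norm_num) hγo (by simpa using h1) (hmem r h1 h2),
    ?_⟩
  have hR : 1 < (p - 1) / (p - 2) := by rw [one_lt_div hp2]; linarith
  have hint : IntegrableOn (simChain c U v κ s₀ (waveChain p q) 3) (Ioo 0 L) := by
    have := hmem 1 le_rfl hR
    rwa [ENNReal.ofReal_one, memLp_one_iff_integrable] at this
  refine hD.not_memSobolev hL.le hγo (by simpa using hR.le) hint ?_
  -- A single zero of the curvature already destroys integrability at the critical exponent. If it
  -- is an end point of `[0, L]`, the interior side is used.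
  obtain ⟨⟨x, hx⟩, hxZ⟩ := hZ
  have hx0 : Real.cos (am1 p q (κ * x + s₀)) = 0 := by
    rw [← waveChain_two_eq_zero_iff hq, ← simChain_succ_eq_zero_iff (c := c) (U := U) (v := v)
      hc.ne' hκ]
    exact (curvature_eq_zero_iff hL hγ' (hD.hasDerivAt_all (by norm_num))
      (hD.hasDerivAt_all (by norm_num)) (norm_simChain_one hκc hc (norm_waveChain_one hq)) hx).1 hxZ
  obtain ⟨l, hl, hl'⟩ := exists_onesided_filter hL hx
  refine not_memLp_of_rpow_isBigO hl (by linarith) (τ := (p - 2) / (p - 1)) (by field_simp) hl' ?_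
  exact isBigO_simChain_succ hc.ne' hκ ((isBigO_waveChain hp hq hx0).mono
    (map_le_iff_le_comap.2 ((onesided_le_nhdsNE hl).trans
      (map_le_iff_le_comap.1 (tendsto_affine_nhdsNE hκ s₀ x)))))

end Regularity

/-! ### The zeros of the curvature of a flat-core curve -/

/-- The point is the infimum of the part of the union lying in `[b, s]`. It belongs to no `O i`,
since openness would allow a smaller element, and by finiteness of the family it is in the closure
of a single `O i`. -/
theorem exists_first_mem {O : ℕ → Set ℝ} {n : ℕ} (hO : ∀ i, IsOpen (O i)) {b s : ℝ} (hbs : b < s)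
    (hb : ∀ i ≤ n, b ∉ O i) (hs : ∃ i ≤ n, s ∈ O i) :
    ∃ x, b ≤ x ∧ (∀ t ∈ Icc b x, ∀ i ≤ n, t ∉ O i) ∧
      ∃ i ≤ n, x ∈ closure (O i) ∧ ∃ t ∈ O i, x < t ∧ t ≤ s := by
  set T : Set ℝ := ⋃ i ∈ Finset.range (n + 1), (Icc b s ∩ O i) with hT
  have memT : ∀ {t}, t ∈ T ↔ ∃ i ≤ n, t ∈ Icc b s ∧ t ∈ O i := by
    intro t
    simp only [hT, mem_iUnion, Finset.mem_range, mem_inter_iff, Nat.lt_succ_iff, exists_prop]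
  have hsT : s ∈ T := by
    obtain ⟨i, hi, h⟩ := hs
    exact memT.2 ⟨i, hi, ⟨hbs.le, le_rfl⟩, h⟩
  have hbdd : BddBelow T := ⟨b, fun t ht => (memT.1 ht).choose_spec.2.1.1⟩
  have hbx : b ≤ sInf T := le_csInf ⟨s, hsT⟩ fun t ht => (memT.1 ht).choose_spec.2.1.1
  have hxs : sInf T ≤ s := csInf_le hbdd hsT
  have hx : ∀ i ≤ n, sInf T ∉ O i := by
    intro i hi hmem
    have hne : b < sInf T := lt_of_le_of_ne hbx fun h => hb i hi (h ▸ hmem)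
    have h0 : ∀ᶠ t in 𝓝 (sInf T), t ∈ O i := (hO i).mem_nhds hmem
    have h1 : ∀ᶠ t in 𝓝[<] (sInf T), t ∈ O i ∧ t ∈ Ioo b (sInf T) :=
      (h0.filter_mono nhdsWithin_le_nhds).and (Ioo_mem_nhdsLT hne)
    obtain ⟨t, ht, ht'⟩ := h1.exists
    exact absurd (csInf_le hbdd (memT.2 ⟨i, hi, ⟨ht'.1.le, (ht'.2.trans_le hxs).le⟩, ht⟩))
      (not_le.2 ht'.2)
  refine ⟨sInf T, hbx, fun t ht i hi hti => ?_, ?_⟩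
  · rcases ht.2.lt_or_eq with h | h
    · exact notMem_of_lt_csInf h hbdd (memT.2 ⟨i, hi, ⟨ht.1, h.le.trans hxs⟩, hti⟩)
    · exact hx i hi (h ▸ hti)
  · have hcl := csInf_mem_closure ⟨s, hsT⟩ hbdd
    rw [hT, Finset.closure_biUnion, ← hT] at hcl
    simp only [mem_iUnion, Finset.mem_range, Nat.lt_succ_iff, exists_prop] at hcl
    obtain ⟨i, hi, hxi⟩ := hcl
    refine ⟨i, hi, closure_mono inter_subset_right hxi, ?_⟩
    obtain ⟨t, ht, hti⟩ := closure_nonempty_iff.1 ⟨_, hxi⟩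
    refine ⟨t, hti, lt_of_le_of_ne (csInf_le hbdd (memT.2 ⟨i, hi, ht, hti⟩)) fun h => ?_, ht.2⟩
    exact hx i hi (h ▸ hti)

theorem exists_last_mem {O : ℕ → Set ℝ} {n : ℕ} (hO : ∀ i, IsOpen (O i)) {b s : ℝ} (hbs : s < b)
    (hb : ∀ i ≤ n, b ∉ O i) (hs : ∃ i ≤ n, s ∈ O i) :
    ∃ x, x ≤ b ∧ (∀ t ∈ Icc x b, ∀ i ≤ n, t ∉ O i) ∧
      ∃ i ≤ n, x ∈ closure (O i) ∧ ∃ t ∈ O i, t < x ∧ s ≤ t := by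
  -- Reflection reduces this to the first entry point.
  obtain ⟨x, h1, h2, i, hi, h3, t, h4, h5, h6⟩ := exists_first_mem
    (O := fun i => Neg.neg ⁻¹' O i) (n := n) (fun i => (hO i).preimage continuous_neg)
    (neg_lt_neg hbs) (by simpa using hb) (by simpa using hs)
  refine ⟨-x, by linarith, fun t ht i hi => ?_, i, hi, ?_, -t, h4, by linarith, by linarith⟩
  · have := h2 (-t) ⟨by linarith [ht.2], by linarith [ht.1]⟩ i hi
    simpa using this
  · exact map_mem_closure continuous_neg h3 fun _ h => h

section FlatCoreZeros

variable {p L κ s₀ : ℝ} {ℓ : ℕ → ℝ}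

theorem affine_mem_loopInterval (hκ : κ ≠ 0) {i : ℕ} {x t u : ℝ}
    (hx : κ * x + s₀ ∈ Icc (flatCenter p ℓ i - ellK p) (flatCenter p ℓ i + ellK p))
    (ht : κ * t + s₀ ∈ loopInterval p ℓ i) (hu : u ∈ Ioo x t ∨ u ∈ Ioo t x) :
    κ * u + s₀ ∈ loopInterval p ℓ i := by
  have h1 := hx.1
  have h2 := hx.2
  have h3 := ht.1
  have h4 := ht.2
  rcases lt_or_gt_of_ne hκ with hk | hk
  · rcases hu with hu | hu <;>
      have h5 := mul_lt_mul_of_neg_left hu.1 hk <;> have h6 := mul_lt_mul_of_neg_left hu.2 hk <;>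
      constructor <;> linarith
  · rcases hu with hu | hu <;>
      have h5 := mul_lt_mul_of_pos_left hu.1 hk <;> have h6 := mul_lt_mul_of_pos_left hu.2 hk <;>
      constructor <;> linarith

theorem isOpen_affine_preimage (i : ℕ) :
    IsOpen ((fun s => κ * s + s₀) ⁻¹' loopInterval p ℓ i) :=
  isOpen_Ioo.preimage (continuous_affine κ s₀)

theorem affine_mem_Icc_of_mem_closure {i : ℕ} {x : ℝ}
    (hx : x ∈ closure ((fun s => κ * s + s₀) ⁻¹' loopInterval p ℓ i)) :
    κ * x + s₀ ∈ Icc (flatCenter p ℓ i - ellK p) (flatCenter p ℓ i + ellK p) :=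
  closure_minimal Ioo_subset_Icc_self isClosed_Icc
    ((continuous_affine κ s₀).closure_preimage_subset _ hx)

theorem affine_sub_flatCenter {i : ℕ} {x : ℝ}
    (hx : x ∈ closure ((fun s => κ * s + s₀) ⁻¹' loopInterval p ℓ i))
    (hx' : κ * x + s₀ ∉ loopInterval p ℓ i) :
    κ * x + s₀ - flatCenter p ℓ i = -ellK p ∨ κ * x + s₀ - flatCenter p ℓ i = ellK p := by
  have h := affine_mem_Icc_of_mem_closure hx
  rcases h.1.lt_or_eq with h1 | h1
  · rcases h.2.lt_or_eq with h2 | h2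
    · exact absurd ⟨h1, h2⟩ hx'
    · right; linarith
  · left; linarith

theorem finite_frontier_affine_preimage (hκ : κ ≠ 0) (i : ℕ) :
    (frontier ((fun s => κ * s + s₀) ⁻¹' loopInterval p ℓ i)).Finite := by
  refine (((finite_singleton (flatCenter p ℓ i + ellK p)).insert
    (flatCenter p ℓ i - ellK p)).preimage (injective_affine hκ s₀).injOn).subset fun x hx => ?_
  rw [(isOpen_affine_preimage i).frontier_eq] at hx
  rcases affine_sub_flatCenter hx.1 hx.2 with h | h
  · left; linarith
  · right; rw [mem_singleton_iff]; linarith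

theorem exists_onesided_mem (hκ : κ ≠ 0) {i : ℕ} {x t : ℝ} (hx : x ∈ Icc 0 L) (ht : t ∈ Icc 0 L)
    (hxc : x ∈ closure ((fun s => κ * s + s₀) ⁻¹' loopInterval p ℓ i))
    (hx' : κ * x + s₀ ∉ loopInterval p ℓ i) (hti : κ * t + s₀ ∈ loopInterval p ℓ i) :
    ∃ l : Filter ℝ, (l = 𝓝[<] x ∨ l = 𝓝[>] x) ∧
      (∀ᶠ u in l, u ∈ Ioo 0 L) ∧ ∀ᶠ u in l, κ * u + s₀ ∈ loopInterval p ℓ i := by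
  have hxI := affine_mem_Icc_of_mem_closure hxc
  rcases lt_trichotomy x t with h | h | h
  · refine ⟨𝓝[>] x, Or.inr rfl, ?_, ?_⟩ <;> filter_upwards [Ioo_mem_nhdsGT h] with u hu
    · exact ⟨hx.1.trans_lt hu.1, hu.2.trans_le ht.2⟩
    · exact affine_mem_loopInterval hκ hxI hti (Or.inl hu)
  · exact absurd (h ▸ hti) hx'
  · refine ⟨𝓝[<] x, Or.inl rfl, ?_, ?_⟩ <;> filter_upwards [Ioo_mem_nhdsLT h] with u hu
    · exact ⟨ht.1.trans_lt hu.1, hu.2.trans_le hx.2⟩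
    · exact affine_mem_loopInterval hκ hxI hti (Or.inr hu)

end FlatCoreZeros

/-! ### Complements of finitely many open sets in a compact interval -/

section Complements

variable {L : ℝ} {n : ℕ} {O : ℕ → Set ℝ} {Z : Set (Icc (0 : ℝ) L)}

/-- The set `Z` is closed in `[0, L]`, so a boundary point lies in it and also in the closure of its
complement, a finite union. Taking the closure relative to `[0, L]` provides a point `t` of the
curve in the open set, which rules out loops met only outside the curve. -/
theorem exists_mem_closure_of_frontier_nonempty
    (hZ : ∀ s : Icc (0 : ℝ) L, s ∈ Z ↔ ∀ i ≤ n, (s : ℝ) ∉ O i) (hO : ∀ i, IsOpen (O i))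
    (h : (frontier Z).Nonempty) :
    ∃ x ∈ Icc 0 L, (∀ i ≤ n, x ∉ O i) ∧ ∃ i ≤ n, x ∈ closure (O i) ∧ ∃ t ∈ Icc 0 L, t ∈ O i := by
  have hc : Zᶜ = ⋃ i ∈ Finset.range (n + 1), ((↑) : Icc (0 : ℝ) L → ℝ) ⁻¹' O i := by
    ext s
    simp [hZ]
  have hcl : IsClosed Z := by
    rw [← isOpen_compl_iff, hc]
    exact isOpen_biUnion fun i _ => (hO i).preimage continuous_subtype_val
  obtain ⟨x, hx⟩ := h
  rw [frontier_eq_closure_inter_closure, hcl.closure_eq, hc, Finset.closure_biUnion] at hx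
  obtain ⟨hx1, hx2⟩ := hx
  simp only [mem_iUnion, Finset.mem_range, Nat.lt_succ_iff, exists_prop] at hx2
  obtain ⟨i, hi, hxi⟩ := hx2
  refine ⟨x, x.2, (hZ x).1 hx1, i, hi, map_mem_closure continuous_subtype_val hxi fun _ h => h, ?_⟩
  obtain ⟨t, ht⟩ := closure_nonempty_iff.1 ⟨_, hxi⟩
  exact ⟨t, t.2, ht⟩

theorem not_isDiscrete_of_Icc_subset {a b : Icc (0 : ℝ) L} (hab : a < b) (h : Icc a b ⊆ Z) :
    ¬ IsDiscrete Z := by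
  intro hd
  obtain ⟨U, hU, hUZ⟩ := isDiscrete_iff_forall_mem_exists_isOpen.1 hd a (h ⟨le_rfl, hab.le⟩)
  obtain ⟨V, hV, rfl⟩ := isOpen_induced_iff.1 hU
  have haV : (a : ℝ) ∈ V := (hUZ.ge rfl : a ∈ _ ∩ Z).1
  have h1 : ∀ᶠ u in 𝓝[>] (a : ℝ), u ∈ V := nhdsWithin_le_nhds (hV.mem_nhds haV)
  obtain ⟨u, huV, hu⟩ := (h1.and (Ioo_mem_nhdsGT (show (a : ℝ) < b from hab))).exists
  have huI : u ∈ Icc 0 L := ⟨a.2.1.trans hu.1.le, hu.2.le.trans b.2.2⟩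
  have : (⟨u, huI⟩ : Icc (0 : ℝ) L) ∈ ({a} : Set _) :=
    hUZ.le ⟨huV, h ⟨hu.1.le, hu.2.le⟩⟩
  exact hu.1.ne' (congrArg Subtype.val this)

/-- If every point of `Z` adheres to some `O i`, then `Z` is contained in finitely many finite
frontiers, so it is finite and discrete. Otherwise some point has a neighbourhood missing all the `O
i`, and an interval in it can be taken on a side that stays in `[0, L]`. -/
theorem exists_Icc_subset_of_not_isDiscrete (hL : 0 < L)
    (hZ : ∀ s : Icc (0 : ℝ) L, s ∈ Z ↔ ∀ i ≤ n, (s : ℝ) ∉ O i)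
    (hO : ∀ i, (frontier (O i)).Finite) (h : ¬ IsDiscrete Z) :
    ∃ a b : Icc (0 : ℝ) L, a < b ∧ Icc a b ⊆ Z := by
  by_cases hall : ∀ s ∈ Z, ∃ i ≤ n, (s : ℝ) ∈ closure (O i)
  · refine absurd (Set.Finite.isDiscrete ?_) h
    refine Finite.subset (Finite.preimage Subtype.val_injective.injOn
      ((Finset.range (n + 1)).finite_toSet.biUnion fun i _ => hO i)) fun s hs => ?_
    obtain ⟨i, hi, hsi⟩ := hall s hs
    simp only [mem_preimage, mem_iUnion]
    exact ⟨i, by simpa [Nat.lt_succ_iff] using hi,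
      hsi, fun h' => (hZ s).1 hs i hi (interior_subset h')⟩
  · push Not at hall
    obtain ⟨x, -, hxc⟩ := hall
    have hU : ∀ᶠ u in 𝓝 (x : ℝ), ∀ i ∈ Finset.range (n + 1), u ∉ closure (O i) :=
      (Filter.eventually_all_finset _).2 fun i hi =>
        isClosed_closure.isOpen_compl.mem_nhds (hxc i (Nat.le_of_lt_succ (Finset.mem_range.1 hi)))
    have key : ∀ a b : ℝ, a < b → a ∈ Icc 0 L → b ∈ Icc 0 L →
        Icc a b ⊆ {u | ∀ i ∈ Finset.range (n + 1), u ∉ closure (O i)} →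
        ∃ a b : Icc (0 : ℝ) L, a < b ∧ Icc a b ⊆ Z := fun a b hab ha hb hs =>
      ⟨⟨a, ha⟩, ⟨b, hb⟩, hab, fun s hss => (hZ s).2 fun i hi h' =>
        hs ⟨hss.1, hss.2⟩ i (Finset.mem_range.2 (Nat.lt_succ_of_le hi)) (subset_closure h')⟩
    rcases x.2.2.lt_or_eq with hx | hx
    · obtain ⟨u, hu, hus⟩ := mem_nhdsGE_iff_exists_Icc_subset.1
        (inter_mem (nhdsWithin_le_nhds hU) (Icc_mem_nhdsGE hx))
      exact key x u hu x.2 ⟨x.2.1.trans hu.le, (hus ⟨hu.le, le_rfl⟩).2.2⟩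
        (hus.trans inter_subset_left)
    · have hx0 : (0 : ℝ) < x := by rw [hx]; exact hL
      obtain ⟨u, hu, hus⟩ := mem_nhdsLE_iff_exists_Icc_subset.1
        (inter_mem (nhdsWithin_le_nhds hU) (Icc_mem_nhdsLE hx0))
      exact key u x hu ⟨(hus ⟨le_rfl, hu.le⟩).2.1, hu.le.trans x.2.2⟩ x.2
        (hus.trans inter_subset_left)

end Complements

/-! ### Regularity of flat-core curves -/

section FlatCoreRegularity

variable {p L : ℝ} {γ : ℝ → Plane}

theorem lt_loopExp_of_lt_expM {j : ℕ} (hj : j < expM p) : (j : ℝ) < loopExp p :=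
  Nat.lt_ceil.1 hj

theorem loopExp_le_expM (p : ℝ) : loopExp p ≤ expM p := Nat.le_ceil _

theorem one_le_expM (hp : 2 < p) : 1 ≤ expM p := Nat.ceil_pos.2 (loopExp_pos hp)

theorem one_lt_expR (hp : 2 < p) (hz : ¬ ∃ z : ℤ, 2 / (p - 2) = (z : ℝ)) : 1 < expR p := by
  have h1 : (expM p : ℝ) < loopExp p + 1 := Nat.ceil_lt_add_one (loopExp_pos hp).le
  have h2 : loopExp p ≠ expM p := fun h => hz ⟨expM p, by exact_mod_cast h⟩
  have h3 : loopExp p < expM p := lt_of_le_of_ne (loopExp_le_expM p) h2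
  exact (one_lt_inv₀ (sub_pos.2 h3)).2 (by change (expM p : ℝ) - loopExp p < 1; linarith)

theorem loopExp_eq_expM (hp : 2 < p) (hz : ∃ z : ℤ, 2 / (p - 2) = (z : ℝ)) :
    loopExp p = expM p := by
  obtain ⟨z, hz⟩ := hz
  have h0 : (0 : ℝ) < z := hz ▸ loopExp_pos hp
  lift z to ℕ using by exact_mod_cast h0.le
  rw [loopExp, expM, hz]
  simp

variable {σ ℓ : ℕ → ℝ} {n : ℕ} {c κ s₀ : ℝ} {U : Plane ≃ₗᵢ[ℝ] Plane} {v : Plane}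

theorem memLp_simChain_flatChain (hp : 2 < p) (hκ : κ ≠ 0) (hz : ¬ ∃ z : ℤ, 2 / (p - 2) = (z : ℝ))
    {r : ℝ} (h1 : 1 ≤ r) (h2 : r < expR p) :
    MemLp (simChain c U v κ s₀ (flatChain p σ ℓ n) (expM p + 2)) (ENNReal.ofReal r)
      (volume.restrict (Ioo 0 L)) := by
  have hR := one_lt_expR hp hz
  refine memLp_of_isBigO_rpow h1 ?_
    (simChain_succ_measurable (j := expM p + 1) (measurable_flatChain hp n _)).aestronglyMeasurable
    (simChain_succ_isBigO (j := expM p + 1) hκ (flatChain_isBigO hp n (loopExp_le_expM p))) 0 L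
  have h3 : 0 < (expM p : ℝ) - loopExp p := inv_pos.1 (zero_lt_one.trans hR)
  have h4 : r < ((expM p : ℝ) - loopExp p)⁻¹ := h2
  rwa [lt_inv_comm₀ (by linarith) h3, ← one_div, lt_div_iff₀ (by linarith)] at h4

theorem memLp_top_simChain_flatChain (hp : 2 < p) (hz : ∃ z : ℤ, 2 / (p - 2) = (z : ℝ)) :
    MemLp (simChain c U v κ s₀ (flatChain p σ ℓ n) (expM p + 2)) ⊤
      (volume.restrict (Ioo 0 L)) := by
  obtain ⟨C, hC⟩ := exists_flatChain_bound (σ := σ) (ℓ := ℓ) hp n (loopExp_eq_expM hp hz)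
  refine memLp_top_of_bound
    (simChain_succ_measurable (j := expM p + 1)
      (measurable_flatChain hp n _)).aestronglyMeasurable (|c * κ ^ (expM p + 2)| * C)
    (Eventually.of_forall fun s => ?_)
  rw [simChain_succ, norm_smul, LinearIsometryEquiv.norm_map, Real.norm_eq_abs]
  exact mul_le_mul_of_nonneg_left (hC _) (abs_nonneg _)

/-- The point `x` is the end of a loop whose interior the curve enters on one side, and on that side
the singularity is the exact power. The behaviour on the other side is irrelevant. -/
theorem not_memSobolev_flatChain (hp : 2 < p) (hL : 0 ≤ L) (hc : c ≠ 0) (hκ : κ ≠ 0)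
    (hσ : ∀ j, σ j = 1 ∨ σ j = -1) (hℓ : ∀ j, 0 ≤ ℓ j) (hz : ¬ ∃ z : ℤ, 2 / (p - 2) = (z : ℝ))
    (hγ : EqOn γ (simChain c U v κ s₀ (flatChain p σ ℓ n) 0) (Ioo 0 L)) {i : ℕ} (hi : i ≤ n)
    {x t : ℝ} (hx : x ∈ Icc 0 L) (ht : t ∈ Icc 0 L)
    (hxc : x ∈ closure ((fun s => κ * s + s₀) ⁻¹' loopInterval p ℓ i))
    (hx' : κ * x + s₀ ∉ loopInterval p ℓ i) (hti : κ * t + s₀ ∈ loopInterval p ℓ i) :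
    ¬ MemSobolev L (expM p + 2) (ENNReal.ofReal (expR p)) γ := by
  have hR := one_lt_expR hp hz
  have hD := derivChain_simChain (c := c) (U := U) (v := v) (s₀ := s₀) hκ
    (derivChain_flatChain (σ := σ) (ℓ := ℓ) hp n fun _ hj => lt_loopExp_of_lt_expM hj)
  have hint := memLp_simChain_flatChain (c := c) (U := U) (v := v) (s₀ := s₀) (σ := σ) (ℓ := ℓ)
    (n := n) (L := L) hp hκ hz le_rfl hR
  rw [ENNReal.ofReal_one, memLp_one_iff_integrable] at hint
  refine hD.not_memSobolev hL hγ (by simpa using hR.le) hint ?_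
  obtain ⟨l, hl, hlL, hli⟩ := exists_onesided_mem hκ hx ht hxc hx' hti
  have h3 : (expM p : ℝ) - loopExp p ≠ 0 := (inv_pos.1 (zero_lt_one.trans hR)).ne'
  refine not_memLp_of_rpow_isBigO hl (by linarith) (τ := expM p - loopExp p)
    (mul_inv_cancel₀ h3) hlL ?_
  refine isBigO_simChain_succ (j := expM p + 1) hc hκ ?_
  have hne : Tendsto (fun s => s - flatCenter p ℓ i) (map (fun s => κ * s + s₀) l)
      (𝓝[≠] (κ * x + s₀ - flatCenter p ℓ i)) := by
    have := (tendsto_affine_nhdsNE hκ (s₀ - flatCenter p ℓ i) x).mono_left (onesided_le_nhdsNE hl)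
    rw [tendsto_map'_iff]
    simpa only [Function.comp_def, add_sub_assoc] using this
  have hbig := isBigO_loopChain hp (hσ i) (loopExp_le_expM p)
    (fun _ hj => lt_loopExp_of_lt_expM hj) (affine_sub_flatCenter hxc hx') hne
    (eventually_map.2 (eventually_map.2 (hli.mono fun u hu => mem_loopInterval.1 hu)))
  refine (hbig.comp_tendsto tendsto_map).congr' (Eventually.of_forall fun u => ?_)
    (eventually_map.2 (hli.mono fun u hu => ?_))
  · simp only [Function.comp_apply, sub_sub_sub_cancel_right]
  · exact (flatChain_of_mem hp hℓ hi hu _).symm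

/-- For an integer exponent the singular power has become `|Y| ^ 0`, so inside the loop the top
derivative is a smooth function of the angle. It extends to a `C¹` function on the line whose value
at the loop end is nonzero: one side of the jump. -/
theorem exists_loop_eq (hp : 2 < p) (hz : ∃ z : ℤ, 2 / (p - 2) = (z : ℝ)) (hc : c ≠ 0) (hκ : κ ≠ 0)
    (hσ : ∀ j, σ j = 1 ∨ σ j = -1) (hℓ : ∀ j, 0 ≤ ℓ j) {i : ℕ} (hi : i ≤ n)
    {x : ℝ} (hx' : κ * x + s₀ ∉ loopInterval p ℓ i) :
    ∃ A A' : ℝ → Plane, (∀ x, HasDerivAt A (A' x) x) ∧ Continuous A' ∧ A x ≠ 0 ∧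
      ∀ u, κ * u + s₀ ∈ loopInterval p ℓ i →
        simChain c U v κ s₀ (flatChain p σ ℓ n) (expM p + 2) u = A u := by
  -- Only the entries of index zero and one are used: the factor along the loop and its derivative.
  let d : ℕ → ℝ → Plane := fun j s => if j = 0 then
    loopFactor p (σ i) (expM p) (loopAngle p s) else
    Real.cos (loopAngle p s) ^ (2 / p) • deriv (loopFactor p (σ i) (expM p)) (loopAngle p s)
  have hk : c * κ ^ (expM p + 2) ≠ 0 := mul_ne_zero hc (pow_ne_zero _ hκ)
  refine ⟨simChain (c * κ ^ (expM p + 2)) U 0 κ (s₀ - flatCenter p ℓ i) d 0,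
    simChain (c * κ ^ (expM p + 2)) U 0 κ (s₀ - flatCenter p ℓ i) d 1,
    fun y => hasDerivAt_simChain (hasDerivAt_loopFactor_loopAngle hp _ _), ?_, ?_, fun u hu => ?_⟩
  · rw [simChain_succ]
    exact (U.continuous.comp ((continuous_deriv_loopFactor_loopAngle hp (expM p)).comp
      (continuous_affine κ (s₀ - flatCenter p ℓ i)))).const_smul
        (c * κ ^ (expM p + 2) * κ ^ (0 + 1))
  · have h1 := loopFactor_ne_zero hp (hσ i) (cos_loopAngle_of_notMem hp
      fun h => hx' (mem_loopInterval.2 h)) fun _ hj => lt_loopExp_of_lt_expM hj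
    rw [add_sub_assoc] at h1
    simpa [simChain, d, hc, hκ] using h1
  · rw [simChain_succ, simChain]
    beta_reduce
    rw [flatChain_of_mem hp hℓ hi hu, loopChain_of_mem_of_eq (loopExp_eq_expM hp hz)
      (mem_loopInterval.1 hu), add_sub_assoc]
    simp [d]

/-- Going from `[a, b]` towards `s`, at the first loop met the top derivative passes from zero to a
nonzero limit. Nondegeneracy of `[a, b]` puts the jump inside `(0, L)` with zeros on a whole side of
it; where two loops abut, the one-sided limits may agree. -/
theorem not_memSobolev_succ_flatChain (hp : 2 < p) (hL : 0 < L) (hc : c ≠ 0) (hκ : κ ≠ 0)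
    (hσ : ∀ j, σ j = 1 ∨ σ j = -1) (hℓ : ∀ j, 0 ≤ ℓ j) (hz : ∃ z : ℤ, 2 / (p - 2) = (z : ℝ))
    (hγ : EqOn γ (simChain c U v κ s₀ (flatChain p σ ℓ n) 0) (Ioo 0 L))
    {a b s : ℝ} (hab : a < b) (ha : a ∈ Icc 0 L) (hb : b ∈ Icc 0 L) (hs : s ∈ Icc 0 L)
    (hZ : ∀ u ∈ Icc a b, ∀ i ≤ n, κ * u + s₀ ∉ loopInterval p ℓ i)
    (hsZ : ∃ i ≤ n, κ * s + s₀ ∈ loopInterval p ℓ i) :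
    ¬ MemSobolev L (expM p + 3) 1 γ := by
  have hD := derivChain_simChain (c := c) (U := U) (v := v) (s₀ := s₀) hκ
    (derivChain_flatChain (σ := σ) (ℓ := ℓ) hp n fun _ hj => lt_loopExp_of_lt_expM hj)
  have hint : IntegrableOn (simChain c U v κ s₀ (flatChain p σ ℓ n) (expM p + 2)) (Ioo 0 L) :=
    (memLp_top_simChain_flatChain hp hz).integrable le_top
  have h0 : ∀ u, (∀ i ≤ n, κ * u + s₀ ∉ loopInterval p ℓ i) →
      simChain c U v κ s₀ (flatChain p σ ℓ n) (expM p + 2) u = 0 := fun u hu =>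
    (simChain_succ_eq_zero_iff (j := expM p + 1) hc hκ).2 (flatChain_of_notMem hu _)
  have hO := fun i => isOpen_affine_preimage (p := p) (ℓ := ℓ) (κ := κ) (s₀ := s₀) i
  have hsab : b < s ∨ s < a := by
    by_contra! h
    obtain ⟨i, hi, hsi⟩ := hsZ
    exact hZ s ⟨h.2, h.1⟩ i hi hsi
  rcases hsab with hlt | hlt
  · obtain ⟨x, hbx, hx0, i, hi, hxc, t, hti, hxt, hts⟩ :=
      exists_first_mem hO hlt (hZ b ⟨hab.le, le_rfl⟩) hsZ
    have hx' := hx0 x ⟨hbx, le_rfl⟩ i hi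
    obtain ⟨A, A', hA, hA', hAx, hAu⟩ := exists_loop_eq (U := U) (v := v) hp hz hc hκ hσ hℓ hi hx'
    refine hD.not_memSobolev_succ hL.le hγ hint (x₀ := x)
      ⟨ha.1.trans_lt (hab.trans_le hbx), hxt.trans_le (hts.trans hs.2)⟩
      (fun y => hasDerivAt_const y (0 : Plane)) hA continuous_const hA' hAx.symm ?_ ?_
    · filter_upwards [Ioo_mem_nhdsLT (hab.trans_le hbx)] with u hu
      refine h0 u ?_
      rcases le_total u b with h | h
      · exact hZ u ⟨hu.1.le, h⟩
      · exact hx0 u ⟨h, hu.2.le⟩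
    · filter_upwards [Ioo_mem_nhdsGT hxt] with u hu
      exact hAu u (affine_mem_loopInterval hκ (affine_mem_Icc_of_mem_closure hxc) hti (Or.inl hu))
  · obtain ⟨x, hbx, hx0, i, hi, hxc, t, hti, hxt, hts⟩ :=
      exists_last_mem hO hlt (hZ a ⟨le_rfl, hab.le⟩) hsZ
    have hx' := hx0 x ⟨le_rfl, hbx⟩ i hi
    obtain ⟨A, A', hA, hA', hAx, hAu⟩ := exists_loop_eq (U := U) (v := v) hp hz hc hκ hσ hℓ hi hx'
    refine hD.not_memSobolev_succ hL.le hγ hint (x₀ := x)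
      ⟨(hs.1.trans hts).trans_lt hxt, (hbx.trans_lt hab).trans_le hb.2⟩
      hA (fun y => hasDerivAt_const y (0 : Plane)) hA' continuous_const hAx ?_ ?_
    · filter_upwards [Ioo_mem_nhdsLT hxt] with u hu
      exact hAu u (affine_mem_loopInterval hκ (affine_mem_Icc_of_mem_closure hxc) hti (Or.inr hu))
    · filter_upwards [Ioo_mem_nhdsGT (hbx.trans_lt hab)] with u hu
      refine h0 u ?_
      rcases le_total a u with h | h
      · exact hZ u ⟨h, hu.2.le⟩
      · exact hx0 u ⟨hu.1.le, h⟩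

theorem IsFlatCore.memSobolev (h : IsFlatCore p L γ) (hp : 2 < p) (hL : 0 < L)
    (harc : IsArclength L γ) (hZ : (frontier (curvatureZeros L γ)).Nonempty) :
    ((¬ ∃ z : ℤ, 2 / (p - 2) = (z : ℝ)) →
        (∀ r : ℝ, 1 ≤ r → r < expR p → MemSobolev L (expM p + 2) (ENNReal.ofReal r) γ) ∧
          ¬ MemSobolev L (expM p + 2) (ENNReal.ofReal (expR p)) γ) ∧
      ((∃ z : ℤ, 2 / (p - 2) = (z : ℝ)) →
        MemSobolev L (expM p + 2) ⊤ γ ∧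
        (¬ IsDiscrete (curvatureZeros L γ) ↔
          ∃ a b : Icc (0 : ℝ) L, a < b ∧ Icc a b ⊆ curvatureZeros L γ) ∧
        (¬ IsDiscrete (curvatureZeros L γ) → ¬ MemSobolev L (expM p + 3) 1 γ)) := by
  obtain ⟨n, σ, ℓ, hσ, hℓ, hpiece⟩ := h
  have hF := derivChain_flatChain (σ := σ) (ℓ := ℓ) hp n fun _ hj => lt_loopExp_of_lt_expM hj
  obtain ⟨c, U, v, κ, s₀, hc, hκc, hγ⟩ := hpiece.exists_affine hL harc
    (fun s _ => congrFun (flatCoreProfile_curve hp hℓ n) s)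
    fun s => ⟨_, hF.hasDerivAt_all (j := 0) (by omega) s, norm_flatChain_one hp hσ hℓ n s⟩
  have hκ := ne_zero_of_abs_mul_eq_one hκc
  have hD := derivChain_simChain (c := c) (U := U) (v := v) (s₀ := s₀) hκ hF
  have hγ' : EqOn γ (simChain c U v κ s₀ (flatChain p σ ℓ n) 0) (Icc 0 L) := fun s hs => by
    rw [hγ s hs]; simp [simChain]
  have hγo := hγ'.mono Ioo_subset_Icc_self
  have hM := one_le_expM hp
  have hZ' : ∀ s : Icc (0 : ℝ) L, s ∈ curvatureZeros L γ ↔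
      ∀ i ≤ n, (s : ℝ) ∉ (fun s => κ * s + s₀) ⁻¹' loopInterval p ℓ i := fun s => by
    refine (curvature_eq_zero_iff hL hγ' (hD.hasDerivAt_all (by omega))
      (hD.hasDerivAt_all (by omega)) (norm_simChain_one hκc hc (norm_flatChain_one hp hσ hℓ n))
      s.2).trans ?_
    rw [simChain_succ_eq_zero_iff hc.ne' hκ, flatChain_two_eq_zero_iff hp hσ hℓ]
    rfl
  -- The nonempty boundary supplies an end `x` of a loop and a point `t` of the curve inside that
  -- loop. The non-integer case uses both, and the jump argument needs only `t`.
  obtain ⟨x, hx, hx', i, hi, hxc, t, ht, hti⟩ :=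
    exists_mem_closure_of_frontier_nonempty hZ' (fun i => isOpen_affine_preimage i) hZ
  refine ⟨fun hz => ⟨fun r h1 h2 => hD.memSobolev hL.le (by omega) hγo (by simpa using h1)
    (memLp_simChain_flatChain hp hκ hz h1 h2), not_memSobolev_flatChain hp hL.le hc.ne' hκ hσ hℓ hz
      hγo hi hx ht hxc (hx' i hi) hti⟩, fun hz => ?_⟩
  have hdisc : ¬ IsDiscrete (curvatureZeros L γ) →
      ∃ a b : Icc (0 : ℝ) L, a < b ∧ Icc a b ⊆ curvatureZeros L γ :=
    exists_Icc_subset_of_not_isDiscrete hL hZ' fun i => finite_frontier_affine_preimage hκ i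
  refine ⟨hD.memSobolev hL.le (by omega) hγo le_top (memLp_top_simChain_flatChain hp hz),
    ⟨hdisc, fun ⟨a, b, hab, h⟩ => not_isDiscrete_of_Icc_subset hab h⟩, fun hnd => ?_⟩
  obtain ⟨a, b, hab, h⟩ := hdisc hnd
  exact not_memSobolev_succ_flatChain hp hL hc.ne' hκ hσ hℓ hz hγo hab a.2 b.2 ht
    (fun u hu => (hZ' ⟨u, a.2.1.trans hu.1, hu.2.trans b.2.2⟩).1 (h ⟨hu.1, hu.2⟩)) ⟨i, hi, hti⟩

end FlatCoreRegularity

end PElastica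

end

/-! ### The regularity theorem. -/

theorem theorem1p5 (p : ℝ) (hp : 2 < p) (L : ℝ) (hL : 0 < L)
    (γ : ℝ → PElastica.Plane) (hγ : PElastica.IsPElastica p L γ)
    (harc : PElastica.IsArclength L γ) :
    (PElastica.IsLinear L γ ∨ PElastica.IsOrbitlike p L γ ∨ PElastica.IsCircular L γ →
      AnalyticOn ℝ γ (Set.Icc 0 L)) ∧
    ((frontier (PElastica.curvatureZeros L γ)).Nonempty →
      (PElastica.IsWavelike p L γ →
        (∀ r : ℝ, 1 ≤ r → r < (p - 1) / (p - 2) →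
          PElastica.MemSobolev L 3 (ENNReal.ofReal r) γ) ∧
        ¬ PElastica.MemSobolev L 3 (ENNReal.ofReal ((p - 1) / (p - 2))) γ) ∧
      (PElastica.IsFlatCore p L γ →
        1 ≤ PElastica.expM p ∧
        ((¬ ∃ z : ℤ, 2 / (p - 2) = (z : ℝ)) →
          1 < PElastica.expR p ∧
          (∀ r : ℝ, 1 ≤ r → r < PElastica.expR p →
            PElastica.MemSobolev L (PElastica.expM p + 2) (ENNReal.ofReal r) γ) ∧
          ¬ PElastica.MemSobolev L (PElastica.expM p + 2)
              (ENNReal.ofReal (PElastica.expR p)) γ) ∧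
        ((∃ z : ℤ, 2 / (p - 2) = (z : ℝ)) →
          PElastica.MemSobolev L (PElastica.expM p + 2) ⊤ γ ∧
          (¬ IsDiscrete (PElastica.curvatureZeros L γ) ↔
            ∃ a b : Set.Icc (0 : ℝ) L, a < b ∧
              Set.Icc a b ⊆ PElastica.curvatureZeros L γ) ∧
          (¬ IsDiscrete (PElastica.curvatureZeros L γ) →
            ¬ PElastica.MemSobolev L (PElastica.expM p + 3) 1 γ)))) := by
  refine ⟨?_, fun hZ => ⟨fun h => h.memSobolev hp hL harc
    (PElastica.nonempty_of_frontier_nonempty hZ), fun h => ?_⟩⟩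
  · rintro (h | ⟨q, hq, h⟩ | h)
    · exact h.analyticOn hL harc PElastica.exists_hasDerivAt_linearProfile
        PElastica.analyticAt_linearProfile
    · exact h.analyticOn hL harc (PElastica.exists_hasDerivAt_orbitlikeProfile hp hq)
        (PElastica.analyticAt_orbitlikeProfile hp hq)
    · exact h.analyticOn hL harc PElastica.exists_hasDerivAt_circularProfile
        PElastica.analyticAt_circularProfile
  · obtain ⟨h1, h2⟩ := h.memSobolev hp hL harc hZ
    exact ⟨PElastica.one_le_expM hp, fun hz => ⟨PElastica.one_lt_expR hp hz, h1 hz⟩, h2⟩
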